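/- **Model.** A *graph* is a finite connected simple graph without node labels in which the edges at each node $v$ carry distinct port numbers $1,\dots,\deg v$. An *initial configuration* is $(G,S,\mathrm{Id},\mathbf w)$, where $G$ is a graph, $S$ is a non-empty finite multiset of nodes (the agents' starting nodes), $\mathrm{Id}$ gives the agents distinct positive integer identities, and $\mathbf w$ gives each agent an input in $\{0,1\}^*$. A *protocol* is a computable deterministic state machine with unlimited memory, the same for all agents, and initially knowing only the agent's own identity and input (and its certificate, if there is one). Agents act in synchronous rounds: in each round an agent perceives its entry port, the degree of its node, and the identities of the agents at that node, exchanges all information with them, and then stays or leaves by a port. An agent may at some round decide "yes" or "no", and then stops. **Problems.** A *decision problem* $\Pi$ is a set of initial configurations, posed for a set of instances containing it (by default all configurations), such that both sets are recognized by algorithms and are invariant under port-preserving isomorphisms. It is *uniform* if in all its instances all agents have the same input. $\Pi$ is *mobile agents verifiable* ($\Pi\in\mathrm{MAV}$) if there is a protocol such that on every instance, for every certificate $\mathbf x:S\to\{0,1\}^*$, all agents eventually decide, and: if the instance is in $\Pi$, then for some $\mathbf x$ all agents decide "yes"; if it is not in $\Pi$, then for every $\mathbf x$ at least one agent decides "no".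 $\Pi$ is *reducible* to a uniform problem $\Pi'$ if some protocol (without certificates), whose agents may make finitely many calls to a black box that on a string $w$ answers whether $(G,S,\mathrm{Id},w)\in\Pi'$, makes all agents decide on every instance of $\Pi$, all of them "yes" if the instance is in $\Pi$, and at least one of them "no" otherwise. A problem is *MAV-complete* if it is in MAV and every problem in MAV is reducible to it. **The problem $\Omega$.** The *view* from a node $v$ is the infinite port-labeled rooted tree of all walks from $v$. The *quotient graph* $\widehat G$ has as nodes the classes of nodes of $G$ with equal views, with an edge between classes $x$ and $y$ (possibly equal) labeled $p$ at $x$ and $q$ at $y$ whenever $G$ has an edge $\{u,v\}$ with $u\in x$, $v\in y$, port $p$ at $u$ and port $q$ at $v$. Let $\mathtt{teamsize}=\{(G,S,\mathrm{Id},k): |S|>k\}$ with $k$ a positive integer, let $\mathtt{quotient}=\{(G,S,\mathrm{Id},H):\widehat G\not\cong H\}$ with $H$ a finite graph, possibly with loops and multiple edges, with labels at both ends of each edge (two edges differ in their ends or in their labels), and let $\Omega=\mathtt{teamsize}\times\mathtt{quotient}$ be the uniform problem (its instances are all configurations with identical inputs) consisting of the configurations with common input $(1,k)$ such that $(G,S,\mathrm{Id},k)\in\mathtt{teamsize}$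 and those with common input $(2,H)$ such that $(G,S,\mathrm{Id},H)\in\mathtt{quotient}$. **Theorem 2.** $\Omega=\mathtt{teamsize}\times\mathtt{quotient}$ is MAV-complete. Moreover, $\Omega$ has a verification protocol for which, on every configuration in $\Omega$, all agents decide "yes" when each of them is given the same certificate, namely the number of nodes of $G$. -/

import Mathlib

namespace MobileAgents

/-! Port-labeled graphs -/

/-- A finite connected simple graph whose edges at each node `v` are numbered by ports
`1, …, deg v`; the index `p : Fin (deg v)` stands for the port number `p + 1`. Port numbers at
different nodes are unrelated. -/
structure PortGraph where
  size : ℕ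
  graph : SimpleGraph (Fin size)
  connected : graph.Connected
  deg : Fin size → ℕ
  port : (v : Fin size) → Fin (deg v) ≃ graph.neighborSet v

namespace PortGraph

/-- The edge leaving `v` by its port of index `p`: the other end, and the port number there. -/
def arc (G : PortGraph) (v : Fin G.size) (p : Fin (G.deg v)) : Fin G.size × ℕ :=
  ((G.port v p).1, ((G.port (G.port v p).1).symm ⟨v, (G.port v p).2.symm⟩ : ℕ) + 1)

/-- Leaving `v` by port number `p`: the node reached and the entry port number there
(`none` if `v` has no port number `p`). -/
def cross (G : PortGraph) (v : Fin G.size) (p : ℕ) : Option (Fin G.size × ℕ) :=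
  if h : 1 ≤ p ∧ p ≤ G.deg v then some (G.arc v ⟨p - 1, by omega⟩) else none

/-- Isomorphism preserving adjacency and port numbers. -/
structure Iso (G H : PortGraph) where
  toEquiv : Fin G.size ≃ Fin H.size
  cross_eq : ∀ v p, H.cross (toEquiv v) p = (G.cross v p).map fun e => (toEquiv e.1, e.2)

/-- Adjacency lists with port numbers, as finite data for algorithms. -/
def code (G : PortGraph) : List (List (ℕ × ℕ)) :=
  List.ofFn fun v => List.ofFn fun p => ((G.arc v p).1.val, (G.arc v p).2)

theorem cross_symm (G : PortGraph) {u v : Fin G.size} {p q : ℕ}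
    (h : G.cross u p = some (v, q)) : G.cross v q = some (u, p) := by
  unfold cross at h
  split_ifs at h with hp
  simp only [Option.some.injEq, arc, Prod.mk.injEq] at h
  obtain ⟨rfl, rfl⟩ := h
  have hp' : p - 1 < G.deg u := by omega
  unfold cross
  rw [dif_pos ⟨by omega, Fin.isLt _⟩]
  have key : ∀ (v : Fin G.size) (h : G.graph.Adj v u) (z : G.graph.neighborSet v),
      z = ⟨u, h⟩ → ((z.1, ((G.port z.1).symm ⟨v, z.2.symm⟩ : ℕ) + 1) : Fin G.size × ℕ) =
        (u, ((G.port u).symm ⟨v, h.symm⟩ : ℕ) + 1) := by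
    rintro v h z rfl
    rfl
  have e := key _ (G.port u ⟨p - 1, hp'⟩).2.symm
    (G.port _ ((G.port (G.port u ⟨p - 1, hp'⟩).1).symm
      ⟨u, (G.port u ⟨p - 1, hp'⟩).2.symm⟩)) (Equiv.apply_symm_apply _ _)
  refine congrArg some (e.trans ?_)
  refine Prod.ext rfl ?_
  show (((G.port u).symm (G.port u ⟨p - 1, hp'⟩) : Fin _) : ℕ) + 1 = p
  rw [Equiv.symm_apply_apply]
  show p - 1 + 1 = p
  omega

end PortGraph

/-! Views and quotient graphs -/

/-- Finite rooted trees with port labels: the root has children number `1, …, d`, in the order of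
the ports at the root; `entry p` is the port number at the child's end of the edge. Two trees are
isomorphic (as rooted port-labeled trees) iff they are equal. -/
inductive View : Type
  | node (d : ℕ) (entry : Fin d → ℕ) (child : Fin d → View) : View

/-- The view from `v` truncated at depth `t`. -/
def PortGraph.truncView (G : PortGraph) : ℕ → Fin G.size → View
  | 0, _ => View.node 0 Fin.elim0 Fin.elim0
  | t + 1, v => View.node (G.deg v) (fun p => (G.arc v p).2)
      (fun p => G.truncView t (G.arc v p).1)

/-- Two nodes are equivalent when they have the same (infinite) view. -/
def PortGraph.viewSetoid (G : PortGraph) : Setoid (Fin G.size) where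
  r u v := ∀ t, G.truncView t u = G.truncView t v
  iseqv := ⟨fun _ _ => rfl, fun h t => (h t).symm, fun h k t => (h t).trans (k t)⟩

/-- A graph, possibly with loops and multiple edges, whose edges carry a label at each end:
`Edge x p y q` says that there is an edge between `x` and `y` with label `p` at `x` and `q` at
`y`. -/
structure LabeledGraph where
  Node : Type
  Edge : Node → ℕ → Node → ℕ → Prop
  symm : ∀ x p y q, Edge x p y q → Edge y q x p

/-- Label-preserving isomorphism. -/
def LabeledGraph.Isomorphic (Q H : LabeledGraph) : Prop :=
  ∃ φ : Q.Node ≃ H.Node, ∀ x p y q, Q.Edge x p y q ↔ H.Edge (φ x) p (φ y) q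

/-- The quotient graph. -/
def PortGraph.quotient (G : PortGraph) : LabeledGraph where
  Node := Quotient G.viewSetoid
  Edge x p y q := ∃ u v : Fin G.size,
    Quotient.mk G.viewSetoid u = x ∧ Quotient.mk G.viewSetoid v = y ∧ G.cross u p = some (v, q)
  symm := by
    rintro x p y q ⟨u, v, hu, hv, h⟩
    exact ⟨v, u, hv, hu, G.cross_symm h⟩

/-- A finite labeled graph written as a number `m` of nodes and a list of edges `(x, p, y, q)`. -/
abbrev GraphCode : Type := ℕ × List (ℕ × ℕ × ℕ × ℕ)

/-- The labeled graph on `0, …, m - 1` given by a code. -/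
def GraphCode.toGraph (H : GraphCode) : LabeledGraph where
  Node := Fin H.1
  Edge x p y q := (x.val, p, y.val, q) ∈ H.2 ∨ (y.val, q, x.val, p) ∈ H.2
  symm := fun _ _ _ _ h => h.symm

/-! Initial configurations -/

/-- Encoding of finite data as binary strings. -/
def bin {α : Type} [Encodable α] (a : α) : List Bool := Nat.bits (Encodable.encode a)

/-- An initial configuration. The non-empty multiset of starting nodes is indexed by
`Fin numAgents`. -/
structure Config where
  graph : PortGraph
  numAgents : ℕ
  numAgents_pos : 0 < numAgents
  start : Fin numAgents → Fin graph.size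
  ident : Fin numAgents → ℕ
  ident_pos : ∀ a, 0 < ident a
  ident_injective : Function.Injective ident
  input : Fin numAgents → List Bool

namespace Config

/-- The same configuration with other inputs. -/
def withInput (C : Config) (w : Fin C.numAgents → List Bool) : Config :=
  { C with input := w }

/-- All agents have the same input. -/
def Uniform (C : Config) : Prop := ∀ a b, C.input a = C.input b

/-- Configurations carried on each other by a port-preserving graph isomorphism (the indexing of
the agents is irrelevant). -/
def Equivalent (C D : Config) : Prop :=
  ∃ (α : PortGraph.Iso C.graph D.graph) (σ : Fin C.numAgents ≃ Fin D.numAgents),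
    ∀ a, D.start (σ a) = α.toEquiv (C.start a) ∧ D.ident (σ a) = C.ident a ∧
      D.input (σ a) = C.input a

/-- The finite data of a configuration, for algorithms: the graph, and for each agent its
starting node, identity and input. -/
def code (C : Config) : List (List (ℕ × ℕ)) × List (ℕ × ℕ × List Bool) :=
  (C.graph.code, List.ofFn fun a => ((C.start a).val, C.ident a, C.input a))

end Config

/-! Decision problems -/

/-- A problem: the initial configurations that are its instances, and those among them with answer
"yes". An unrestricted problem has all configurations as instances. -/
structure Problem where
  instances : Set Config
  yes : Set Config
  yes_subset : yes ⊆ instances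

/-- A set of configurations is recognized by an algorithm. -/
def Recognizable (Y : Set Config) : Prop :=
  ∃ f : List (List (ℕ × ℕ)) × List (ℕ × ℕ × List Bool) → Bool,
    Computable f ∧ ∀ C : Config, C ∈ Y ↔ f C.code = true

/-- A set of configurations does not depend on names of nodes. -/
def Invariant (Y : Set Config) : Prop :=
  ∀ C D : Config, C.Equivalent D → (C ∈ Y ↔ D ∈ Y)

/-- The class of all decision problems. -/
def IsDecisionProblem (A : Problem) : Prop :=
  Recognizable A.instances ∧ Recognizable A.yes ∧ Invariant A.instances ∧ Invariant A.yes

/-- All instances are configurations with identical inputs. -/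
def Problem.Uniform (A : Problem) : Prop := ∀ C ∈ A.instances, C.Uniform

/-- The uniform problem with a given set of positive instances, posed for all configurations
with identical inputs. -/
def uniformProblem (Y : Set Config) : Problem where
  instances := {C | C.Uniform}
  yes := {C | C.Uniform ∧ C ∈ Y}
  yes_subset := fun _ h => h.1

/-! Protocols and their executions -/

/-- A deterministic protocol: a computable state machine run by every agent.
* `init` gives the initial memory from the agent's identity, input and certificate;
* `verdict` tells whether the agent has decided, and how;
* `query` is the string submitted to the black box in the current round, if any;
* `next` takes the current memory, the entry port number (`0` if the agent did not move in the
  previous round), the degree of the current node, the answer of the black box to the current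
  query, and the list, in increasing order of identities, of the identities, entry ports and
  memories of all agents at the current node (agents that meet exchange all they know). It returns
  the new memory and the number of the port by which the agent leaves; any number that is not a
  port of the node, such as `0`, means staying. -/
structure Protocol where
  Mem : Type
  [primcodable : Primcodable Mem]
  init : ℕ × List Bool × List Bool → Mem
  verdict : Mem → Option Bool
  query : Mem → Option (List Bool)
  next : Mem × ℕ × ℕ × Option Bool × List (ℕ × ℕ × Mem) → Mem × ℕ
  init_computable : Computable init
  verdict_computable : Computable verdict
  query_computable : Computable query
  next_computable : Computable next

/-- The momentary situation of an agent: its node, entry port and memory. -/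
structure AgentState (G : PortGraph) (M : Type) where
  pos : Fin G.size
  entry : ℕ
  mem : M

namespace Protocol

/-- What agent `a` reads at its node about all agents located there (itself included). -/
def here (P : Protocol) (C : Config) (s : Fin C.numAgents → AgentState C.graph P.Mem)
    (a : Fin C.numAgents) : List (ℕ × ℕ × P.Mem) :=
  (((List.finRange C.numAgents).filter fun b => (s b).pos = (s a).pos).insertionSort
    fun b c => C.ident b ≤ C.ident c).map fun b => (C.ident b, (s b).entry, (s b).mem)

/-- One round for agent `a`. An agent that has decided stops, and remains at its node. -/
def step (P : Protocol) (C : Config) (oracle : List Bool → Bool)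
    (s : Fin C.numAgents → AgentState C.graph P.Mem) (a : Fin C.numAgents) :
    AgentState C.graph P.Mem :=
  if (P.verdict (s a).mem).isSome then ⟨(s a).pos, 0, (s a).mem⟩
  else
    let r := P.next ((s a).mem, (s a).entry, C.graph.deg (s a).pos,
      (P.query (s a).mem).map oracle, P.here C s a)
    match C.graph.cross (s a).pos r.2 with
    | some (v, q) => ⟨v, q, r.1⟩
    | none => ⟨(s a).pos, 0, r.1⟩

/-- The synchronous execution from the configuration `C`, with certificate `x` and a black box
`oracle`: the situation of all agents after `t` rounds. -/
def run (P : Protocol) (C : Config) (x : Fin C.numAgents → List Bool)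
    (oracle : List Bool → Bool) : ℕ → Fin C.numAgents → AgentState C.graph P.Mem
  | 0 => fun a => ⟨C.start a, 0, P.init (C.ident a, C.input a, x a)⟩
  | t + 1 => P.step C oracle (P.run C x oracle t)

/-- Agent `a` eventually decides `b` (`true` is "yes", `false` is "no"). -/
def Decides (P : Protocol) (C : Config) (x : Fin C.numAgents → List Bool)
    (oracle : List Bool → Bool) (a : Fin C.numAgents) (b : Bool) : Prop :=
  ∃ t, P.verdict (P.run C x oracle t a).mem = some b

end Protocol

/-! Verification, reduction, completeness -/

/-- The absence of a black box: every query gets the same answer. -/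
def noOracle : List Bool → Bool := fun _ => false

/-- `P` is a verification protocol for `A`: on every instance and for every certificate all agents
decide; a positive instance has a certificate for which all agents decide "yes"; on a negative
instance, for every certificate, some agent decides "no". -/
def Verifies (P : Protocol) (A : Problem) : Prop :=
  ∀ C ∈ A.instances,
    (∀ x a, ∃ b, P.Decides C x noOracle a b) ∧
    (C ∈ A.yes → ∃ x, ∀ a, P.Decides C x noOracle a true) ∧
    (C ∉ A.yes → ∀ x, ∃ a, P.Decides C x noOracle a false)

/-- The class of mobile agents verifiable problems. -/
def MAV : Set Problem := {A | IsDecisionProblem A ∧ ∃ P : Protocol, Verifies P A}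

open scoped Classical in
/-- The black box deciding `B` for agents started in `C`: on the string `w` it tells whether the
configuration `C` with common input `w` belongs to `B`. -/
noncomputable def blackBox (B : Problem) (C : Config) : List Bool → Bool :=
  fun w => decide (C.withInput (fun _ => w) ∈ B.yes)

/-- `A` is reducible to the uniform problem `B`: some protocol, without certificates, decides `A`
using a black box for `B`. (An agent makes at most one call per round and stops when it decides,
so the number of calls is finite.) -/
def Reducible (A B : Problem) : Prop :=
  B.Uniform ∧ ∃ P : Protocol, ∀ C ∈ A.instances,
    (∀ a, ∃ b, P.Decides C (fun _ => []) (blackBox B C) a b) ∧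
    (C ∈ A.yes → ∀ a, P.Decides C (fun _ => []) (blackBox B C) a true) ∧
    (C ∉ A.yes → ∃ a, P.Decides C (fun _ => []) (blackBox B C) a false)

/-- Completeness for a class of problems. -/
def Complete (K : Set Problem) (B : Problem) : Prop :=
  B ∈ K ∧ ∀ A ∈ K, Reducible A B

/-! The problem -/

/-- The input is a positive integer `k`, and there are more than `k` agents. -/
def teamsize : Set Config :=
  {C | ∃ k : ℕ, 0 < k ∧ (∀ a, C.input a = bin k) ∧ k < C.numAgents}

/-- The input is a labeled graph `H`, and the quotient of the graph is not (isomorphic to) `H`. -/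
def quotient : Set Config :=
  {C | ∃ H : GraphCode, (∀ a, C.input a = bin H) ∧ ¬ C.graph.quotient.Isomorphic H.toGraph}

/-- The product `Π₁ × ⋯ × Πₖ`: the input is `(i, w)` with `1 ≤ i ≤ k`, and the configuration with
input `w` is in `Πᵢ`. -/
def product (L : List (Set Config)) : Set Config :=
  {C | ∃ (i : Fin L.length) (w : Fin C.numAgents → List Bool),
    (∀ a, C.input a = bin ((i : ℕ) + 1, w a)) ∧ C.withInput w ∈ L.get i}

/-- `Ω = teamsize × quotient`. -/
def Omega : Problem := uniformProblem (product [teamsize, quotient])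

end MobileAgents

/-! An agent learns about its surroundings by following words of port numbers and noting, at the end
of each, the last entry port, the degree and the agents present. Two nodes have the same view iff
entry ports and degrees agree on all words (`truncView_eq_iff_same`), and by partition refinement on
pairs of nodes it suffices to compare words no longer than the product of the two sizes
(`Alike.same`). A coded graph is `Good` if its labels are port numbers, it is connected, and
distinct nodes have distinct views. The quotient of `G` is `H` iff `H` is good and some node of `G`
has the view of some node of `H` (`Good.of_isomorphic`, `Good.isomorphic`).

Both protocols are instances of `explorer`. Each pair of an identity and a word owns a time slot, in
which only the agent with that identity moves; it follows the word and returns. Thus every agent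
eventually sees the end of every word while all others are at home, and agents that have stopped
disturb nobody, because decisions are made at home between slots (`explorer_run`).

Membership in MAV: the certificate is used only as a bound for the words to be explored. Whatever it
is, an agent never counts more identities than there are agents, and its observations fit `H`
whenever `H` is the quotient, so no wrong "yes" occurs (`omegaAnswer_sound`). If it is the number of
nodes, the exploration reaches all agents and distinguishes the view from all views in `H`, so every
correct "yes" is found (`omegaAnswer_complete`).

Hardness: let `A` be verifiable. Each agent enumerates candidates, that is, codes of configurations
together with a quotient graph `H`, and accepts one that agrees with its record on sufficiently many
words and with the answers of the black box to "more than one agent?" and "quotient different from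
`H`?". The true configuration is accepted if nothing else is before. If there are at least two
agents, another agent is a landmark that breaks all symmetry, and an accepted candidate is
equivalent to the true configuration (`SeesAlike.equivalent`). If there is one agent, the common
quotient forces equal views at the starting nodes. A lone agent behaves identically from equal
views, so the certificate of one configuration works for the other, and `A` gives both the same
answer (`mem_yes_of_same`). In either case the answer for the candidate is correct. -/

namespace MobileAgents

/-! Automation for primitive recursive functions -/

attribute [fun_prop] Primrec
attribute [fun_prop] Primrec.const Primrec.comp

section PrimrecRules

variable {α β γ δ : Type*} [Primcodable α] [Primcodable β] [Primcodable γ] [Primcodable δ]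

@[fun_prop]
theorem primrec_id : Primrec (fun a : α => a) := Primrec.id

@[fun_prop]
theorem primrec_fst {f : α → β × γ} (hf : Primrec f) : Primrec (fun a => (f a).1) :=
  Primrec.fst.comp hf

@[fun_prop]
theorem primrec_snd {f : α → β × γ} (hf : Primrec f) : Primrec (fun a => (f a).2) :=
  Primrec.snd.comp hf

@[fun_prop]
theorem primrec_pair {f : α → β} {g : α → γ} (hf : Primrec f) (hg : Primrec g) :
    Primrec (fun a => (f a, g a)) :=
  Primrec.pair hf hg

@[fun_prop]
theorem primrec_add {f g : α → ℕ} (hf : Primrec f) (hg : Primrec g) :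
    Primrec (fun a => f a + g a) :=
  Primrec.nat_add.comp hf hg

@[fun_prop]
theorem primrec_mul {f g : α → ℕ} (hf : Primrec f) (hg : Primrec g) :
    Primrec (fun a => f a * g a) :=
  Primrec.nat_mul.comp hf hg

@[fun_prop]
theorem primrec_sub {f g : α → ℕ} (hf : Primrec f) (hg : Primrec g) :
    Primrec (fun a => f a - g a) :=
  Primrec.nat_sub.comp hf hg

@[fun_prop]
theorem primrec_max {f g : α → ℕ} (hf : Primrec f) (hg : Primrec g) :
    Primrec (fun a => max (f a) (g a)) :=
  Primrec.nat_max.comp hf hg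

@[fun_prop]
theorem primrec_div2 {f : α → ℕ} (hf : Primrec f) : Primrec (fun a => (f a).div2) :=
  Primrec.nat_div2.comp hf

@[fun_prop]
theorem primrec_bodd {f : α → ℕ} (hf : Primrec f) : Primrec (fun a => (f a).bodd) :=
  Primrec.nat_bodd.comp hf

@[fun_prop]
theorem primrec_unpair {f : α → ℕ} (hf : Primrec f) : Primrec (fun a => (f a).unpair) :=
  Primrec.unpair.comp hf

@[fun_prop]
theorem primrec_cond {c : α → Bool} {f g : α → β} (hc : Primrec c) (hf : Primrec f)
    (hg : Primrec g) : Primrec (fun a => cond (c a) (f a) (g a)) :=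
  Primrec.cond hc hf hg

@[fun_prop]
theorem primrec_and {f g : α → Bool} (hf : Primrec f) (hg : Primrec g) :
    Primrec (fun a => f a && g a) :=
  Primrec.and.comp hf hg

@[fun_prop]
theorem primrec_or {f g : α → Bool} (hf : Primrec f) (hg : Primrec g) :
    Primrec (fun a => f a || g a) :=
  Primrec.or.comp hf hg

@[fun_prop]
theorem primrec_not {f : α → Bool} (hf : Primrec f) : Primrec (fun a => !(f a)) :=
  Primrec.not.comp hf

@[fun_prop]
theorem primrec_decide_eq {f g : α → β} [∀ a, Decidable (f a = g a)] (hf : Primrec f)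
    (hg : Primrec g) : Primrec (fun a => decide (f a = g a)) := by
  classical
  exact (Primrec.eq.decide.comp hf hg).of_eq fun a => by congr

@[fun_prop]
theorem primrec_decide_lt {f g : α → ℕ} (hf : Primrec f) (hg : Primrec g) :
    Primrec (fun a => decide (f a < g a)) :=
  Primrec.nat_lt.decide.comp hf hg

@[fun_prop]
theorem primrec_encode {f : α → β} (hf : Primrec f) : Primrec (fun a => Encodable.encode (f a)) :=
  Primrec.encode.comp hf

@[fun_prop]
theorem primrec_decode {f : α → ℕ} (hf : Primrec f) :
    Primrec (fun a => (Encodable.decode (f a) : Option β)) :=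
  Primrec.decode.comp hf

@[fun_prop]
theorem primrec_ofNat {ε : Type*} [Denumerable ε] {f : α → ℕ} (hf : Primrec f) :
    Primrec (fun a => Denumerable.ofNat ε (f a)) :=
  (Primrec.ofNat ε).comp hf

@[fun_prop]
theorem primrec_some {f : α → β} (hf : Primrec f) : Primrec (fun a => some (f a)) :=
  Primrec.option_some.comp hf

@[fun_prop]
theorem primrec_getD {f : α → Option β} {g : α → β} (hf : Primrec f) (hg : Primrec g) :
    Primrec (fun a => (f a).getD (g a)) :=
  Primrec.option_getD.comp hf hg

@[fun_prop]
theorem primrec_bind {f : α → Option β} {g : α → β → Option γ} (hf : Primrec f)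
    (hg : Primrec (fun p : α × β => g p.1 p.2)) : Primrec (fun a => (f a).bind (g a)) :=
  Primrec.option_bind hf hg

@[fun_prop]
theorem primrec_option_map {f : α → Option β} {g : α → β → γ} (hf : Primrec f)
    (hg : Primrec (fun p : α × β => g p.1 p.2)) : Primrec (fun a => (f a).map (g a)) :=
  Primrec.option_map hf hg

@[fun_prop]
theorem primrec_elim {f : α → Option β} {d : α → γ} {g : α → β → γ} (hf : Primrec f)
    (hd : Primrec d) (hg : Primrec (fun p : α × β => g p.1 p.2)) :
    Primrec (fun a => (f a).elim (d a) (g a)) :=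
  (Primrec.option_casesOn hf hd hg).of_eq fun a => by cases f a <;> rfl

@[fun_prop]
theorem primrec_cons {f : α → β} {g : α → List β} (hf : Primrec f) (hg : Primrec g) :
    Primrec (fun a => f a :: g a) :=
  Primrec.list_cons.comp hf hg

@[fun_prop]
theorem primrec_append {f g : α → List β} (hf : Primrec f) (hg : Primrec g) :
    Primrec (fun a => f a ++ g a) :=
  Primrec.list_append.comp hf hg

@[fun_prop]
theorem primrec_length {f : α → List β} (hf : Primrec f) : Primrec (fun a => (f a).length) :=
  Primrec.list_length.comp hf

@[fun_prop]
theorem primrec_reverse {f : α → List β} (hf : Primrec f) : Primrec (fun a => (f a).reverse) :=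
  Primrec.list_reverse.comp hf

@[fun_prop]
theorem primrec_head? {f : α → List β} (hf : Primrec f) : Primrec (fun a => (f a).head?) :=
  Primrec.list_head?.comp hf

@[fun_prop]
theorem primrec_tail {f : α → List β} (hf : Primrec f) : Primrec (fun a => (f a).tail) :=
  Primrec.list_tail.comp hf

@[fun_prop]
theorem primrec_range {f : α → ℕ} (hf : Primrec f) : Primrec (fun a => List.range (f a)) :=
  Primrec.list_range.comp hf

@[fun_prop]
theorem primrec_getElem? {f : α → List β} {g : α → ℕ} (hf : Primrec f) (hg : Primrec g) :
    Primrec (fun a => (f a)[g a]?) :=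
  Primrec.list_getElem?.comp hf hg

@[fun_prop]
theorem primrec_map {f : α → List β} {g : α → β → γ} (hf : Primrec f)
    (hg : Primrec (fun p : α × β => g p.1 p.2)) : Primrec (fun a => (f a).map (g a)) :=
  Primrec.list_map hf hg

@[fun_prop]
theorem primrec_flatMap {f : α → List β} {g : α → β → List γ} (hf : Primrec f)
    (hg : Primrec (fun p : α × β => g p.1 p.2)) : Primrec (fun a => (f a).flatMap (g a)) :=
  Primrec.list_flatMap hf hg

@[fun_prop]
theorem primrec_foldl {f : α → List β} {g : α → γ} {h : α → γ → β → γ} (hf : Primrec f)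
    (hg : Primrec g) (hh : Primrec (fun p : α × γ × β => h p.1 p.2.1 p.2.2)) :
    Primrec (fun a => (f a).foldl (h a) (g a)) :=
  Primrec.list_foldl (h := fun a p => h a p.1 p.2) hf hg hh

@[fun_prop]
theorem primrec_foldr {f : α → List β} {g : α → γ} {h : α → β → γ → γ} (hf : Primrec f)
    (hg : Primrec g) (hh : Primrec (fun p : α × β × γ => h p.1 p.2.1 p.2.2)) :
    Primrec (fun a => (f a).foldr (h a) (g a)) :=
  Primrec.list_foldr (h := fun a p => h a p.1 p.2) hf hg hh

@[fun_prop]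
theorem primrec_all {f : α → List β} {g : α → β → Bool} (hf : Primrec f)
    (hg : Primrec (fun p : α × β => g p.1 p.2)) : Primrec (fun a => (f a).all (g a)) := by
  have : Primrec (fun a => (f a).foldr (fun b r => g a b && r) true) := by fun_prop
  refine this.of_eq fun a => ?_
  induction f a with
  | nil => rfl
  | cons b l ih => simp [ih]

@[fun_prop]
theorem primrec_any {f : α → List β} {g : α → β → Bool} (hf : Primrec f)
    (hg : Primrec (fun p : α × β => g p.1 p.2)) : Primrec (fun a => (f a).any (g a)) := by
  have : Primrec (fun a => (f a).foldr (fun b r => g a b || r) false) := by fun_prop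
  refine this.of_eq fun a => ?_
  induction f a with
  | nil => rfl
  | cons b l ih => simp [ih]

@[fun_prop]
theorem primrec_filter {f : α → List β} {g : α → β → Bool} (hf : Primrec f)
    (hg : Primrec (fun p : α × β => g p.1 p.2)) : Primrec (fun a => (f a).filter (g a)) := by
  have : Primrec (fun a => (f a).flatMap (fun b => cond (g a b) [b] [])) := by fun_prop
  refine this.of_eq fun a => ?_
  induction f a with
  | nil => rfl
  | cons b l ih =>
    rw [List.flatMap_cons, ih]
    by_cases h : g a b = true <;> simp [h]

@[fun_prop]
theorem primrec_nat_rec {f : α → ℕ} {g : α → β} {h : α → ℕ → β → β} (hf : Primrec f)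
    (hg : Primrec g) (hh : Primrec (fun p : α × ℕ × β => h p.1 p.2.1 p.2.2)) :
    Primrec (fun a => Nat.rec (motive := fun _ => β) (g a) (h a) (f a)) :=
  Primrec.nat_rec' (h := fun a p => h a p.1 p.2) hf hg hh

@[fun_prop]
theorem primrec_nat_iterate {f : α → ℕ} {g : α → β} {h : α → β → β} (hf : Primrec f)
    (hg : Primrec g) (hh : Primrec (fun p : α × β => h p.1 p.2)) :
    Primrec (fun a => (h a)^[f a] (g a)) :=
  Primrec.nat_iterate hf hg hh

end PrimrecRules

/-! Binary strings -/

/-- The number with a given binary expansion, least significant digit first. -/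
def ofBits (s : List Bool) : ℕ := s.foldr (fun b n => bif b then n + n + 1 else n + n) 0

theorem ofBits_bits (n : ℕ) : ofBits n.bits = n := by
  induction n using Nat.binaryRec' with
  | zero => simp [ofBits]
  | bit b n h ih =>
    rw [Nat.bits_append_bit n b h]
    unfold ofBits at ih ⊢
    rw [List.foldr_cons, ih]
    cases b <;> simp [Nat.bit] <;> omega

@[fun_prop]
theorem primrec_ofBits {α : Type*} [Primcodable α] {f : α → List Bool} (hf : Primrec f) :
    Primrec (fun a => ofBits (f a)) := by
  unfold ofBits; fun_prop

/-- Repeated halving reaches 0 within `n` steps, and a pair with first component 0 is a fixed point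
of the iteration, so any number of steps from `n` on gives the same digits. -/
theorem bits_eq_iterate (n : ℕ) : ∀ k l, n ≤ k →
    ((fun s : ℕ × List Bool => bif decide (s.1 = 0) then s else (s.1.div2, s.1.bodd :: s.2))^[k]
      (n, l)).2 = n.bits.reverse ++ l := by
  induction n using Nat.binaryRec' with
  | zero =>
    intro k l _
    rw [Function.iterate_fixed (by simp)]
    simp
  | bit b n h ih =>
    intro k l hk
    have hpos : Nat.bit b n ≠ 0 := by
      cases b
      · have : n ≠ 0 := fun h0 => by simpa using h h0
        simp [Nat.bit, this]
      · simp [Nat.bit]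
    have hlt : n < Nat.bit b n := by
      cases b
      · have : n ≠ 0 := fun h0 => by simpa using h h0
        simp [Nat.bit]; omega
      · simp [Nat.bit]; omega
    obtain ⟨k, rfl⟩ : ∃ k', k = k' + 1 := ⟨k - 1, by omega⟩
    rw [Function.iterate_succ_apply, Nat.bits_append_bit n b h]
    simp only [hpos, decide_false, cond_false, Nat.div2_bit, Nat.bodd_bit]
    rw [ih k _ (by omega)]
    simp

@[fun_prop]
theorem primrec_bits {α : Type*} [Primcodable α] {f : α → ℕ} (hf : Primrec f) :
    Primrec (fun a => (f a).bits) := by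
  have : Primrec (fun a => ((fun s : ℕ × List Bool =>
      bif decide (s.1 = 0) then s else (s.1.div2, s.1.bodd :: s.2))^[f a] (f a, [])).2.reverse) := by
    fun_prop
  refine this.of_eq fun a => ?_
  rw [bits_eq_iterate _ _ _ le_rfl]
  simp

theorem bin_injective {α : Type} [Encodable α] : Function.Injective (bin : α → List Bool) := by
  intro a b h
  have := congrArg ofBits h
  simpa [bin, ofBits_bits] using this

/-- Inverse of `bin`. -/
def parse (α : Type) [Encodable α] (s : List Bool) : Option α :=
  (Encodable.decode (ofBits s)).bind fun a : α =>
    -- Re-encoding rejects non-canonical strings, such as those with superfluous final zeros, which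
    -- `ofBits` would accept.
    bif decide ((Encodable.encode a).bits = s) then some a else none

theorem parse_eq_some {α : Type} [Encodable α] {s : List Bool} {a : α} :
    parse α s = some a ↔ bin a = s := by
  unfold parse
  constructor
  · intro h
    obtain ⟨b, _, hb⟩ := Option.bind_eq_some_iff.1 h
    by_cases hs : (Encodable.encode b).bits = s
    · simp only [hs, decide_true, cond_true, Option.some.injEq] at hb
      rw [← hb]; exact hs
    · simp [hs] at hb
  · rintro rfl
    simp [bin, ofBits_bits]

@[fun_prop]
theorem primrec_parse {α : Type*} {β : Type} [Primcodable α] [Primcodable β] {f : α → List Bool}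
    (hf : Primrec f) : Primrec (fun a => parse β (f a)) := by
  unfold parse; fun_prop

/-! Words over an initial segment of the natural numbers -/

/-- The words of length at most `L` with letters at most `K`. -/
def words (K L : ℕ) : List (List ℕ) :=
  Nat.rec [[]] (fun _ l => [] :: (List.range (K + 1)).flatMap fun p => l.map fun w => p :: w) L

theorem mem_words {K L : ℕ} {w : List ℕ} :
    w ∈ words K L ↔ w.length ≤ L ∧ ∀ p ∈ w, p ≤ K := by
  induction L generalizing w with
  | zero =>
    rw [show words K 0 = [[]] from rfl]
    cases w <;> simp
  | succ L ih =>
    rw [show words K (L + 1) = [] :: (List.range (K + 1)).flatMap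
      fun p => (words K L).map fun w => p :: w from rfl]
    cases w with
    | nil => simp
    | cons p w =>
      simp [ih]
      tauto

@[fun_prop]
theorem primrec_words {α : Type*} [Primcodable α] {f g : α → ℕ} (hf : Primrec f)
    (hg : Primrec g) : Primrec (fun a => words (f a) (g a)) := by
  unfold words; fun_prop

attribute [local irreducible] Primrec

/-! Walks -/

/-- One step by port `p`, from a node with an entry port; the walker stays if there is no such
port. -/
def move {X : Type} (f : X → ℕ → Option (X × ℕ)) (s : X × ℕ) (p : ℕ) : X × ℕ :=
  (f s.1 p).getD (s.1, 0)

/-- The node reached, and the last entry port, after following a word of port numbers. -/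
def walk {X : Type} (f : X → ℕ → Option (X × ℕ)) (s : X × ℕ) (w : List ℕ) : X × ℕ :=
  w.foldl (move f) s

section Walk
variable {X : Type} (f : X → ℕ → Option (X × ℕ))

@[simp] theorem walk_nil (s : X × ℕ) : walk f s [] = s := rfl

@[simp] theorem walk_cons (s : X × ℕ) (p : ℕ) (w : List ℕ) :
    walk f s (p :: w) = walk f (move f s p) w := rfl

theorem walk_append (s : X × ℕ) (w w' : List ℕ) :
    walk f s (w ++ w') = walk f (walk f s w) w' := List.foldl_append

/-- A move reads the node only, so the initial entry port survives just in the empty word. This is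
why nonempty words are required when walks are cut into pieces. -/
theorem walk_entry (x : X) (e e' : ℕ) {w : List ℕ} (hw : w ≠ []) :
    walk f (x, e) w = walk f (x, e') w := by
  cases w with
  | nil => exact absurd rfl hw
  | cons p w => rfl

theorem walk_fst (s t : X × ℕ) (h : s.1 = t.1) (w : List ℕ) :
    (walk f s w).1 = (walk f t w).1 := by
  cases w with
  | nil => exact h
  | cons p w => simp [walk_cons, move, h]

theorem move_of_some {x y : X} {p q : ℕ} (h : f x p = some (y, q)) (e : ℕ) :
    move f (x, e) p = (y, q) := by simp [move, h]

theorem move_of_none {x : X} {p : ℕ} (h : f x p = none) (e : ℕ) :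
    move f (x, e) p = (x, 0) := by simp [move, h]

end Walk

/-! Adjacency lists -/

/-- Adjacency lists with port numbers. -/
abbrev AdjList : Type := List (List (ℕ × ℕ))

/-- The edge leaving node `x` by port number `p`: the node reached and the entry port number. -/
def crossing (l : AdjList) (x p : ℕ) : Option (ℕ × ℕ) :=
  -- Without the test, truncated subtraction would turn 0 into the first port.
  bif decide (p = 0) then none else (l[x]?.getD [])[p - 1]?

/-- The degree of a node. -/
def degree (l : AdjList) (x : ℕ) : ℕ := (l[x]?.getD []).length

/-- What is observed at the end of a walk: the last entry port and the degree. -/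
def obs (c : AdjList) (x : ℕ) (w : List ℕ) : ℕ × ℕ :=
  ((walk (crossing c) (x, 0) w).2, degree c (walk (crossing c) (x, 0) w).1)

/-- The node at the end of a walk. -/
def target (c : AdjList) (x : ℕ) (w : List ℕ) : ℕ := (walk (crossing c) (x, 0) w).1

/-- Every edge can be traversed in both directions. -/
def Reversible (c : AdjList) : Prop :=
  ∀ x p y q, crossing c x p = some (y, q) → crossing c y q = some (x, p)

/-- The same observations are made on all walks. -/
def Same (c : AdjList) (x : ℕ) (d : AdjList) (y : ℕ) : Prop := ∀ w, obs c x w = obs d y w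

/-- An upper bound for all degrees. -/
def maxDegree (c : AdjList) : ℕ := c.foldr (fun r k => max r.length k) 0

section Primrec
variable {α : Type*} [Primcodable α]

@[fun_prop]
theorem primrec_crossing {c : α → AdjList} {x p : α → ℕ} (hc : Primrec c) (hx : Primrec x)
    (hp : Primrec p) : Primrec (fun a => crossing (c a) (x a) (p a)) := by
  unfold crossing; fun_prop

@[fun_prop]
theorem primrec_degree {c : α → AdjList} {x : α → ℕ} (hc : Primrec c) (hx : Primrec x) :
    Primrec (fun a => degree (c a) (x a)) := by
  unfold degree; fun_prop

@[fun_prop]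
theorem primrec_walk {c : α → AdjList} {s : α → ℕ × ℕ} {w : α → List ℕ} (hc : Primrec c)
    (hs : Primrec s) (hw : Primrec w) : Primrec (fun a => walk (crossing (c a)) (s a) (w a)) := by
  unfold walk move; fun_prop

@[fun_prop]
theorem primrec_obs {c : α → AdjList} {x : α → ℕ} {w : α → List ℕ} (hc : Primrec c)
    (hx : Primrec x) (hw : Primrec w) : Primrec (fun a => obs (c a) (x a) (w a)) := by
  unfold obs; fun_prop

@[fun_prop]
theorem primrec_target {c : α → AdjList} {x : α → ℕ} {w : α → List ℕ} (hc : Primrec c)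
    (hx : Primrec x) (hw : Primrec w) : Primrec (fun a => target (c a) (x a) (w a)) := by
  unfold target; fun_prop

@[fun_prop]
theorem primrec_maxDegree {c : α → AdjList} (hc : Primrec c) :
    Primrec (fun a => maxDegree (c a)) := by
  unfold maxDegree; fun_prop

end Primrec

/-! ### Observations along walks and how many of them are needed -/

section AdjList
variable {c d : AdjList}

theorem crossing_isSome {x p : ℕ} :
    (crossing c x p).isSome ↔ 1 ≤ p ∧ p ≤ degree c x := by
  unfold crossing degree
  by_cases hp : p = 0
  · simp [hp]
  · simp [hp]; omega

theorem exists_crossing {x p : ℕ} (h1 : 1 ≤ p) (h2 : p ≤ degree c x) :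
    ∃ y q, crossing c x p = some (y, q) := by
  have := (crossing_isSome (c := c)).2 ⟨h1, h2⟩
  obtain ⟨⟨y, q⟩, h⟩ := Option.isSome_iff_exists.1 this
  exact ⟨y, q, h⟩

theorem bounds_of_crossing {x p : ℕ} {e : ℕ × ℕ} (h : crossing c x p = some e) :
    1 ≤ p ∧ p ≤ degree c x := crossing_isSome.1 (by simp [h])

theorem crossing_eq_none {x p : ℕ} (h : ¬ (1 ≤ p ∧ p ≤ degree c x)) : crossing c x p = none := by
  rw [← crossing_isSome] at h
  simpa using h

theorem lt_of_crossing {x p : ℕ} {e : ℕ × ℕ} (h : crossing c x p = some e) : x < c.length := by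
  by_contra hx
  have := bounds_of_crossing h
  simp [degree, List.getElem?_eq_none (not_lt.1 hx)] at this
  omega

theorem degree_le_maxDegree (x : ℕ) : degree c x ≤ maxDegree c := by
  unfold degree maxDegree
  by_cases hx : x < c.length
  · rw [List.getElem?_eq_getElem hx]
    have : ∀ l : AdjList, ∀ r ∈ l, r.length ≤ l.foldr (fun r k => max r.length k) 0 := by
      intro l
      induction l with
      | nil => simp
      | cons a l ih =>
        intro r hr
        rcases List.mem_cons.1 hr with rfl | hr
        · simp
        · exact (ih r hr).trans (by simp)
    exact this _ _ (List.getElem_mem hx)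
  · simp [List.getElem?_eq_none (not_lt.1 hx)]

theorem Reversible.entry_pos (hc : Reversible c) {x p y q : ℕ}
    (h : crossing c x p = some (y, q)) : 1 ≤ q := (bounds_of_crossing (hc _ _ _ _ h)).1

theorem Reversible.lt (hc : Reversible c) {x p y q : ℕ}
    (h : crossing c x p = some (y, q)) : y < c.length := lt_of_crossing (hc _ _ _ _ h)

theorem Reversible.walk_lt (hc : Reversible c) {s : ℕ × ℕ} (h : s.1 < c.length) (w : List ℕ) :
    (walk (crossing c) s w).1 < c.length := by
  induction w generalizing s with
  | nil => exact h
  | cons p w ih =>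
    refine ih ?_
    unfold move
    rcases e : crossing c s.1 p with _ | ⟨y, q⟩
    · simpa using h
    · simpa using hc.lt e

theorem Reversible.target_lt (hc : Reversible c) {x : ℕ} (h : x < c.length) (w : List ℕ) :
    target c x w < c.length := hc.walk_lt h w

theorem target_append (x : ℕ) (w w' : List ℕ) :
    target c x (w ++ w') = target c (target c x w) w' := by
  unfold target
  rw [walk_append]
  exact walk_fst _ _ ((walk (crossing c) (x, 0) w).1, 0) (by rfl) _

theorem obs_append (x : ℕ) (w : List ℕ) {w' : List ℕ} (h : w' ≠ []) :
    obs c x (w ++ w') = obs c (target c x w) w' := by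
  unfold obs target
  rw [walk_append, ← walk_entry (crossing c) (walk (crossing c) (x, 0) w).1 _ 0 h]

theorem obs_snd (x : ℕ) (w : List ℕ) : (obs c x w).2 = degree c (target c x w) := rfl

theorem obs_nil (x : ℕ) : obs c x [] = (0, degree c x) := rfl

/-- Restarting at the intermediate node resets the entry port to 0. For the empty `w'` the claim is
therefore about degrees alone, and these come from `h1`. -/
theorem obs_target {x y : ℕ} {w w' : List ℕ} (h1 : obs c x w = obs d y w)
    (h2 : obs c x (w ++ w') = obs d y (w ++ w')) :
    obs c (target c x w) w' = obs d (target d y w) w' := by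
  cases w' with
  | nil =>
    have := congrArg Prod.snd h1
    rw [obs_snd, obs_snd] at this
    rw [obs_nil, obs_nil, this]
  | cons p w' => rwa [obs_append _ _ (by simp), obs_append _ _ (by simp)] at h2

theorem Same.target {x y : ℕ} (h : Same c x d y) (w : List ℕ) :
    Same c (target c x w) d (MobileAgents.target d y w) := fun w' => obs_target (h w) (h (w ++ w'))

theorem Same.symm {x y : ℕ} (h : Same c x d y) : Same d y c x := fun w => (h w).symm

theorem Same.trans {e : AdjList} {x y z : ℕ} (h : Same c x d y) (h' : Same d y e z) :
    Same c x e z := fun w => (h w).trans (h' w)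

theorem Same.degree {x y : ℕ} (h : Same c x d y) : degree c x = MobileAgents.degree d y :=
  congrArg Prod.snd (h [])

theorem target_singleton {x p y q : ℕ} (h : crossing c x p = some (y, q)) :
    target c x [p] = y := by
  simp [MobileAgents.target, move_of_some _ h]

/-- Nodes with the same observations have matching edges. -/
theorem Same.crossing {x y : ℕ} (h : Same c x d y) {p x' q : ℕ}
    (hx : crossing c x p = some (x', q)) :
    ∃ y', MobileAgents.crossing d y p = some (y', q) ∧ Same c x' d y' := by
  have hb := bounds_of_crossing hx
  rw [h.degree] at hb
  obtain ⟨y', q', hy⟩ := exists_crossing hb.1 hb.2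
  have h1 := congrArg Prod.fst (h [p])
  simp only [obs, walk_cons, walk_nil, move_of_some _ hx, move_of_some _ hy] at h1
  refine ⟨y', by rw [hy, h1], ?_⟩
  have := h.target [p]
  rwa [target_singleton hx, target_singleton hy] at this

/-- Entry port 0 marks a failed move, while real entry ports are positive by reversibility. Equal
outcomes thus come from two failures at the same node or from the same edge, which is traversed
backwards. -/
theorem crossing_eq_of_move (hc : Reversible c) {x x' p : ℕ}
    (h : move (crossing c) (x, 0) p = move (crossing c) (x', 0) p) : x = x' := by
  unfold move at h
  rcases e : crossing c x p with _ | ⟨y, q⟩ <;> rcases e' : crossing c x' p with _ | ⟨y', q'⟩ <;>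
    simp only [e, e', Option.getD_none, Option.getD_some, Prod.mk.injEq] at h
  · exact h.1
  · have := hc.entry_pos e'; omega
  · have := hc.entry_pos e; omega
  · obtain ⟨rfl, rfl⟩ := h
    have h1 := hc _ _ _ _ e
    rw [hc _ _ _ _ e'] at h1
    simp only [Option.some.injEq, Prod.mk.injEq] at h1
    exact h1.1.symm

/-- The end of a walk and the entry ports on it determine its beginning. -/
theorem eq_of_target_eq (hc : Reversible c) {w : List ℕ} {x x' : ℕ}
    (ht : target c x w = target c x' w)
    (he : ∀ w', w' <+: w → obs c x w' = obs c x' w') : x = x' := by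
  induction w using List.reverseRecOn with
  | nil => exact ht
  | append_singleton w p ih =>
    refine ih ?_ fun w' hw' => he w' (hw'.trans (List.prefix_append _ _))
    -- The observation after the whole word supplies the last entry port, with which the last move
    -- is undone.
    have h1 := congrArg Prod.fst (he (w ++ [p]) List.prefix_rfl)
    rw [obs_append _ _ (by simp), obs_append _ _ (by simp)] at h1
    rw [target_append, target_append] at ht
    exact crossing_eq_of_move hc (Prod.ext ht h1)

/-- Walks can be shortened. -/
theorem exists_short_walk {c : AdjList} (hc : Reversible c) {K : ℕ} (hK : ∀ x, degree c x ≤ K)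
    {x : ℕ} (hx : x < c.length) (w : List ℕ) :
    ∃ w', w'.length < c.length ∧ (∀ p ∈ w', p ≤ K) ∧ target c x w' = target c x w := by
  classical
  have hex : ∃ k, ∃ w', w'.length = k ∧ target c x w' = target c x w := ⟨_, w, rfl, rfl⟩
  obtain ⟨w', hk, hw'⟩ := Nat.find_spec hex
  have hmin : ∀ v, target c x v = target c x w → w'.length ≤ v.length := fun v hv => by
    rw [hk]; exact Nat.find_min' hex ⟨v, rfl, hv⟩
  -- A shortest word to its target visits no node twice, since the part between two visits could be
  -- cut out. Its length is then bounded by pigeonhole.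
  have hinj : ∀ i j, i < j → j ≤ w'.length →
      target c x (w'.take i) ≠ target c x (w'.take j) := by
    intro i j hij hj h
    have := hmin (w'.take i ++ w'.drop j) (by
      rw [target_append, h, ← target_append, List.take_append_drop, hw'])
    simp at this
    omega
  refine ⟨w', ?_, ?_, hw'⟩
  · by_contra hlen
    have := Finset.exists_ne_map_eq_of_card_lt_of_maps_to
      (s := Finset.range (w'.length + 1)) (t := Finset.range c.length)
      (f := fun i => target c x (w'.take i)) (by simp; omega)
      (fun i _ => by simpa using hc.target_lt hx _)
    obtain ⟨i, hi, j, hj, hij, h⟩ := this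
    simp at hi hj
    rcases lt_or_gt_of_ne hij with hlt | hlt
    · exact hinj i j hlt (by omega) h
    · exact hinj j i hlt (by omega) h.symm
  · intro p hp
    obtain ⟨i, hi, rfl⟩ := List.getElem_of_mem hp
    by_contra hlt
    refine hinj i (i + 1) (by omega) (by omega) ?_
    rw [List.take_succ_eq_append_getElem hi, target_append]
    -- A letter above `K` is no port, so the walker would stay and visit a node twice.
    have hn : crossing c (target c x (w'.take i)) w'[i] = none := by
      refine crossing_eq_none fun h => hlt (h.2.trans (hK _))
    conv_rhs => simp [target, walk_cons]
    rw [show (walk (crossing c) (x, 0) (w'.take i)).1 = target c x (w'.take i) from rfl,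
      move_of_none _ hn]

/-- Equality of observations on short words. -/
def Alike (K L : ℕ) (c : AdjList) (x : ℕ) (d : AdjList) (y : ℕ) : Prop :=
  ∀ w ∈ words K L, obs c x w = obs d y w

theorem obs_cons (x p : ℕ) (w : List ℕ) :
    obs c x (p :: w) = bif decide (w = []) then obs c x [p] else obs c (target c x [p]) w := by
  cases w with
  | nil => rfl
  | cons q w => exact obs_append x [p] (by simp)

/-- The recursion behind partition refinement: agreement to depth `L + 1` amounts to equal degrees,
equal first steps and agreement of the successors to depth `L`. -/
theorem alike_succ {K L : ℕ} {x y : ℕ} : Alike K (L + 1) c x d y ↔ degree c x = degree d y ∧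
    ∀ p ≤ K, obs c x [p] = obs d y [p] ∧ Alike K L c (target c x [p]) d (target d y [p]) := by
  constructor
  · intro h
    refine ⟨congrArg Prod.snd (h [] (mem_words.2 (by simp))), fun p hp => ?_⟩
    have h1 : obs c x [p] = obs d y [p] := h [p] (mem_words.2 (by simpa using hp))
    refine ⟨h1, fun w hw => ?_⟩
    refine obs_target h1 (h _ (mem_words.2 ?_))
    rw [mem_words] at hw
    simpa [hp] using hw
  · rintro ⟨h0, h⟩ w hw
    rw [mem_words] at hw
    cases w with
    | nil => rw [obs_nil, obs_nil, h0]
    | cons p w =>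
      simp at hw
      obtain ⟨h1, h2⟩ := h p hw.2.1
      rw [obs_cons x, obs_cons y, h1, h2 w (mem_words.2 ⟨hw.1, hw.2.2⟩)]

theorem Alike.mono {K K' L L' : ℕ} {x y : ℕ} (h : Alike K' L' c x d y) (hK : K ≤ K')
    (hL : L ≤ L') : Alike K L c x d y := fun w hw => h w <| by
  rw [mem_words] at hw ⊢
  exact ⟨hw.1.trans hL, fun p hp => (hw.2 p hp).trans hK⟩

theorem same_of_alike {K : ℕ} {x y : ℕ} (hK : ∀ x, degree c x ≤ K)
    (h : ∀ L, Alike K L c x d y) : Same c x d y := by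
  intro w
  induction w generalizing x y with
  | nil => exact h 0 _ (mem_words.2 (by simp))
  | cons p w ih =>
    have h0 : degree c x = degree d y := (alike_succ.1 (h 1)).1
    have key : obs c x [p] = obs d y [p] ∧ obs c (target c x [p]) w = obs d (target d y [p]) w := by
      by_cases hp : p ≤ K
      · exact ⟨((alike_succ.1 (h 1)).2 p hp).1, ih fun L => ((alike_succ.1 (h (L + 1))).2 p hp).2⟩
      -- Only the degrees in `c` are bounded by `K`; equality of the degrees at `x` and `y` shows
      -- that the letter is no port in `d` either.
      · have hc : crossing c x p = none := crossing_eq_none fun h' => hp (h'.2.trans (hK x))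
        have hd : crossing d y p = none :=
          crossing_eq_none fun h' => hp ((h0 ▸ h'.2).trans (hK x))
        simp only [obs, target, walk_cons, walk_nil, move_of_none _ hc, move_of_none _ hd]
        exact ⟨by rw [h0], ih h⟩
    rw [obs_cons x, obs_cons y, key.1, key.2]

/-- Observations on words whose length is bounded by the product of the sizes determine all
observations. -/
theorem Alike.same (hc : Reversible c) (hd : Reversible d) {K : ℕ} (hK : ∀ x, degree c x ≤ K)
    {x y : ℕ} (hx : x < c.length) (hy : y < d.length)
    (h : Alike K (c.length * d.length) c x d y) : Same c x d y := by
  classical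
  -- The pairs that agree to depth `L` form a decreasing chain of subsets of a set with `c.length *
  -- d.length` elements.
  let A : ℕ → Finset (ℕ × ℕ) := fun L =>
    (Finset.range c.length ×ˢ Finset.range d.length).filter fun z => Alike K L c z.1 d z.2
  have hA : ∀ L z, z ∈ A L ↔ (z.1 < c.length ∧ z.2 < d.length) ∧ Alike K L c z.1 d z.2 := by
    intro L z; simp [A]
  have hanti : ∀ L L', L ≤ L' → A L' ⊆ A L := by
    intro L L' hL z hz
    rw [hA] at hz ⊢
    exact ⟨hz.1, hz.2.mono le_rfl hL⟩
  -- By `alike_succ` each level is obtained from the preceding one by the same rule, so the chain is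
  -- constant once it has been stationary for one step.
  have hstep : ∀ L, A L = A (L + 1) → A (L + 1) = A (L + 2) := by
    intro L hL
    refine Finset.Subset.antisymm (fun z hz => ?_) (hanti _ _ (by omega))
    rw [hA] at hz ⊢
    refine ⟨hz.1, alike_succ.2 ⟨(alike_succ.1 hz.2).1, fun p hp => ?_⟩⟩
    obtain ⟨h1, h2⟩ := (alike_succ.1 hz.2).2 p hp
    have : (target c z.1 [p], target d z.2 [p]) ∈ A L :=
      (hA _ _).2 ⟨⟨hc.target_lt hz.1.1 _, hd.target_lt hz.1.2 _⟩, h2⟩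
    rw [hL, hA] at this
    exact ⟨h1, this.2⟩
  -- Each strict inclusion costs an element, so a stationary step comes in time.
  have hfix : ∃ L ≤ c.length * d.length, A L = A (L + 1) := by
    by_contra hno
    push Not at hno
    have hcard : ∀ L ≤ c.length * d.length + 1, (A L).card + L ≤ c.length * d.length := by
      intro L
      induction L with
      | zero =>
        intro _
        refine (Finset.card_filter_le _ _).trans (by simp)
      | succ L ih =>
        intro hL
        have := Finset.card_lt_card ((hanti L (L + 1) (by omega)).ssubset_of_ne
          (hno L (by omega)).symm)
        have := ih (by omega)
        omega
    have := hcard _ le_rfl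
    omega
  obtain ⟨L, hL, hLs⟩ := hfix
  have hconst : ∀ k, A (L + k) = A (L + k + 1) := by
    intro k
    induction k with
    | zero => exact hLs
    | succ k ih => exact hstep _ ih
  have hconst' : ∀ k, A (L + k) = A L := by
    intro k
    induction k with
    | zero => rfl
    | succ k ih => rw [← ih, ← add_assoc]; exact (hconst k).symm
  refine same_of_alike hK fun M => ?_
  have hmem : (x, y) ∈ A L := hanti _ _ hL ((hA _ _).2 ⟨⟨hx, hy⟩, h⟩)
  rw [← hconst' M] at hmem
  exact ((hA _ _).1 (hanti M (L + M) (by omega) hmem)).2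

end AdjList

/-! The adjacency list of a port-labeled graph -/

namespace PortGraph
variable (G : PortGraph)

@[simp] theorem length_code : G.code.length = G.size := by simp [code]

theorem degree_code (v : Fin G.size) : degree G.code v = G.deg v := by
  simp [degree, code]

theorem cross_of_pos {v : Fin G.size} {p : ℕ} (h1 : 1 ≤ p) (h2 : p ≤ G.deg v) :
    G.cross v p = some (G.arc v ⟨p - 1, by omega⟩) := dif_pos ⟨h1, h2⟩

theorem cross_eq_none {v : Fin G.size} {p : ℕ} (h : ¬ (1 ≤ p ∧ p ≤ G.deg v)) :
    G.cross v p = none := dif_neg h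

theorem crossing_code (v : Fin G.size) (p : ℕ) :
    crossing G.code v p = (G.cross v p).map fun e => (e.1.val, e.2) := by
  by_cases h : 1 ≤ p ∧ p ≤ G.deg v
  · have hp : p - 1 < G.deg v := by omega
    rw [G.cross_of_pos h.1 h.2]
    simp [crossing, code, show p ≠ 0 by omega, hp]
  · rw [G.cross_eq_none h, crossing_eq_none (by rwa [degree_code])]
    rfl

theorem crossing_code_eq_some {v u : Fin G.size} {p q : ℕ} :
    crossing G.code v p = some (u.val, q) ↔ G.cross v p = some (u, q) := by
  rw [crossing_code]
  rcases G.cross v p with _ | ⟨u', q'⟩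
  · simp
  · simp [Fin.ext_iff]

theorem exists_cross_of_crossing {v : Fin G.size} {p : ℕ} {y q : ℕ}
    (h : crossing G.code v p = some (y, q)) : ∃ u : Fin G.size, u.val = y ∧
      G.cross v p = some (u, q) := by
  rw [crossing_code] at h
  obtain ⟨⟨u, q'⟩, hu, he⟩ := Option.map_eq_some_iff.1 h
  simp only [Prod.mk.injEq] at he
  exact ⟨u, he.1, by rw [hu, he.2]⟩

theorem reversible_code : Reversible G.code := by
  intro x p y q h
  have hx := lt_of_crossing h
  rw [length_code] at hx
  obtain ⟨u, rfl, hu⟩ := G.exists_cross_of_crossing (v := ⟨x, hx⟩) h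
  exact G.crossing_code_eq_some.2 (G.cross_symm hu)

theorem size_pos : 0 < G.size := by
  obtain ⟨v⟩ := G.connected.nonempty
  exact v.pos

theorem deg_lt_size (v : Fin G.size) : G.deg v < G.size := by
  have h : Fintype.card (Fin (G.deg v)) ≤ Fintype.card {u : Fin G.size // u ≠ v} :=
    Fintype.card_le_of_injective
      (fun p => ⟨(G.port v p).1, fun e => G.graph.irrefl (e ▸ (G.port v p).2)⟩)
      fun p p' hp => by
        simp only [Subtype.mk.injEq] at hp
        exact (G.port v).injective (Subtype.ext hp)
  simp at h
  have := v.pos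
  omega

theorem degree_code_le (x : ℕ) : degree G.code x ≤ G.size := by
  by_cases hx : x < G.size
  · exact (G.degree_code ⟨x, hx⟩).trans_le (G.deg_lt_size _).le
  · unfold degree
    rw [List.getElem?_eq_none (by simpa using hx)]
    simp

theorem exists_cross_of_adj {u v : Fin G.size} (h : G.graph.Adj u v) :
    ∃ p q, G.cross u p = some (v, q) := by
  let i := (G.port u).symm ⟨v, h⟩
  refine ⟨i + 1, (G.arc u i).2, ?_⟩
  rw [G.cross_of_pos (by omega) (by omega)]
  refine congrArg some (Prod.ext ?_ rfl)
  show (G.port u ((G.port u).symm ⟨v, h⟩)).1 = v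
  rw [Equiv.apply_symm_apply]

theorem exists_walk (u v : Fin G.size) : ∃ w, target G.code u w = v := by
  obtain ⟨W⟩ := G.connected.preconnected u v
  induction W with
  | nil => exact ⟨[], rfl⟩
  | cons h _ ih =>
    obtain ⟨w, hw⟩ := ih
    obtain ⟨p, q, hp⟩ := G.exists_cross_of_adj h
    refine ⟨p :: w, ?_⟩
    rw [← hw, ← List.singleton_append, target_append,
      target_singleton (G.crossing_code_eq_some.2 hp)]

theorem walk_code (s : Fin G.size × ℕ) (w : List ℕ) :
    walk (crossing G.code) (s.1.val, s.2) w =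
      ((walk G.cross s w).1.val, (walk G.cross s w).2) := by
  induction w generalizing s with
  | nil => rfl
  | cons p w ih =>
    rw [walk_cons, walk_cons, ← ih]
    congr 1
    unfold move
    rw [crossing_code]
    rcases G.cross s.1 p with _ | ⟨u, q⟩ <;> rfl

/-! Equality of views -/

theorem View.node_eq {d d' : ℕ} {e : Fin d → ℕ} {e' : Fin d' → ℕ} {k : Fin d → View}
    {k' : Fin d' → View} : View.node d e k = View.node d' e' k' ↔
      d = d' ∧ ∀ i (h : i < d) (h' : i < d'), e ⟨i, h⟩ = e' ⟨i, h'⟩ ∧ k ⟨i, h⟩ = k' ⟨i, h'⟩ := by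
  constructor
  · intro h
    injection h with h1 h2 h3
    subst h1
    cases h2
    cases h3
    exact ⟨rfl, fun _ _ _ => ⟨rfl, rfl⟩⟩
  · rintro ⟨rfl, h⟩
    congr
    · exact funext fun i => (h i i.2 i.2).1
    · exact funext fun i => (h i i.2 i.2).2

variable {G}

theorem truncView_succ {H : PortGraph} {t : ℕ} {u : Fin G.size} {v : Fin H.size} :
    G.truncView (t + 1) u = H.truncView (t + 1) v ↔ G.deg u = H.deg v ∧
      ∀ p u' q v' q', G.cross u p = some (u', q) → H.cross v p = some (v', q') →
        q = q' ∧ G.truncView t u' = H.truncView t v' := by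
  rw [truncView, truncView, View.node_eq]
  refine and_congr_right fun hd => ⟨fun h p u' q v' q' hu hv => ?_, fun h i hi hi' => ?_⟩
  · have hp : 1 ≤ p ∧ p ≤ G.deg u := by
      by_contra hp
      rw [G.cross_eq_none hp] at hu
      cases hu
    have := h (p - 1) (by omega) (by omega)
    rw [G.cross_of_pos hp.1 hp.2] at hu
    rw [H.cross_of_pos hp.1 (hd ▸ hp.2)] at hv
    simp only [Option.some.injEq] at hu hv
    rw [hu, hv] at this
    exact this
  · exact h (i + 1) _ _ _ _ (G.cross_of_pos (by omega) (by omega))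
      (H.cross_of_pos (by omega) (by omega))

/-- A view lists entry ports and degrees along all walks. One direction follows a word through the
tree, the other unfolds the tree edge by edge; letters that are no ports leave the walker in place
and add no information. -/
theorem truncView_eq_iff_same {u v : Fin G.size} :
    (∀ t, G.truncView t u = G.truncView t v) ↔ Same G.code u G.code v := by
  constructor
  · intro h w
    induction w generalizing u v with
    | nil =>
      rw [obs_nil, obs_nil, degree_code, degree_code, (truncView_succ.1 (h 1)).1]
    | cons p w ih =>
      have hd := (truncView_succ.1 (h 1)).1
      rw [obs_cons, obs_cons v]
      by_cases hp : 1 ≤ p ∧ p ≤ G.deg u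
      · have hu := G.cross_of_pos hp.1 hp.2
        have hv := G.cross_of_pos hp.1 (hd ▸ hp.2)
        have key := fun t => (truncView_succ.1 (h (t + 1))).2 _ _ _ _ _ hu hv
        have h1 := ih fun t => (key t).2
        have h2 := (truncView_succ.1 ((key 1).2)).1
        have cu := G.crossing_code_eq_some.2 hu
        have cv := G.crossing_code_eq_some.2 hv
        rw [target_singleton cu, target_singleton cv, h1]
        congr 1
        simp only [obs, walk_cons, walk_nil, move_of_some _ cu, move_of_some _ cv]
        rw [degree_code, degree_code]
        exact Prod.ext (key 0).1 h2
      · have cu : crossing G.code u p = none := crossing_eq_none (by rwa [degree_code])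
        have cv : crossing G.code v p = none := crossing_eq_none (by rwa [degree_code, ← hd])
        simp only [obs, target, walk_cons, walk_nil, move_of_none _ cu, move_of_none _ cv]
        have h1 := ih h
        simp only [obs] at h1
        rw [h1, degree_code, degree_code, hd]
  · intro h t
    induction t generalizing u v with
    | zero => rfl
    | succ t ih =>
      refine truncView_succ.2 ⟨by rw [← degree_code, ← degree_code, h.degree], ?_⟩
      intro p u' q v' q' hu hv
      obtain ⟨y, hy, hs⟩ := h.crossing (G.crossing_code_eq_some.2 hu)
      rw [G.crossing_code_eq_some.2 hv] at hy
      simp only [Option.some.injEq, Prod.mk.injEq] at hy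
      obtain ⟨rfl, rfl⟩ := hy
      exact ⟨rfl, ih hs⟩

theorem quotient_mk_eq {u v : Fin G.size} :
    Quotient.mk G.viewSetoid u = Quotient.mk G.viewSetoid v ↔ Same G.code u G.code v := by
  rw [Quotient.eq, ← truncView_eq_iff_same]
  rfl

end PortGraph

/-! Quotient graphs written as codes -/

/-- The edges of a coded graph, in both directions. -/
def halfEdges (H : GraphCode) : List (ℕ × ℕ × ℕ × ℕ) :=
  (H.2 ++ H.2.map fun e => (e.2.2.1, e.2.2.2, e.1, e.2.1)).filter
    -- Entries naming nonexistent nodes are harmless in `toGraph`, whose nodes are `Fin H.1`, and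
    -- have to be dropped.
    fun e => decide (e.1 < H.1) && decide (e.2.2.1 < H.1)

/-- The first edge with label `p` at node `x`. -/
def edgeAt (H : GraphCode) (x p : ℕ) : Option (ℕ × ℕ) :=
  ((halfEdges H).filter fun e => decide (e.1 = x) && decide (e.2.1 = p)).head?.map
    fun e => (e.2.2.1, e.2.2.2)

/-- The greatest label at a node. -/
def maxLabel (H : GraphCode) (x : ℕ) : ℕ :=
  (halfEdges H).foldr (fun e k => bif decide (e.1 = x) then max e.2.1 k else k) 0

/-- The adjacency list of a coded graph whose labels are port numbers. -/
def adjList (H : GraphCode) : AdjList :=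
  (List.range H.1).map fun x =>
    -- A missing label leads to the nonexistent node `H.1`, which makes `faithfulCheck` fail.
    (List.range (maxLabel H x)).map fun p => (edgeAt H x (p + 1)).getD (H.1, 0)

/-- The adjacency list represents the graph. -/
def faithfulCheck (H : GraphCode) : Bool :=
  ((halfEdges H).all fun e =>
    decide (crossing (adjList H) e.1 e.2.1 = some (e.2.2.1, e.2.2.2))) &&
  ((List.range H.1).all fun x => (List.range (degree (adjList H) x)).all fun p =>
    (crossing (adjList H) x (p + 1)).elim true
      fun e => (halfEdges H).any fun e' => decide (e' = (x, p + 1, e.1, e.2)))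

/-- All nodes are connected by walks. -/
def connectedCheck (l : AdjList) : Bool :=
  (List.range l.length).all fun x => (List.range l.length).all fun y =>
    (words (maxDegree l) l.length).any fun w => decide (target l x w = y)

/-- Different nodes have different views. -/
def reducedCheck (l : AdjList) : Bool :=
  (List.range l.length).all fun x => (List.range l.length).all fun y =>
    (!((words (maxDegree l) (l.length * l.length)).all
      fun w => decide (obs l x w = obs l y w))) || decide (x = y)

/-- The coded graph is a quotient graph. -/
def goodCheck (H : GraphCode) : Bool :=
  faithfulCheck H && (connectedCheck (adjList H) && reducedCheck (adjList H))

/-- The given observations are those made from some node of the graph. -/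
def fits (H : GraphCode) (data : List (List ℕ × ℕ × ℕ)) : Bool :=
  (List.range H.1).any fun x => data.all fun e => decide (obs (adjList H) x e.1 = e.2)

section Primrec
variable {α : Type*} [Primcodable α] {H : α → GraphCode} {l : α → AdjList}

@[fun_prop]
theorem primrec_halfEdges (hH : Primrec H) : Primrec (fun a => halfEdges (H a)) := by
  unfold halfEdges; fun_prop

@[fun_prop]
theorem primrec_edgeAt {x p : α → ℕ} (hH : Primrec H) (hx : Primrec x) (hp : Primrec p) :
    Primrec (fun a => edgeAt (H a) (x a) (p a)) := by
  unfold edgeAt; fun_prop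

@[fun_prop]
theorem primrec_maxLabel {x : α → ℕ} (hH : Primrec H) (hx : Primrec x) :
    Primrec (fun a => maxLabel (H a) (x a)) := by
  unfold maxLabel; fun_prop

@[fun_prop]
theorem primrec_adjList (hH : Primrec H) : Primrec (fun a => adjList (H a)) := by
  unfold adjList; fun_prop

@[fun_prop]
theorem primrec_faithfulCheck (hH : Primrec H) : Primrec (fun a => faithfulCheck (H a)) := by
  unfold faithfulCheck; fun_prop

@[fun_prop]
theorem primrec_connectedCheck (hl : Primrec l) : Primrec (fun a => connectedCheck (l a)) := by
  unfold connectedCheck; fun_prop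

@[fun_prop]
theorem primrec_reducedCheck (hl : Primrec l) : Primrec (fun a => reducedCheck (l a)) := by
  unfold reducedCheck; fun_prop

@[fun_prop]
theorem primrec_goodCheck (hH : Primrec H) : Primrec (fun a => goodCheck (H a)) := by
  unfold goodCheck; fun_prop

@[fun_prop]
theorem primrec_fits {o : α → List (List ℕ × ℕ × ℕ)} (hH : Primrec H) (ho : Primrec o) :
    Primrec (fun a => fits (H a) (o a)) := by
  unfold fits; fun_prop

end Primrec

/-- The coded graph is the quotient graph of some port-labeled graph. -/
structure Good (H : GraphCode) : Prop where
  edge_iff : ∀ x p y q, crossing (adjList H) x p = some (y, q) ↔ (x, p, y, q) ∈ halfEdges H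
  connected : ∀ x < H.1, ∀ y < H.1, ∃ w, target (adjList H) x w = y
  reduced : ∀ x < H.1, ∀ y < H.1, Same (adjList H) x (adjList H) y → x = y

section
variable {H : GraphCode}

@[simp] theorem length_adjList : (adjList H).length = H.1 := by simp [adjList]

theorem mem_halfEdges {x p y q : ℕ} : (x, p, y, q) ∈ halfEdges H ↔
    ((x, p, y, q) ∈ H.2 ∨ (y, q, x, p) ∈ H.2) ∧ x < H.1 ∧ y < H.1 := by
  simp only [halfEdges, List.mem_filter, List.mem_append, List.mem_map, Prod.mk.injEq,
    Bool.and_eq_true, decide_eq_true_eq]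
  refine and_congr_left fun _ => or_congr_right ⟨?_, fun h => ⟨_, h, rfl, rfl, rfl, rfl⟩⟩
  rintro ⟨⟨a, b, c, d⟩, h, rfl, rfl, rfl, rfl⟩
  exact h

theorem edge_toGraph {x y : Fin H.1} {p q : ℕ} :
    H.toGraph.Edge x p y q ↔ (x.val, p, y.val, q) ∈ halfEdges H := by
  rw [mem_halfEdges]
  exact ⟨fun h => ⟨h, x.2, y.2⟩, fun h => h.1⟩

theorem halfEdges_symm {x p y q : ℕ} (h : (x, p, y, q) ∈ halfEdges H) :
    (y, q, x, p) ∈ halfEdges H := by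
  rw [mem_halfEdges] at h ⊢
  tauto

theorem Good.reversible (h : Good H) : Reversible (adjList H) := fun x p y q hx => by
  rw [h.edge_iff] at hx ⊢
  exact halfEdges_symm hx

/-- The bounded searches lose nothing: `exists_short_walk` bounds the words needed for
connectedness, and `Alike.same` those needed to tell two views apart. -/
theorem goodCheck_iff : goodCheck H = true ↔ Good H := by
  simp only [goodCheck, faithfulCheck, connectedCheck, reducedCheck, Bool.and_eq_true,
    List.all_eq_true, List.any_eq_true, decide_eq_true_eq, List.mem_range, Bool.or_eq_true,
    Bool.not_eq_true', Prod.forall, length_adjList]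
  constructor
  · rintro ⟨⟨h1, h2⟩, h3, h4⟩
    refine ⟨fun x p y q => ⟨fun h => ?_, fun h => h1 _ _ _ _ h⟩, fun x hx y hy => ?_,
      fun x hx y hy h => ?_⟩
    · have hx := lt_of_crossing h
      rw [length_adjList] at hx
      have hp := bounds_of_crossing h
      have := h2 x hx (p - 1) (by omega)
      rw [show p - 1 + 1 = p by omega, h] at this
      simpa using this
    · obtain ⟨w, -, hw⟩ := h3 x hx y hy
      exact ⟨w, hw⟩
    · refine (h4 x hx y hy).resolve_left ?_
      rw [Bool.eq_false_iff, not_not, List.all_eq_true]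
      exact fun w _ => by simpa using h w
  · intro h
    have hr := h.reversible
    refine ⟨⟨fun x p y q he => (h.edge_iff _ _ _ _).2 he, fun x hx p hp => ?_⟩,
      fun x hx y hy => ?_, fun x hx y hy => ?_⟩
    · obtain ⟨y, q, hc⟩ := exists_crossing (c := adjList H) (x := x) (p := p + 1) (by omega)
        (by omega)
      rw [hc]
      simpa using (h.edge_iff _ _ _ _).1 hc
    · obtain ⟨w, hw⟩ := h.connected x hx y hy
      obtain ⟨w', h1, h2, h3⟩ := exists_short_walk hr degree_le_maxDegree (x := x)
        (by simpa using hx) w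
      exact ⟨w', mem_words.2 ⟨by simpa using h1.le, h2⟩, h3.trans hw⟩
    · by_cases hs : Alike (maxDegree (adjList H)) (H.1 * H.1) (adjList H) x (adjList H) y
      · refine Or.inr (h.reduced x hx y hy ?_)
        exact Alike.same hr hr degree_le_maxDegree (by simpa using hx) (by simpa using hy)
          (by simpa using hs)
      · refine Or.inl ?_
        rw [Bool.eq_false_iff]
        intro hall
        rw [List.all_eq_true] at hall
        exact hs fun w hw => by simpa using hall w hw

theorem le_maxLabel {x p y q : ℕ} (h : (x, p, y, q) ∈ halfEdges H) : p ≤ maxLabel H x := by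
  unfold maxLabel
  revert h
  induction halfEdges H with
  | nil => simp
  | cons e l ih =>
    intro h
    rw [List.foldr_cons]
    rcases List.mem_cons.1 h with rfl | h
    · simp
    · refine (ih h).trans ?_
      by_cases he : e.1 = x <;> simp [he]

theorem maxLabel_le {x k : ℕ} (h : ∀ p y q, (x, p, y, q) ∈ halfEdges H → p ≤ k) :
    maxLabel H x ≤ k := by
  unfold maxLabel
  revert h
  induction halfEdges H with
  | nil => simp
  | cons e l ih =>
    intro h
    obtain ⟨a, b, c, d⟩ := e
    rw [List.foldr_cons]
    have := ih fun p y q hp => h p y q (List.mem_cons_of_mem _ hp)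
    by_cases he : a = x
    · subst he
      have := h b c d (by simp)
      simp
      omega
    · simpa [he] using this

theorem edgeAt_eq_some {x p y q : ℕ} (h : (x, p, y, q) ∈ halfEdges H)
    (hu : ∀ y' q', (x, p, y', q') ∈ halfEdges H → y' = y ∧ q' = q) :
    edgeAt H x p = some (y, q) := by
  unfold edgeAt
  rcases e : ((halfEdges H).filter fun e => decide (e.1 = x) && decide (e.2.1 = p)).head? with
    _ | ⟨x', p', y', q'⟩
  · rw [List.head?_eq_none_iff, List.filter_eq_nil_iff] at e
    exact absurd (e _ h) (by simp)
  · have := List.mem_of_head? e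
    simp only [List.mem_filter, Bool.and_eq_true, decide_eq_true_eq] at this
    obtain ⟨hm, rfl, rfl⟩ := this
    obtain ⟨rfl, rfl⟩ := hu _ _ hm
    rw [e]
    rfl

theorem crossing_adjList {x p : ℕ} (hx : x < H.1) (h1 : 1 ≤ p) (h2 : p ≤ maxLabel H x) :
    crossing (adjList H) x p = some ((edgeAt H x p).getD (H.1, 0)) := by
  have : p - 1 < maxLabel H x := by omega
  simp [crossing, adjList, show p ≠ 0 by omega, hx, this, show p - 1 + 1 = p by omega]

theorem degree_adjList {x : ℕ} (hx : x < H.1) : degree (adjList H) x = maxLabel H x := by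
  simp [degree, adjList, hx]

end

/-- If the quotient graph is isomorphic to a coded graph then that code passes the check, and views
are preserved. -/
theorem Good.of_isomorphic {G : PortGraph} {H : GraphCode}
    (h : G.quotient.Isomorphic H.toGraph) :
    Good H ∧ ∀ v : Fin G.size, ∃ x < H.1, Same G.code v (adjList H) x := by
  obtain ⟨φ, hφ⟩ := h
  let π : Fin G.size → Fin H.1 := fun v => φ (Quotient.mk G.viewSetoid v)
  have hπ : Function.Surjective π := fun x => by
    obtain ⟨v, hv⟩ := Quotient.exists_rep (s := G.viewSetoid) (φ.symm x)
    exact ⟨v, (congrArg φ hv).trans (φ.apply_symm_apply x)⟩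
  have hπs : ∀ {u v}, π u = π v ↔ Same G.code u G.code v := fun {u v} => by
    rw [← PortGraph.quotient_mk_eq]
    exact φ.injective.eq_iff
  have hedge : ∀ {u : Fin G.size} {p y q}, ((π u).val, p, y, q) ∈ halfEdges H ↔
      ∃ v, (π v).val = y ∧ G.cross u p = some (v, q) := by
    intro u p y q
    constructor
    · intro he
      have hy := (mem_halfEdges.1 he).2.2
      have he' : H.toGraph.Edge (π u) p (⟨y, hy⟩ : Fin H.1) q := edge_toGraph.2 he
      obtain ⟨v, hv⟩ := hπ ⟨y, hy⟩
      rw [← hv] at he'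
      obtain ⟨u', v', hu', hv', hc⟩ := (hφ _ _ _ _).2 he'
      rw [PortGraph.quotient_mk_eq] at hu' hv'
      -- An edge of the quotient is witnessed at some representative `u'` of the class only.
      -- Equality of views moves it to the given `u`, and its other end stays in the class of `v`.
      obtain ⟨z, hz, hzs⟩ := hu'.crossing (G.crossing_code_eq_some.2 hc)
      obtain ⟨z, rfl, hz'⟩ := G.exists_cross_of_crossing hz
      refine ⟨z, ?_, hz'⟩
      have h3 : π z = π v := hπs.2 (hzs.symm.trans hv')
      rw [h3, hv]
    · rintro ⟨v, rfl, hc⟩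
      exact edge_toGraph.1 ((hφ _ _ _ _).1 ⟨u, v, rfl, rfl, hc⟩)
  have hcross : ∀ {u v : Fin G.size} {p q}, G.cross u p = some (v, q) →
      edgeAt H (π u) p = some ((π v).val, q) := by
    intro u v p q hc
    refine edgeAt_eq_some (hedge.2 ⟨v, rfl, hc⟩) fun y' q' he => ?_
    obtain ⟨v', rfl, hc'⟩ := hedge.1 he
    rw [hc] at hc'
    cases hc'
    exact ⟨rfl, rfl⟩
  -- The labels at a class are exactly the ports of any of its members.
  have hmax : ∀ u, maxLabel H (π u) = G.deg u := by
    intro u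
    apply le_antisymm
    · refine maxLabel_le fun p y q he => ?_
      obtain ⟨v, -, hc⟩ := hedge.1 he
      by_contra hp
      rw [G.cross_eq_none (by omega)] at hc
      cases hc
    · rcases Nat.eq_zero_or_pos (G.deg u) with h0 | h0
      · omega
      · exact le_maxLabel (hedge.2 ⟨_, rfl, G.cross_of_pos h0 le_rfl⟩)
  have hdeg : ∀ u, degree (adjList H) (π u) = G.deg u := fun u => by
    rw [degree_adjList (π u).2, hmax]
  have hcr : ∀ {u v : Fin G.size} {p q}, G.cross u p = some (v, q) →
      crossing (adjList H) (π u) p = some ((π v).val, q) := by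
    intro u v p q hc
    have hp : 1 ≤ p ∧ p ≤ G.deg u := by
      by_contra hp
      rw [G.cross_eq_none hp] at hc
      cases hc
    rw [crossing_adjList (π u).2 hp.1 (by rw [hmax]; exact hp.2), hcross hc]
    rfl
  -- The projection commutes with all moves, failed ones included, and therefore preserves
  -- observations.
  have hmove : ∀ (u : Fin G.size) (e p : ℕ), move (crossing (adjList H)) ((π u).val, e) p =
      ((π (move G.cross (u, e) p).1).val, (move G.cross (u, e) p).2) := by
    intro u e p
    by_cases hp : 1 ≤ p ∧ p ≤ G.deg u
    · have hc := G.cross_of_pos hp.1 hp.2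
      rw [move_of_some _ (hcr hc), move_of_some _ hc]
    · rw [move_of_none _ (crossing_eq_none (by rwa [hdeg])), move_of_none _ (G.cross_eq_none hp)]
  have hwalk : ∀ w (s : Fin G.size × ℕ), walk (crossing (adjList H)) ((π s.1).val, s.2) w =
      ((π (walk G.cross s w).1).val, (walk G.cross s w).2) := by
    intro w
    induction w with
    | nil => intro s; rfl
    | cons p w ih =>
      intro s
      rw [walk_cons, walk_cons, hmove, ih]
  have hsame : ∀ v : Fin G.size, Same G.code v (adjList H) (π v) := by
    intro v w
    unfold obs
    rw [hwalk w (v, 0), G.walk_code (v, 0)]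
    simp only [hdeg, G.degree_code]
  have hedge_iff : ∀ x p y q, crossing (adjList H) x p = some (y, q) ↔
      (x, p, y, q) ∈ halfEdges H := by
    intro x p y q
    constructor
    · intro hc
      have hx := lt_of_crossing hc
      rw [length_adjList] at hx
      obtain ⟨u, hu⟩ := hπ ⟨x, hx⟩
      obtain rfl : (π u).val = x := by rw [hu]
      have hp := bounds_of_crossing hc
      rw [hdeg] at hp
      have hc' := hcr (G.cross_of_pos hp.1 hp.2)
      rw [hc] at hc'
      simp only [Option.some.injEq, Prod.mk.injEq] at hc'
      obtain ⟨rfl, rfl⟩ := hc'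
      exact hedge.2 ⟨_, rfl, G.cross_of_pos hp.1 hp.2⟩
    · intro he
      obtain ⟨u, hu⟩ := hπ ⟨x, (mem_halfEdges.1 he).2.1⟩
      obtain rfl : (π u).val = x := by rw [hu]
      obtain ⟨v, rfl, hc⟩ := hedge.1 he
      exact hcr hc
  refine ⟨⟨hedge_iff, fun x hx y hy => ?_, fun x hx y hy hs => ?_⟩,
    fun v => ⟨π v, (π v).2, hsame v⟩⟩
  · obtain ⟨u, hu⟩ := hπ ⟨x, hx⟩
    obtain ⟨v, hv⟩ := hπ ⟨y, hy⟩
    obtain rfl : (π u).val = x := by rw [hu]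
    obtain rfl : (π v).val = y := by rw [hv]
    obtain ⟨w, hw⟩ := G.exists_walk u v
    refine ⟨w, ?_⟩
    unfold target at hw ⊢
    rw [hwalk w (u, 0)]
    rw [G.walk_code (u, 0)] at hw
    rw [Fin.ext (a := (walk G.cross (u, 0) w).1) (b := v) hw]
  · obtain ⟨u, hu⟩ := hπ ⟨x, hx⟩
    obtain ⟨v, hv⟩ := hπ ⟨y, hy⟩
    obtain rfl : (π u).val = x := by rw [hu]
    obtain rfl : (π v).val = y := by rw [hv]
    rw [hπs.2 (((hsame u).trans hs).trans (hsame v).symm)]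

/-- One common view suffices. Following walks from `v` and `x` in parallel gives every node of `G` a
node of `H` with its view, unique because `H` is reduced. All nodes of `H` are reached because `H`
is connected, and the fibres are the classes of equal views. -/
theorem Good.isomorphic {G : PortGraph} {H : GraphCode} (h : Good H) {v : Fin G.size} {x : ℕ}
    (hx : x < H.1) (hs : Same G.code v (adjList H) x) : G.quotient.Isomorphic H.toGraph := by
  have hex : ∀ u : Fin G.size, ∃ y : Fin H.1, Same G.code u (adjList H) y := by
    intro u
    obtain ⟨w, hw⟩ := G.exists_walk v u
    refine ⟨⟨target (adjList H) x w, ?_⟩, ?_⟩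
    · simpa using h.reversible.target_lt (by simpa using hx) w
    · rw [← hw]
      exact hs.target w
  choose π hπ using hex
  have huniq : ∀ {u : Fin G.size} {y : ℕ}, y < H.1 → Same G.code u (adjList H) y →
      y = (π u).val := fun hy hs =>
    h.reduced _ hy _ (π _).2 (hs.symm.trans (hπ _))
  have hπs : ∀ {u v}, π u = π v ↔ Same G.code u G.code v := by
    intro u v
    constructor
    · intro e
      exact (hπ u).trans (e ▸ (hπ v).symm)
    · intro e
      exact Fin.ext (huniq (π u).2 (e.symm.trans (hπ u)))
  have hsurj : Function.Surjective π := by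
    intro y
    obtain ⟨w, hw⟩ := h.connected x hx y y.2
    have hlt := G.reversible_code.target_lt (x := v) (by simp) w
    rw [PortGraph.length_code] at hlt
    refine ⟨⟨target G.code v w, hlt⟩, Fin.ext ?_⟩
    rw [← huniq (u := ⟨target G.code v w, hlt⟩) y.2 (hw ▸ hs.target w)]
  have hcr : ∀ {u v : Fin G.size} {p q}, G.cross u p = some (v, q) →
      crossing (adjList H) (π u) p = some ((π v).val, q) := by
    intro u v p q hc
    obtain ⟨y, hy, hs⟩ := (hπ u).crossing (G.crossing_code_eq_some.2 hc)
    rw [hy, huniq (by simpa using h.reversible.lt hy) hs]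
  let φ : Quotient G.viewSetoid → Fin H.1 :=
    Quotient.lift π fun a b hab => hπs.2 (PortGraph.quotient_mk_eq.1 (Quotient.sound hab))
  have hφ : Function.Bijective φ := by
    refine ⟨fun a b => ?_, fun y => ?_⟩
    · induction a using Quotient.inductionOn
      induction b using Quotient.inductionOn
      exact fun e => PortGraph.quotient_mk_eq.2 (hπs.1 e)
    · obtain ⟨u, rfl⟩ := hsurj y
      exact ⟨Quotient.mk _ u, rfl⟩
  refine ⟨Equiv.ofBijective φ hφ, fun a p b q => ?_⟩
  induction a using Quotient.inductionOn with | _ u => ?_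
  induction b using Quotient.inductionOn with | _ v => ?_
  refine Iff.trans ?_ (edge_toGraph (x := π u) (y := π v)).symm
  rw [← h.edge_iff]
  constructor
  · rintro ⟨u', v', hu, hv, hc⟩
    rw [← hπs.2 (PortGraph.quotient_mk_eq.1 hu), ← hπs.2 (PortGraph.quotient_mk_eq.1 hv)]
    exact hcr hc
  · intro hc
    have hp := bounds_of_crossing hc
    rw [← (hπ u).degree, G.degree_code] at hp
    -- Equal views give equal degrees, so `p` is a port of the representative `u` itself, and the
    -- edge there serves as witness.
    have hu := G.cross_of_pos hp.1 hp.2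
    have hc' := hcr hu
    rw [hc] at hc'
    simp only [Option.some.injEq, Prod.mk.injEq] at hc'
    refine ⟨u, (G.arc u ⟨p - 1, by omega⟩).1, rfl, ?_, ?_⟩
    · exact PortGraph.quotient_mk_eq.2 (hπs.1 (Fin.ext hc'.1.symm))
    · rw [hu, hc'.2]
      rfl

/-- The quotient graph is finite. -/
theorem exists_code_quotient (G : PortGraph) :
    ∃ H : GraphCode, G.quotient.Isomorphic H.toGraph := by
  classical
  have : Fintype (Quotient G.viewSetoid) := Fintype.ofFinite _
  let φ := Fintype.equivFin (Quotient G.viewSetoid)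
  let F : Fin G.size → Fin G.size × ℕ → ℕ → ℕ × ℕ × ℕ × ℕ := fun u e p =>
    ((φ (Quotient.mk _ u)).val, p, (φ (Quotient.mk _ e.1)).val, e.2)
  let l : List (ℕ × ℕ × ℕ × ℕ) := (List.finRange G.size).flatMap fun u =>
    (List.range (G.size + 1)).flatMap fun p => ((G.cross u p).map fun e => F u e p).toList
  have hl : ∀ z, z ∈ l ↔ ∃ u v p q, G.cross u p = some (v, q) ∧ F u (v, q) p = z := by
    intro z
    simp only [l, List.mem_flatMap, List.mem_finRange, true_and, List.mem_range,
      Option.mem_toList, Option.map_eq_some_iff]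
    constructor
    · rintro ⟨u, p, -, ⟨v, q⟩, h1, h2⟩
      exact ⟨u, v, p, q, h1, h2⟩
    · rintro ⟨u, v, p, q, h1, h2⟩
      refine ⟨u, p, ?_, (v, q), h1, h2⟩
      have := bounds_of_crossing (G.crossing_code_eq_some.2 h1)
      have := G.degree_code_le u
      omega
  have hmem : ∀ x p y q, ((φ x).val, p, (φ y).val, q) ∈ l ↔ G.quotient.Edge x p y q := by
    intro x p y q
    rw [hl]
    constructor
    · rintro ⟨u, v, p', q', hc, he⟩
      simp only [F, Prod.mk.injEq] at he
      obtain ⟨h1, rfl, h2, rfl⟩ := he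
      exact ⟨u, v, φ.injective (Fin.ext h1), φ.injective (Fin.ext h2), hc⟩
    · rintro ⟨u, v, rfl, rfl, hc⟩
      exact ⟨u, v, p, q, hc, rfl⟩
  refine ⟨(Fintype.card (Quotient G.viewSetoid), l), φ, fun x p y q => ?_⟩
  refine Iff.trans ?_ (or_congr (hmem x p y q) (hmem y q x p)).symm
  exact ⟨Or.inl, fun h => h.elim id (G.quotient.symm _ _ _ _)⟩

/-! Recognition of the problem `Ω` -/

/-- The graph with the given adjacency list, explored from `x`, has the given quotient graph. -/
def quotientCheck (l : AdjList) (x : ℕ) (H : GraphCode) : Bool :=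
  goodCheck H && fits H ((words (maxDegree l) (l.length * H.1)).map fun w => (w, obs l x w))

/-- The integer `k` if the input is `(1, k)`. -/
def parseTeam (s : List Bool) : Option ℕ :=
  (parse (ℕ × List Bool) s).bind fun e => bif decide (e.1 = 1) then parse ℕ e.2 else none

/-- The graph `H` if the input is `(2, H)`. -/
def parseQuotient (s : List Bool) : Option GraphCode :=
  (parse (ℕ × List Bool) s).bind fun e => bif decide (e.1 = 2) then parse GraphCode e.2 else none

/-- Recognizes the configurations in `Ω`. -/
def omegaCheck (z : AdjList × List (ℕ × ℕ × List Bool)) : Bool :=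
  z.2.head?.elim false fun b => (z.2.all fun a => decide (a.2.2 = b.2.2)) &&
    ((parseTeam b.2.2).elim false (fun k => decide (0 < k) && decide (k < z.2.length)) ||
      (parseQuotient b.2.2).elim false fun H => !(quotientCheck z.1 0 H))

/-- Recognizes the configurations with identical inputs. -/
def uniformCheck (z : AdjList × List (ℕ × ℕ × List Bool)) : Bool :=
  z.2.head?.elim false fun b => z.2.all fun a => decide (a.2.2 = b.2.2)

section Primrec
variable {α : Type*} [Primcodable α]

@[fun_prop]
theorem primrec_quotientCheck {l : α → AdjList} {x : α → ℕ} {H : α → GraphCode} (hl : Primrec l)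
    (hx : Primrec x) (hH : Primrec H) :
    Primrec (fun a => quotientCheck (l a) (x a) (H a)) := by
  unfold quotientCheck; fun_prop

@[fun_prop]
theorem primrec_parseTeam {s : α → List Bool} (hs : Primrec s) :
    Primrec (fun a => parseTeam (s a)) := by
  unfold parseTeam; fun_prop

@[fun_prop]
theorem primrec_parseQuotient {s : α → List Bool} (hs : Primrec s) :
    Primrec (fun a => parseQuotient (s a)) := by
  unfold parseQuotient; fun_prop

@[fun_prop]
theorem primrec_omegaCheck {z : α → AdjList × List (ℕ × ℕ × List Bool)} (hz : Primrec z) :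
    Primrec (fun a => omegaCheck (z a)) := by
  unfold omegaCheck; fun_prop

@[fun_prop]
theorem primrec_uniformCheck {z : α → AdjList × List (ℕ × ℕ × List Bool)} (hz : Primrec z) :
    Primrec (fun a => uniformCheck (z a)) := by
  unfold uniformCheck; fun_prop

end Primrec

theorem parseTeam_eq_some {s : List Bool} {k : ℕ} : parseTeam s = some k ↔ s = bin (1, bin k) := by
  unfold parseTeam
  rw [Option.bind_eq_some_iff]
  constructor
  · rintro ⟨⟨i, t⟩, h1, h2⟩
    rw [parse_eq_some] at h1
    by_cases hi : i = 1
    · simp only [hi, decide_true, cond_true] at h2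
      rw [← h1, hi, parse_eq_some.1 h2]
    · simp [hi] at h2
  · rintro rfl
    exact ⟨(1, bin k), parse_eq_some.2 rfl, parse_eq_some.2 rfl⟩

theorem parseQuotient_eq_some {s : List Bool} {H : GraphCode} :
    parseQuotient s = some H ↔ s = bin (2, bin H) := by
  unfold parseQuotient
  rw [Option.bind_eq_some_iff]
  constructor
  · rintro ⟨⟨i, t⟩, h1, h2⟩
    rw [parse_eq_some] at h1
    by_cases hi : i = 2
    · simp only [hi, decide_true, cond_true] at h2
      rw [← h1, hi, parse_eq_some.1 h2]
    · simp [hi] at h2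
  · rintro rfl
    exact ⟨(2, bin H), parse_eq_some.2 rfl, parse_eq_some.2 rfl⟩

theorem fits_iff {H : GraphCode} {o : List (List ℕ × ℕ × ℕ)} :
    fits H o = true ↔ ∃ x < H.1, ∀ w b, (w, b) ∈ o → obs (adjList H) x w = b := by
  simp [fits, List.any_eq_true, List.all_eq_true]

/-- Soundness needs the observations on sufficiently many words only. -/
theorem isomorphic_of_fits {G : PortGraph} {v : Fin G.size} {H : GraphCode} {K L : ℕ}
    (hg : goodCheck H = true) (hK : ∀ x, degree G.code x ≤ K) (hL : G.size * H.1 ≤ L)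
    (hf : fits H ((words K L).map fun w => (w, obs G.code v w)) = true) :
    G.quotient.Isomorphic H.toGraph := by
  obtain ⟨x, hx, h⟩ := fits_iff.1 hf
  have hg := goodCheck_iff.1 hg
  refine hg.isomorphic (v := v) hx ?_
  refine Alike.same G.reversible_code hg.reversible hK (by simp) (by simpa using hx)
    fun w hw => ?_
  have hw' : w ∈ words K L := by
    rw [mem_words] at hw ⊢
    refine ⟨hw.1.trans ?_, hw.2⟩
    simpa using hL
  exact (h w _ (List.mem_map_of_mem (f := fun w => (w, obs G.code v w)) hw')).symm

/-- Valid for every list of words: this is what makes the verification immune to false certificates.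
-/
theorem fits_of_isomorphic {G : PortGraph} (v : Fin G.size) {H : GraphCode}
    (h : G.quotient.Isomorphic H.toGraph) (W : List (List ℕ)) :
    fits H (W.map fun w => (w, obs G.code v w)) = true := by
  obtain ⟨x, hx, hs⟩ := (Good.of_isomorphic h).2 v
  refine fits_iff.2 ⟨x, hx, fun w b hw => ?_⟩
  simp only [List.mem_map, Prod.mk.injEq] at hw
  obtain ⟨w, -, rfl, rfl⟩ := hw
  exact (hs w).symm

theorem quotientCheck_iff {G : PortGraph} (v : Fin G.size) {H : GraphCode} :
    quotientCheck G.code v H = true ↔ G.quotient.Isomorphic H.toGraph := by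
  unfold quotientCheck
  rw [Bool.and_eq_true]
  constructor
  · rintro ⟨h1, h2⟩
    exact isomorphic_of_fits h1 degree_le_maxDegree (by simp) h2
  · intro h
    exact ⟨goodCheck_iff.2 (Good.of_isomorphic h).1, fits_of_isomorphic v h _⟩

/-- Membership in `Ω`. -/
theorem mem_omega {C : Config} : C ∈ Omega.yes ↔ C.Uniform ∧
    ((∃ k : ℕ, 0 < k ∧ k < C.numAgents ∧ ∀ a, C.input a = bin (1, bin k)) ∨
      ∃ H : GraphCode, ¬ C.graph.quotient.Isomorphic H.toGraph ∧
        ∀ a, C.input a = bin (2, bin H)) := by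
  refine and_congr_right fun _ => ⟨?_, ?_⟩
  · rintro ⟨i, w, hw, h⟩
    match i, hw, h with
    | ⟨0, _⟩, hw, h =>
      obtain ⟨k, hk, hi, hlt⟩ : C.withInput w ∈ teamsize := h
      exact Or.inl ⟨k, hk, hlt, fun a => (hw a).trans (by rw [show w a = bin k from hi a])⟩
    | ⟨1, _⟩, hw, h =>
      obtain ⟨H, hi, hlt⟩ : C.withInput w ∈ quotient := h
      exact Or.inr ⟨H, hlt, fun a => (hw a).trans (by rw [show w a = bin H from hi a])⟩
  · rintro (⟨k, hk, hlt, hi⟩ | ⟨H, hlt, hi⟩)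
    · exact ⟨⟨0, by simp⟩, fun _ => bin k, hi, k, hk, fun _ => rfl, hlt⟩
    · exact ⟨⟨1, by simp⟩, fun _ => bin H, hi, H, fun _ => rfl, hlt⟩

/-- The first agent. -/
def Config.first (C : Config) : Fin C.numAgents := ⟨0, C.numAgents_pos⟩

theorem Config.head?_code (C : Config) : C.code.2.head? =
    some ((C.start C.first).val, C.ident C.first, C.input C.first) := by
  have := C.numAgents_pos
  rw [List.head?_eq_getElem?]
  simp [Config.code, this, Config.first]

theorem Config.mem_code {C : Config} {z : ℕ × ℕ × List Bool} :
    z ∈ C.code.2 ↔ ∃ a, ((C.start a).val, C.ident a, C.input a) = z := by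
  simp [Config.code, List.mem_ofFn]

@[simp] theorem Config.length_code (C : Config) : C.code.2.length = C.numAgents := by
  simp [Config.code]

theorem uniformCheck_iff (C : Config) : uniformCheck C.code = true ↔ C.Uniform := by
  unfold uniformCheck
  rw [C.head?_code]
  simp only [Option.elim_some, List.all_eq_true, decide_eq_true_eq]
  constructor
  · intro h a b
    exact (h _ (Config.mem_code.2 ⟨a, rfl⟩)).trans (h _ (Config.mem_code.2 ⟨b, rfl⟩)).symm
  · intro h z hz
    obtain ⟨a, rfl⟩ := Config.mem_code.1 hz
    exact h _ _

theorem mem_omega_of_uniform {C : Config} (hC : C.Uniform) (a : Fin C.numAgents) :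
    C ∈ Omega.yes ↔ (∃ k, parseTeam (C.input a) = some k ∧ 0 < k ∧ k < C.numAgents) ∨
      ∃ H, parseQuotient (C.input a) = some H ∧ ¬ C.graph.quotient.Isomorphic H.toGraph := by
  rw [mem_omega]
  simp only [parseTeam_eq_some, parseQuotient_eq_some]
  constructor
  · rintro ⟨-, ⟨k, h1, h2, h3⟩ | ⟨H, h1, h2⟩⟩
    · exact Or.inl ⟨k, h3 a, h1, h2⟩
    · exact Or.inr ⟨H, h2 a, h1⟩
  · rintro (⟨k, h1, h2, h3⟩ | ⟨H, h1, h2⟩)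
    · exact ⟨hC, Or.inl ⟨k, h2, h3, fun b => (hC b a).trans h1⟩⟩
    · exact ⟨hC, Or.inr ⟨H, h2, fun b => (hC b a).trans h1⟩⟩

theorem omegaCheck_iff (C : Config) : omegaCheck C.code = true ↔ C ∈ Omega.yes := by
  have hu := uniformCheck_iff C
  unfold uniformCheck at hu
  unfold omegaCheck
  rw [C.head?_code] at hu ⊢
  simp only [Option.elim_some] at hu ⊢
  rw [Bool.and_eq_true, hu]
  by_cases hC : C.Uniform
  · rw [mem_omega_of_uniform hC C.first, Bool.or_eq_true]
    simp only [hC, true_and]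
    refine or_congr ?_ ?_
    · rcases parseTeam (C.input C.first) with _ | k <;> simp
    · rcases parseQuotient (C.input C.first) with _ | H
      · simp
      · have := quotientCheck_iff (G := C.graph) ⟨0, C.graph.size_pos⟩ (H := H)
        simp only [Option.elim_some, Bool.not_eq_true', Option.some.injEq, exists_eq_left', ← this,
          Bool.not_eq_true]
        rfl
  · exact iff_of_false (fun h => hC h.1) fun h => hC h.1

/-- An isomorphism preserves observations, so a single node of `G'` with a view occurring in `H` is
available, and `Good.isomorphic` applies without transporting the quotient. -/
theorem Equivalent.quotient_isomorphic {G G' : PortGraph} (α : PortGraph.Iso G G')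
    {H : GraphCode} (h : G.quotient.Isomorphic H.toGraph) : G'.quotient.Isomorphic H.toGraph := by
  have hc : ∀ v p, crossing G'.code (α.toEquiv v) p =
      (G.cross v p).map fun e => ((α.toEquiv e.1).val, e.2) := by
    intro v p
    rw [G'.crossing_code, α.cross_eq, Option.map_map]
    rfl
  have hd : ∀ v : Fin G.size, degree G.code v = degree G'.code (α.toEquiv v) := by
    intro v
    have key : ∀ p, (1 ≤ p ∧ p ≤ degree G.code v) ↔
        (1 ≤ p ∧ p ≤ degree G'.code (α.toEquiv v)) := by
      intro p
      rw [← crossing_isSome, ← crossing_isSome, hc, G.crossing_code]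
      simp
    have h1 := key (degree G.code v)
    have h2 := key (degree G'.code (α.toEquiv v))
    omega
  have hs : ∀ v : Fin G.size, Same G.code v G'.code (α.toEquiv v) := by
    intro v w
    induction w generalizing v with
    | nil => rw [obs_nil, obs_nil, hd]
    | cons p w ih =>
      have key : obs G.code v [p] = obs G'.code (α.toEquiv v) [p] ∧
          obs G.code (target G.code v [p]) w =
            obs G'.code (target G'.code (α.toEquiv v) [p]) w := by
        have h2 := hc v p
        rcases hcr : G.cross v p with _ | ⟨u, q⟩
        · rw [hcr] at h2
          have h1 : crossing G.code v p = none := by rw [G.crossing_code, hcr]; rfl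
          simp only [obs, target, walk_cons, walk_nil, move_of_none _ h1,
            move_of_none _ (show crossing G'.code (α.toEquiv v) p = none from h2)]
          exact ⟨by rw [hd], ih v⟩
        · rw [hcr] at h2
          have h1 := G.crossing_code_eq_some.2 hcr
          rw [target_singleton h1, target_singleton h2]
          simp only [obs, walk_cons, walk_nil, move_of_some _ h1, move_of_some _ h2]
          exact ⟨by rw [hd], ih u⟩
      rw [obs_cons, obs_cons (α.toEquiv v).val, key.1, key.2]
  obtain ⟨x, hx, hsx⟩ := (Good.of_isomorphic h).2 ⟨0, G.size_pos⟩
  exact (Good.of_isomorphic h).1.isomorphic hx ((hs _).symm.trans hsx)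

/-- The inverse isomorphism. -/
def PortGraph.Iso.symm {G G' : PortGraph} (α : PortGraph.Iso G G') : PortGraph.Iso G' G where
  toEquiv := α.toEquiv.symm
  cross_eq v p := by
    have := α.cross_eq (α.toEquiv.symm v) p
    rw [Equiv.apply_symm_apply] at this
    rw [this, Option.map_map]
    rcases G.cross (α.toEquiv.symm v) p with _ | e <;> simp

theorem Equivalent.symm {C D : Config} (h : C.Equivalent D) : D.Equivalent C := by
  obtain ⟨α, σ, h⟩ := h
  refine ⟨α.symm, σ.symm, fun b => ?_⟩
  obtain ⟨a, rfl⟩ := σ.surjective b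
  obtain ⟨h1, h2, h3⟩ := h a
  rw [Equiv.symm_apply_apply]
  exact ⟨by rw [h1]; exact (α.toEquiv.symm_apply_apply _).symm, h2.symm, h3.symm⟩

theorem Equivalent.uniform {C D : Config} (h : C.Equivalent D) (hC : C.Uniform) : D.Uniform := by
  obtain ⟨α, σ, h⟩ := h
  intro a b
  obtain ⟨a, rfl⟩ := σ.surjective a
  obtain ⟨b, rfl⟩ := σ.surjective b
  rw [(h a).2.2, (h b).2.2]
  exact hC a b

theorem Equivalent.mem_omega {C D : Config} (h : C.Equivalent D) (hC : C ∈ Omega.yes) :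
    D ∈ Omega.yes := by
  have hu := Equivalent.uniform h hC.1
  obtain ⟨α, σ, h⟩ := h
  have hn : C.numAgents = D.numAgents := by simpa using Fintype.card_congr σ
  rw [mem_omega_of_uniform hC.1 C.first] at hC
  rw [mem_omega_of_uniform hu (σ C.first), (h C.first).2.2, ← hn]
  refine hC.imp_right ?_
  rintro ⟨H, h1, h2⟩
  exact ⟨H, h1, fun h3 => h2 (Equivalent.quotient_isomorphic α.symm h3)⟩

theorem isDecisionProblem_omega : IsDecisionProblem Omega := by
  refine ⟨⟨uniformCheck, Primrec.to_comp (by fun_prop), fun C => (uniformCheck_iff C).symm⟩,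
    ⟨omegaCheck, Primrec.to_comp (by fun_prop), fun C => (omegaCheck_iff C).symm⟩, ?_, ?_⟩
  · exact fun C D h => ⟨Equivalent.uniform h, Equivalent.uniform (Equivalent.symm h)⟩
  · exact fun C D h => ⟨Equivalent.mem_omega h, Equivalent.mem_omega (Equivalent.symm h)⟩

/-! The exploration protocol

Time is divided into slots. Every pair of an identity and a word of port numbers belongs to one
slot, in which the agent with that identity follows the word, records what it sees at the end, and
returns to its starting node, while all other agents stay. Decisions are made between slots. -/

/-- What an agent sees: the entry port, the degree, and the identities and inputs of all agents at
its node. -/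
abbrev Sight : Type := ℕ × ℕ × List (ℕ × List Bool)

/-- The identity, input and certificate of an agent, what it saw at the end of each slot, and all
answers of the black box. -/
abbrev Knowledge : Type := (ℕ × List Bool × List Bool) × List Sight × List (Option Bool)

/-- The knowledge of an agent; the rest of the way, the way back, and whether it is on its way
out. -/
abbrev Memory : Type := Knowledge × List ℕ × List ℕ × Bool

/-- The identity and the word that belong to a slot. -/
def task (s : ℕ) : ℕ × List ℕ := Denumerable.ofNat (ℕ × List ℕ) s

/-- The way of an agent in a slot. -/
def route (i s : ℕ) : List ℕ :=
  bif decide ((task s).1 = i) then (task s).2 else (task s).2.map fun _ => 0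

/-- The initial memory of the exploration protocol. -/
def exploreInit (d : ℕ × List Bool × List Bool) : Memory := ((d, [], []), route d.1 0, [], true)

/-- What is recorded at the end of the way out. -/
def record (s i entry deg : ℕ) (here : List (ℕ × ℕ × Memory)) : Sight :=
  bif decide ((task s).1 = i) then (entry, deg, here.map fun e => (e.1, e.2.2.1.1.2.1))
  else (0, 0, [])

/-- A round of the exploration protocol. -/
def exploreNext (z : Memory × ℕ × ℕ × Option Bool × List (ℕ × ℕ × Memory)) : Memory × ℕ :=
  bif z.1.2.2.2 then
    z.1.2.1.head?.elim
      -- The word is exhausted: one round is spent in place to record and turn round. Every round on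
      -- the way out, this one included, pushes the current entry port; the stack is the way home,
      -- and its last letter is the 0 with which the slot began.
      (((z.1.1.1, z.1.1.2.1 ++ [record z.1.1.2.1.length z.1.1.1.1 z.2.1 z.2.2.1 z.2.2.2.2],
        z.1.1.2.2 ++ [z.2.2.2.1]), [], z.2.1 :: z.1.2.2.1, false), 0)
      fun p => (((z.1.1.1, z.1.1.2.1, z.1.1.2.2 ++ [z.2.2.2.1]),
        z.1.2.1.tail, z.2.1 :: z.1.2.2.1, true), p)
  else
    (((z.1.1.1, z.1.1.2.1, z.1.1.2.2 ++ [z.2.2.2.1]),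
      bif decide (z.1.2.2.1.tail = []) then (route z.1.1.1.1 z.1.1.2.1.length, [], true)
      else ([], z.1.2.2.1.tail, false)), z.1.2.2.1.head?.getD 0)

section Primrec
variable {α : Type*} [Primcodable α]

@[fun_prop]
theorem primrec_task {s : α → ℕ} (hs : Primrec s) : Primrec (fun a => task (s a)) := by
  unfold task; fun_prop

@[fun_prop]
theorem primrec_route {i s : α → ℕ} (hi : Primrec i) (hs : Primrec s) :
    Primrec (fun a => route (i a) (s a)) := by
  unfold route; fun_prop

@[fun_prop]
theorem primrec_record {s i e d : α → ℕ} {h : α → List (ℕ × ℕ × Memory)} (hs : Primrec s)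
    (hi : Primrec i) (he : Primrec e) (hd : Primrec d) (hh : Primrec h) :
    Primrec (fun a => record (s a) (i a) (e a) (d a) (h a)) := by
  unfold record; fun_prop

theorem primrec_exploreInit : Primrec exploreInit := by
  unfold exploreInit; fun_prop

theorem primrec_exploreNext : Primrec exploreNext := by
  unfold exploreNext; fun_prop

end Primrec

/-- The exploration protocol, with a rule for decisions. -/
def explorer (D : Knowledge → Option Bool) (hD : Computable D) : Protocol where
  Mem := Memory
  init := exploreInit
  -- Being on the way out with an empty stack characterizes the beginning of a slot, when the agent
  -- is at home.
  verdict m := bif m.2.2.2 && decide (m.2.2.1 = []) then D m.1 else none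
  -- The query is the binary expansion of the number of past answers, so `bin z` is submitted in
  -- round `Encodable.encode z`.
  query m := some m.1.2.2.length.bits
  next := exploreNext
  init_computable := primrec_exploreInit.to_comp
  verdict_computable := Computable.cond (Primrec.to_comp (by fun_prop)) (hD.comp Computable.fst)
    (Computable.const none)
  query_computable := Primrec.to_comp (by fun_prop)
  next_computable := primrec_exploreNext.to_comp

/-- The identities and inputs that agent `a` sees at node `v` when all others are at their starting
nodes. -/
def Config.seen (C : Config) (a : Fin C.numAgents) (v : Fin C.graph.size) :
    List (ℕ × List Bool) :=
  (((List.finRange C.numAgents).filter fun b => b = a ∨ C.start b = v).insertionSort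
    fun b c => C.ident b ≤ C.ident c).map fun b => (C.ident b, C.input b)

/-- What agent `a` sees at the end of a walk when all others are at their starting nodes. -/
def Config.sight (C : Config) (a : Fin C.numAgents) (w : List ℕ) : Sight :=
  ((walk C.graph.cross (C.start a, 0) w).2, C.graph.deg (walk C.graph.cross (C.start a, 0) w).1,
    C.seen a (walk C.graph.cross (C.start a, 0) w).1)

/-- The entry of slot `s` in the record of agent `a`. -/
def Config.entry (C : Config) (a : Fin C.numAgents) (s : ℕ) : Sight :=
  bif decide ((task s).1 = C.ident a) then C.sight a (task s).2 else (0, 0, [])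

/-- The beginning of a slot. -/
def clock : ℕ → ℕ
  | 0 => 0
  -- For a word of length `n`: `n` rounds out, one to turn, and `n + 1` back, the last being the
  -- dummy move by port 0.
  | s + 1 => clock s + (2 * (task s).2.length + 2)

/-- The answers of a black box in the first `t` rounds. -/
def answers (o : List Bool → Bool) (t : ℕ) : List (Option Bool) :=
  (List.range t).map fun i => some (o i.bits)

/-- The knowledge of agent `a` at the beginning of slot `s` if it has not decided. -/
def Config.knowledge (C : Config) (x : Fin C.numAgents → List Bool) (o : List Bool → Bool)
    (a : Fin C.numAgents) (s : ℕ) : Knowledge :=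
  ((C.ident a, C.input a, x a), (List.range s).map (C.entry a), answers o (clock s))

@[simp] theorem length_route (i s : ℕ) : (route i s).length = (task s).2.length := by
  unfold route
  cases decide ((task s).1 = i) <;> simp

theorem answers_succ (o : List Bool → Bool) (t : ℕ) :
    answers o (t + 1) = answers o t ++ [some (o t.bits)] := by
  simp [answers, List.range_succ]

@[simp] theorem length_answers (o : List Bool → Bool) (t : ℕ) : (answers o t).length = t := by
  simp [answers]

theorem walk_zeros (G : PortGraph) (v : Fin G.size) (w : List ℕ) :
    walk G.cross (v, 0) (w.map fun _ => 0) = (v, 0) := by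
  induction w with
  | nil => rfl
  | cons p w ih =>
    rw [List.map_cons, walk_cons, move_of_none _ (G.cross_eq_none (by omega)), ih]

/-- Failed moves are covered too: their entry port 0 is again no port, so leaving by the entry port
always undoes a move. -/
theorem move_back (G : PortGraph) (s : Fin G.size × ℕ) (p e : ℕ) :
    (move G.cross ((move G.cross s p).1, e) (move G.cross s p).2).1 = s.1 := by
  rcases h : G.cross s.1 p with _ | ⟨v, q⟩
  · rw [show move G.cross s p = (s.1, 0) from move_of_none _ h 0,
      move_of_none _ (G.cross_eq_none (by omega))]
  · rw [show move G.cross s p = (v, q) from move_of_some _ h 0, move_of_some _ (G.cross_symm h)]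

/-! ### Executions of arbitrary protocols -/

namespace Protocol

theorem step_of_none {P : Protocol} {C : Config} {o : List Bool → Bool}
    {σ : Fin C.numAgents → AgentState C.graph P.Mem} {a : Fin C.numAgents}
    (h : P.verdict (σ a).mem = none) : P.step C o σ a =
      let r := P.next ((σ a).mem, (σ a).entry, C.graph.deg (σ a).pos,
        (P.query (σ a).mem).map o, P.here C σ a)
      ⟨(move C.graph.cross ((σ a).pos, 0) r.2).1, (move C.graph.cross ((σ a).pos, 0) r.2).2,
        r.1⟩ := by
  unfold step move
  rw [h]
  simp only [Option.isSome_none, Bool.false_eq_true, if_false]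
  split <;> rename_i h <;> simp [h]

theorem step_of_some {P : Protocol} {C : Config} {o : List Bool → Bool}
    {σ : Fin C.numAgents → AgentState C.graph P.Mem} {a : Fin C.numAgents}
    (h : (P.verdict (σ a).mem).isSome) : P.step C o σ a = ⟨(σ a).pos, 0, (σ a).mem⟩ := by
  unfold step
  rw [if_pos h]

theorem run_mem_of_verdict {P : Protocol} {C : Config} {x : Fin C.numAgents → List Bool}
    {o : List Bool → Bool} {a : Fin C.numAgents} {t : ℕ}
    (h : (P.verdict (P.run C x o t a).mem).isSome) (k : ℕ) :
    (P.run C x o (t + k) a).mem = (P.run C x o t a).mem := by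
  induction k with
  | zero => rfl
  | succ k ih =>
    rw [← add_assoc, run, step_of_some (by rw [ih]; exact h), ih]

theorem Decides.unique {P : Protocol} {C : Config} {x : Fin C.numAgents → List Bool}
    {o : List Bool → Bool} {a : Fin C.numAgents} {b b' : Bool} (h : P.Decides C x o a b)
    (h' : P.Decides C x o a b') : b = b' := by
  obtain ⟨t, ht⟩ := h
  obtain ⟨t', ht'⟩ := h'
  have h1 := run_mem_of_verdict (P := P) (t := t) (by rw [ht]; rfl) t'
  have h2 := run_mem_of_verdict (P := P) (t := t') (by rw [ht']; rfl) t
  rw [add_comm t' t, h1] at h2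
  rw [h2, ht'] at ht
  exact (Option.some.inj ht).symm

end Protocol

/-! ### Execution of the exploration protocol -/

section Explorer
variable {D : Knowledge → Option Bool} {hD : Computable D} {C : Config}
  {x : Fin C.numAgents → List Bool} {o : List Bool → Bool}

/-- The situation of agent `a` at the beginning of slot `s` if it has not decided before. -/
def Config.ready (C : Config) (x : Fin C.numAgents → List Bool) (o : List Bool → Bool)
    (a : Fin C.numAgents) (s : ℕ) : AgentState C.graph Memory :=
  ⟨C.start a, 0, (C.knowledge x o a s, route (C.ident a) s, [], true)⟩

/-- The situation of agent `a` after `j` rounds of slot `s`, on the way out. -/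
def Config.Outward (C : Config) (x : Fin C.numAgents → List Bool) (o : List Bool → Bool)
    (a : Fin C.numAgents) (s j : ℕ) (σ : AgentState C.graph Memory) : Prop :=
  ∃ st : List ℕ, st.length = j ∧
    (σ.pos, σ.entry) = walk C.graph.cross (C.start a, 0) ((route (C.ident a) s).take j) ∧
    walk C.graph.cross (σ.pos, 0) (σ.entry :: st) = (C.start a, 0) ∧
    σ.mem = (((C.ident a, C.input a, x a), (List.range s).map (C.entry a),
      answers o (clock s + j)), (route (C.ident a) s).drop j, st, true)

/-- The situation of agent `a` in slot `s`, on the way back, when `k` rounds are left. -/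
def Config.Homeward (C : Config) (x : Fin C.numAgents → List Bool) (o : List Bool → Bool)
    (a : Fin C.numAgents) (s k : ℕ) (σ : AgentState C.graph Memory) : Prop :=
  ∃ st : List ℕ, st.length = k ∧ walk C.graph.cross (σ.pos, 0) st = (C.start a, 0) ∧
    ∃ t, t + k = clock (s + 1) ∧
    σ.mem = (((C.ident a, C.input a, x a), (List.range (s + 1)).map (C.entry a),
      answers o t), [], st, false)

theorem explorer_outward_step {σ : Fin C.numAgents → AgentState C.graph Memory}
    {a : Fin C.numAgents} {s j : ℕ} (hj : j < (task s).2.length) (h : C.Outward x o a s j (σ a))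
    (hv : (explorer D hD).verdict (σ a).mem = none) :
    C.Outward x o a s (j + 1) ((explorer D hD).step C o σ a) := by
  obtain ⟨st, hst, hw, hb, hm⟩ := h
  rw [Protocol.step_of_none hv]
  have hlt : j < (route (C.ident a) s).length := by simpa using hj
  have hd : (route (C.ident a) s).drop j =
    (route (C.ident a) s)[j] :: (route (C.ident a) s).drop (j + 1) := List.drop_eq_getElem_cons hlt
  have hr : (explorer D hD).next ((σ a).mem, (σ a).entry, C.graph.deg (σ a).pos,
      ((explorer D hD).query (σ a).mem).map o, (explorer D hD).here C σ a) =
      ((((C.ident a, C.input a, x a), (List.range s).map (C.entry a),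
      answers o (clock s + (j + 1))), (route (C.ident a) s).drop (j + 1), (σ a).entry :: st, true),
      (route (C.ident a) s)[j]) := by
    simp only [explorer, exploreNext, hm, hd]
    simp [← add_assoc, answers_succ, List.getElem?_eq_getElem hlt]
  simp only [hr]
  have hmv : move C.graph.cross ((σ a).pos, 0) (route (C.ident a) s)[j] =
      walk C.graph.cross (C.start a, 0) ((route (C.ident a) s).take (j + 1)) := by
    rw [List.take_succ_eq_append_getElem hlt, walk_append, ← hw]
    rfl
  refine ⟨(σ a).entry :: st, by simp [hst], hmv, ?_, rfl⟩
  rw [walk_cons]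
  have := move_back C.graph ((σ a).pos, 0) (route (C.ident a) s)[j] 0
  rw [walk_entry _ _ _ 0 (by simp), this]
  exact hb

/-- The others need to be at home only in slots owned by `a`, since in all other slots the record is
a placeholder. -/
theorem explorer_turn {σ : Fin C.numAgents → AgentState C.graph Memory}
    {a : Fin C.numAgents} {s : ℕ} (h : C.Outward x o a s (task s).2.length (σ a))
    (hpos : ∀ b, b ≠ a → C.ident a = (task s).1 → (σ b).pos = C.start b)
    (hdat : ∀ b, (σ b).mem.1.1.2.1 = C.input b)
    (hv : (explorer D hD).verdict (σ a).mem = none) :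
    C.Homeward x o a s ((task s).2.length + 1) ((explorer D hD).step C o σ a) := by
  obtain ⟨st, hst, hw, hb, hm⟩ := h
  rw [Protocol.step_of_none hv]
  have hd : (route (C.ident a) s).drop (task s).2.length = [] := by simp
  have ht : (route (C.ident a) s).take (task s).2.length = route (C.ident a) s :=
    List.take_of_length_le (by simp)
  rw [ht] at hw
  have hrec : record s (C.ident a) (σ a).entry (C.graph.deg (σ a).pos)
      ((explorer D hD).here C σ a) = C.entry a s := by
    unfold record Config.entry
    by_cases hi : (task s).1 = C.ident a
    · have hro : route (C.ident a) s = (task s).2 := by simp [route, hi]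
      simp only [hi, decide_true, cond_true, Config.sight]
      rw [hro] at hw
      rw [← hw]
      refine congrArg (fun l => ((σ a).entry, C.graph.deg (σ a).pos, l)) ?_
      unfold Protocol.here Config.seen
      refine List.map_map.trans ?_
      have hf : ((List.finRange C.numAgents).filter fun b => (σ b).pos = (σ a).pos) =
          (List.finRange C.numAgents).filter fun b => b = a ∨ C.start b = (σ a).pos := by
        refine List.filter_congr fun b _ => ?_
        by_cases hba : b = a
        · simp [hba]
        · simp [hba, hpos b hba hi.symm]
      rw [hf]
      refine List.map_congr_left fun b _ => ?_
      exact congrArg (Prod.mk (C.ident b)) (hdat b)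
    · simp [hi]
  have hr : (explorer D hD).next ((σ a).mem, (σ a).entry, C.graph.deg (σ a).pos,
      ((explorer D hD).query (σ a).mem).map o, (explorer D hD).here C σ a) =
      ((((C.ident a, C.input a, x a), (List.range (s + 1)).map (C.entry a),
      answers o (clock s + (task s).2.length + 1)), [], (σ a).entry :: st, false), 0) := by
    have hrec' := hrec
    simp only [explorer] at hrec'
    simp only [explorer, exploreNext, hm, hd]
    simp [answers_succ, List.range_succ, hrec']
  simp only [hr]
  have hmv : move C.graph.cross ((σ a).pos, 0) 0 = ((σ a).pos, 0) :=
    move_of_none _ (C.graph.cross_eq_none (by omega)) 0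
  refine ⟨(σ a).entry :: st, by simp [hst], ?_, _, ?_, rfl⟩
  · rw [hmv]
    exact hb
  · simp only [clock]; omega

theorem explorer_homeward_step {σ : Fin C.numAgents → AgentState C.graph Memory}
    {a : Fin C.numAgents} {s k : ℕ} (h : C.Homeward x o a s (k + 2) (σ a)) :
    C.Homeward x o a s (k + 1) ((explorer D hD).step C o σ a) := by
  obtain ⟨st, hst, hw, t, ht, hm⟩ := h
  have hv : (explorer D hD).verdict (σ a).mem = none := by simp [explorer, hm]
  rw [Protocol.step_of_none hv]
  obtain ⟨e, st, rfl⟩ := List.exists_cons_of_length_eq_add_one hst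
  have hne : st ≠ [] := by rintro rfl; simp at hst
  have hr : (explorer D hD).next ((σ a).mem, (σ a).entry, C.graph.deg (σ a).pos,
      ((explorer D hD).query (σ a).mem).map o, (explorer D hD).here C σ a) =
      ((((C.ident a, C.input a, x a), (List.range (s + 1)).map (C.entry a),
      answers o (t + 1)), [], st, false), e) := by
    simp only [explorer, exploreNext, hm]
    simp [answers_succ, hne]
  simp only [hr]
  refine ⟨st, by simpa using hst, ?_, t + 1, by omega, rfl⟩
  rw [walk_cons] at hw
  rwa [walk_entry _ _ 0 (move C.graph.cross ((σ a).pos, 0) e).2 hne]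

/-- The stack ends with port 0, so the agent arrives with entry port 0, in exactly the situation
required at the beginning of a slot. -/
theorem explorer_arrive {σ : Fin C.numAgents → AgentState C.graph Memory}
    {a : Fin C.numAgents} {s : ℕ} (h : C.Homeward x o a s 1 (σ a)) :
    (explorer D hD).step C o σ a = C.ready x o a (s + 1) := by
  obtain ⟨st, hst, hw, t, ht, hm⟩ := h
  have hv : (explorer D hD).verdict (σ a).mem = none := by simp [explorer, hm]
  rw [Protocol.step_of_none hv]
  obtain ⟨e, rfl⟩ := List.length_eq_one_iff.1 hst
  have hr : (explorer D hD).next ((σ a).mem, (σ a).entry, C.graph.deg (σ a).pos,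
      ((explorer D hD).query (σ a).mem).map o, (explorer D hD).here C σ a) =
      ((C.knowledge x o a (s + 1), route (C.ident a) (s + 1), [], true), e) := by
    simp only [explorer, exploreNext, hm, Config.knowledge, ← ht]
    simp [answers_succ]
  simp only [hr]
  rw [walk_cons, walk_nil] at hw
  rw [hw]
  rfl

theorem explorer_verdict_ready {a : Fin C.numAgents} {s : ℕ} :
    (explorer D hD).verdict (C.ready x o a s).mem = D (C.knowledge x o a s) := rfl

/-- The execution of the exploration protocol at the beginning of a slot. -/
theorem explorer_run (s : ℕ) (a : Fin C.numAgents) : ∃ s' ≤ s,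
    (explorer D hD).run C x o (clock s) a = C.ready x o a s' ∧
    (∀ r < s', D (C.knowledge x o a r) = none) ∧
    (s' = s ∨ (D (C.knowledge x o a s')).isSome) := by
  induction s generalizing a with
  | zero => exact ⟨0, le_rfl, rfl, by simp, Or.inl rfl⟩
  | succ s ih =>
    choose s' hs' hrun hnone hsome using ih
    -- An agent that has decided is frozen at its starting node, where it still shows its identity
    -- and input.
    have hfix : ∀ a, (D (C.knowledge x o a (s' a))).isSome → ∀ j,
        (explorer D hD).run C x o (clock s + j) a = C.ready x o a (s' a) := by
      intro a ha j
      induction j with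
      | zero => exact hrun a
      | succ j ih =>
        rw [← add_assoc, Protocol.run, Protocol.step_of_some]
        · rw [ih]; rfl
        · rw [ih]; exact ha
    have hgo : ∀ a, ¬ (D (C.knowledge x o a (s' a))).isSome → s' a = s := fun a ha =>
      (hsome a).resolve_right ha
    have hout : ∀ j ≤ (task s).2.length, ∀ a, ¬ (D (C.knowledge x o a (s' a))).isSome →
        C.Outward x o a s j ((explorer D hD).run C x o (clock s + j) a) ∧
        (explorer D hD).verdict ((explorer D hD).run C x o (clock s + j) a).mem = none := by
      intro j
      induction j with
      | zero =>
        intro _ a ha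
        have h1 := hrun a
        have h2 := ha
        rw [hgo a ha] at h1 h2
        rw [add_zero, h1]
        refine ⟨⟨[], rfl, rfl, ?_, rfl⟩, explorer_verdict_ready.trans (by simpa using h2)⟩
        rw [walk_cons, walk_nil]
        exact move_of_none _ (C.graph.cross_eq_none (by simp [Config.ready])) 0
      | succ j ih =>
        intro hj a ha
        obtain ⟨h1, h2⟩ := ih (by omega) a ha
        have h3 := explorer_outward_step (D := D) (hD := hD) (by omega) h1 h2
        rw [← add_assoc, Protocol.run]
        refine ⟨h3, ?_⟩
        obtain ⟨st, hst, -, -, hm⟩ := h3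
        have hne : st ≠ [] := by rintro rfl; simp at hst
        simp only [explorer] at hm ⊢
        rw [hm]
        simp [hne]
    have hturn : ∀ a, ¬ (D (C.knowledge x o a (s' a))).isSome →
        C.Homeward x o a s ((task s).2.length + 1)
          ((explorer D hD).run C x o (clock s + (task s).2.length + 1) a) := by
      intro a ha
      obtain ⟨h1, h2⟩ := hout _ le_rfl a ha
      rw [Protocol.run]
      -- Every other agent is at home: it has stopped there, or its route consists of zeros because
      -- identities are distinct.
      refine explorer_turn h1 (fun b hba hi => ?_) (fun b => ?_) h2
      · by_cases hb : (D (C.knowledge x o b (s' b))).isSome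
        · rw [hfix b hb]; rfl
        · obtain ⟨⟨st, -, hw, -⟩, -⟩ := hout _ le_rfl b hb
          have hro : route (C.ident b) s = (task s).2.map fun _ => 0 := by
            have : (task s).1 ≠ C.ident b := fun e =>
              hba (C.ident_injective (e.symm.trans hi.symm))
            simp [route, this]
          rw [List.take_of_length_le (by simp), hro, walk_zeros] at hw
          exact congrArg Prod.fst hw
      · by_cases hb : (D (C.knowledge x o b (s' b))).isSome
        · rw [hfix b hb]; rfl
        · obtain ⟨⟨st, -, -, -, hm⟩, -⟩ := hout _ le_rfl b hb
          rw [hm]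
    have hhome : ∀ k j, k + j = (task s).2.length →
        ∀ a, ¬ (D (C.knowledge x o a (s' a))).isSome → C.Homeward x o a s (k + 1)
          ((explorer D hD).run C x o (clock s + (task s).2.length + 1 + j) a) := by
      intro k j
      induction j generalizing k with
      | zero =>
        intro hk a ha
        rw [show k = (task s).2.length by omega]
        exact hturn a ha
      | succ j ih =>
        intro hk a ha
        rw [← add_assoc, Protocol.run]
        exact explorer_homeward_step (ih (k + 1) (by omega) a ha)
    by_cases ha : (D (C.knowledge x o a (s' a))).isSome
    · exact ⟨s' a, (hs' a).trans (by omega), hfix a ha _, hnone a, Or.inr ha⟩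
    · refine ⟨s + 1, le_rfl, ?_, fun r hr => ?_, Or.inl rfl⟩
      · have h1 := hhome 0 _ (zero_add _) a ha
        rw [show clock (s + 1) = clock s + (task s).2.length + 1 + (task s).2.length + 1 by
          simp only [clock]; omega, Protocol.run]
        exact explorer_arrive h1
      · rcases Nat.lt_succ_iff_lt_or_eq.1 hr with h | rfl
        · exact hnone a r (by rw [hgo a ha]; exact h)
        · rw [hgo a ha] at ha
          simpa using ha

/-- The decision of an agent is the first one suggested by its knowledge. -/
theorem explorer_decides {a : Fin C.numAgents} {s : ℕ}
    (hs : (D (C.knowledge x o a s)).isSome) :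
    ∃ r b, D (C.knowledge x o a r) = some b ∧ (explorer D hD).Decides C x o a b := by
  obtain ⟨s', h1, h2, -, h3⟩ := explorer_run (D := D) (hD := hD) (x := x) (o := o) s a
  have h4 : (D (C.knowledge x o a s')).isSome := by
    rcases h3 with rfl | h3
    · exact hs
    · exact h3
  obtain ⟨b, hb⟩ := Option.isSome_iff_exists.1 h4
  exact ⟨s', b, hb, clock s, by rw [h2]; exact hb⟩

end Explorer

/-! Verification of `Ω` -/

/-- The entry port and the degree recorded by an agent at the end of a word. -/
def recorded (i : ℕ) (log : List Sight) (w : List ℕ) : ℕ × ℕ :=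
  log[Encodable.encode (i, w)]?.elim (0, 0) fun e => (e.1, e.2.1)

/-- All words of a list have been explored. -/
def explored (i : ℕ) (log : List Sight) (W : List (List ℕ)) : Bool :=
  W.all fun w => decide (Encodable.encode (i, w) < log.length)

/-- The elements of a list without repetitions. -/
def distinct (l : List ℕ) : List ℕ :=
  l.foldr (fun i r => bif r.any fun j => decide (j = i) then r else i :: r) []

/-- The identities of all agents seen. -/
def seenIdents (log : List Sight) : List ℕ := log.flatMap fun e => e.2.2.map fun z => z.1

/-- The words explored before deciding, for the given certificate and input. -/
def omegaWords (s cert : List Bool) : List (List ℕ) :=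
  -- For a graph with as many nodes as the certificate says, the first summand suffices to reach
  -- every agent and the product to compare the view with those in `H`. Degrees are bounded by the
  -- number of nodes as well.
  words (ofBits cert) (ofBits cert + ofBits cert * (parseQuotient s).elim 0 fun H => H.1)

/-- The answer of an agent that has explored the words. -/
def omegaAnswer (i : ℕ) (s cert : List Bool) (log : List Sight) : Bool :=
  ((parseTeam s).elim false fun k =>
    decide (0 < k) && decide (k < (distinct (seenIdents log)).length)) ||
  ((parseQuotient s).elim false fun H =>
    !(goodCheck H && fits H ((omegaWords s cert).map fun w => (w, recorded i log w))))

/-- The rule for decisions in the verification protocol for `Ω`. -/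
def omegaRule (k : Knowledge) : Option Bool :=
  bif explored k.1.1 k.2.1 (omegaWords k.1.2.1 k.1.2.2) then
    some (omegaAnswer k.1.1 k.1.2.1 k.1.2.2 k.2.1) else none

section Primrec
variable {α : Type*} [Primcodable α] {i : α → ℕ} {log : α → List Sight} {s x : α → List Bool}

@[fun_prop]
theorem primrec_recorded {w : α → List ℕ} (hi : Primrec i) (hl : Primrec log) (hw : Primrec w) :
    Primrec (fun a => recorded (i a) (log a) (w a)) := by
  unfold recorded; fun_prop

@[fun_prop]
theorem primrec_explored {W : α → List (List ℕ)} (hi : Primrec i) (hl : Primrec log)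
    (hW : Primrec W) : Primrec (fun a => explored (i a) (log a) (W a)) := by
  unfold explored; fun_prop

@[fun_prop]
theorem primrec_distinct {l : α → List ℕ} (hl : Primrec l) :
    Primrec (fun a => distinct (l a)) := by
  unfold distinct; fun_prop

@[fun_prop]
theorem primrec_seenIdents (hl : Primrec log) : Primrec (fun a => seenIdents (log a)) := by
  unfold seenIdents; fun_prop

@[fun_prop]
theorem primrec_omegaWords (hs : Primrec s) (hx : Primrec x) :
    Primrec (fun a => omegaWords (s a) (x a)) := by
  unfold omegaWords; fun_prop

@[fun_prop]
theorem primrec_omegaAnswer (hi : Primrec i) (hs : Primrec s) (hx : Primrec x)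
    (hl : Primrec log) : Primrec (fun a => omegaAnswer (i a) (s a) (x a) (log a)) := by
  unfold omegaAnswer; fun_prop

theorem primrec_omegaRule : Primrec omegaRule := by
  unfold omegaRule; fun_prop

end Primrec

theorem task_encode (i : ℕ) (w : List ℕ) : task (Encodable.encode (i, w)) = (i, w) :=
  Denumerable.ofNat_encode (i, w)

theorem explored_iff {i : ℕ} {log : List Sight} {W : List (List ℕ)} :
    explored i log W = true ↔ ∀ w ∈ W, Encodable.encode (i, w) < log.length := by
  simp only [explored, List.all_eq_true, decide_eq_true_eq]

/-- Every finite set of words is explored eventually. -/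
theorem exists_explored (i : ℕ) (W : List (List ℕ)) :
    ∃ n, ∀ log : List Sight, n ≤ log.length → explored i log W = true := by
  induction W with
  | nil => exact ⟨0, fun _ _ => rfl⟩
  | cons w W ih =>
    obtain ⟨n, hn⟩ := ih
    refine ⟨n + Encodable.encode (i, w) + 1, fun log hl => ?_⟩
    have := hn log (by omega)
    rw [explored_iff] at this ⊢
    intro v hv
    rcases List.mem_cons.1 hv with rfl | hv
    · omega
    · exact this v hv

theorem nodup_distinct (l : List ℕ) : (distinct l).Nodup ∧ ∀ i, i ∈ distinct l ↔ i ∈ l := by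
  induction l with
  | nil => simp [distinct]
  | cons j l ih =>
    rw [show distinct (j :: l) = bif (distinct l).any fun i => decide (i = j) then distinct l
      else j :: distinct l from rfl]
    by_cases h : j ∈ distinct l
    · have : ((distinct l).any fun i => decide (i = j)) = true := by simpa using h
      rw [this]
      refine ⟨ih.1, fun i => ?_⟩
      rw [cond_true, ih.2, List.mem_cons]
      refine ⟨Or.inr, ?_⟩
      rintro (rfl | h')
      · exact (ih.2 _).1 h
      · exact h'
    · have : ((distinct l).any fun i => decide (i = j)) = false := by
        rw [Bool.eq_false_iff]
        simpa using h
      rw [this]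
      refine ⟨List.nodup_cons.2 ⟨h, ih.1⟩, fun i => ?_⟩
      rw [cond_false, List.mem_cons, List.mem_cons, ih.2]

/-! ### What the records contain -/

section
variable {C : Config} {a : Fin C.numAgents}

theorem mem_seen {v : Fin C.graph.size} {z : ℕ × List Bool} :
    z ∈ C.seen a v ↔ ∃ b, (b = a ∨ C.start b = v) ∧ (C.ident b, C.input b) = z := by
  simp [Config.seen, List.mem_map, (List.perm_insertionSort _ _).mem_iff]

theorem getElem?_log {s : ℕ} {w : List ℕ} (h : Encodable.encode (C.ident a, w) < s) :
    ((List.range s).map (C.entry a))[Encodable.encode (C.ident a, w)]? = some (C.sight a w) := by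
  rw [List.getElem?_map, List.getElem?_range h, Option.map_some, Config.entry, task_encode]
  simp

theorem obs_eq_sight (w : List ℕ) :
    ((C.sight a w).1, (C.sight a w).2.1) = obs C.graph.code (C.start a) w := by
  unfold obs Config.sight
  rw [C.graph.walk_code (C.start a, 0), C.graph.degree_code]

theorem recorded_eq {s : ℕ} {w : List ℕ} (h : Encodable.encode (C.ident a, w) < s) :
    recorded (C.ident a) ((List.range s).map (C.entry a)) w = obs C.graph.code (C.start a) w := by
  unfold recorded
  rw [getElem?_log h, ← obs_eq_sight]
  rfl

theorem target_sight (w : List ℕ) : target C.graph.code (C.start a) w =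
    (walk C.graph.cross (C.start a, 0) w).1 := by
  unfold target
  rw [C.graph.walk_code (C.start a, 0)]

theorem exists_ident_of_seenIdents {s i : ℕ}
    (h : i ∈ seenIdents ((List.range s).map (C.entry a))) : ∃ b, C.ident b = i := by
  simp only [seenIdents, List.mem_flatMap, List.mem_map, List.mem_range] at h
  obtain ⟨_, ⟨t, -, rfl⟩, z, hz, rfl⟩ := h
  unfold Config.entry at hz
  by_cases ht : (task t).1 = C.ident a
  · simp only [ht, decide_true, cond_true] at hz
    obtain ⟨b, -, rfl⟩ := mem_seen.1 hz
    exact ⟨b, rfl⟩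
  · simp [ht] at hz

/-- Only real identities are recorded, however much has been explored, so the team is never
overestimated. -/
theorem length_distinct_le (s : ℕ) :
    (distinct (seenIdents ((List.range s).map (C.entry a)))).length ≤ C.numAgents := by
  have h := nodup_distinct (seenIdents ((List.range s).map (C.entry a)))
  have : (distinct (seenIdents ((List.range s).map (C.entry a)))).toFinset ⊆
      Finset.univ.image C.ident := by
    intro i hi
    rw [List.mem_toFinset, h.2] at hi
    obtain ⟨b, rfl⟩ := exists_ident_of_seenIdents hi
    exact Finset.mem_image_of_mem _ (Finset.mem_univ _)
  have := (Finset.card_le_card this).trans Finset.card_image_le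
  rwa [List.toFinset_card_of_nodup h.1, Finset.card_univ, Fintype.card_fin] at this

theorem exists_word_to (a b : Fin C.numAgents) {K L : ℕ}
    (hK : C.graph.size ≤ K) (hL : C.graph.size ≤ L) : ∃ w ∈ words K L,
      (walk C.graph.cross (C.start a, 0) w).1 = C.start b := by
  obtain ⟨w, hw⟩ := C.graph.exists_walk (C.start a) (C.start b)
  obtain ⟨w', h1, h2, h3⟩ := exists_short_walk C.graph.reversible_code
    (fun x => (C.graph.degree_code_le x).trans hK) (x := C.start a) (by simp) w
  rw [PortGraph.length_code] at h1
  refine ⟨w', mem_words.2 ⟨by omega, h2⟩, Fin.ext ?_⟩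
  rw [← target_sight, h3, hw]

/-- Every starting node is the end of a word no longer than the number of nodes, so every identity
is recorded. -/
theorem le_length_distinct {s K L : ℕ} (hK : C.graph.size ≤ K) (hL : C.graph.size ≤ L)
    (h : explored (C.ident a) ((List.range s).map (C.entry a)) (words K L) = true) :
    C.numAgents ≤ (distinct (seenIdents ((List.range s).map (C.entry a)))).length := by
  have hd := nodup_distinct (seenIdents ((List.range s).map (C.entry a)))
  have : Finset.univ.image C.ident ⊆
      (distinct (seenIdents ((List.range s).map (C.entry a)))).toFinset := by
    intro i hi
    obtain ⟨b, -, rfl⟩ := Finset.mem_image.1 hi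
    rw [List.mem_toFinset, hd.2]
    obtain ⟨w, hw, hb⟩ := exists_word_to a b hK hL
    have he := explored_iff.1 h w hw
    have hg := getElem?_log (a := a) (w := w) (by simpa using he)
    refine List.mem_flatMap.2 ⟨_, List.mem_of_getElem? hg, List.mem_map.2
      ⟨(C.ident b, C.input b), ?_, rfl⟩⟩
    exact mem_seen.2 ⟨b, Or.inr hb.symm, rfl⟩
  have := Finset.card_le_card this
  rwa [List.toFinset_card_of_nodup hd.1, Finset.card_image_of_injective _ C.ident_injective,
    Finset.card_univ, Fintype.card_fin] at this

end

/-- The verification protocol for `Ω`. -/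
def omegaProtocol : Protocol := explorer omegaRule primrec_omegaRule.to_comp

section
variable {C : Config} {x : Fin C.numAgents → List Bool} {o : List Bool → Bool}
  {a : Fin C.numAgents} {s : ℕ} {b : Bool}

theorem omegaRule_eq_some : omegaRule (C.knowledge x o a s) = some b ↔
    explored (C.ident a) ((List.range s).map (C.entry a)) (omegaWords (C.input a) (x a)) = true ∧
      omegaAnswer (C.ident a) (C.input a) (x a) ((List.range s).map (C.entry a)) = b := by
  unfold omegaRule Config.knowledge
  cases explored (C.ident a) ((List.range s).map (C.entry a)) (omegaWords (C.input a) (x a)) <;>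
    simp

theorem map_recorded
    (h : explored (C.ident a) ((List.range s).map (C.entry a)) (omegaWords (C.input a) (x a))) :
    ((omegaWords (C.input a) (x a)).map fun w =>
      (w, recorded (C.ident a) ((List.range s).map (C.entry a)) w)) =
    (omegaWords (C.input a) (x a)).map fun w => (w, obs C.graph.code (C.start a) w) := by
  refine List.map_congr_left fun w hw => ?_
  rw [recorded_eq]
  simpa using explored_iff.1 h w hw

/-- The certificate is arbitrary here: it affects which words are explored, whereas the upper bound
on identities and the fitting of a true quotient hold for any set of words. -/
theorem omegaAnswer_sound (hC : C.Uniform)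
    (h : explored (C.ident a) ((List.range s).map (C.entry a)) (omegaWords (C.input a) (x a)))
    (ha : omegaAnswer (C.ident a) (C.input a) (x a) ((List.range s).map (C.entry a)) = true) :
    C ∈ Omega.yes := by
  rw [mem_omega_of_uniform hC a]
  unfold omegaAnswer at ha
  rw [map_recorded h, Bool.or_eq_true] at ha
  rcases ha with ha | ha
  · left
    rcases hk : parseTeam (C.input a) with _ | k
    · simp [hk] at ha
    · simp only [hk, Option.elim_some, Bool.and_eq_true, decide_eq_true_eq] at ha
      exact ⟨k, rfl, ha.1, ha.2.trans_le (length_distinct_le s)⟩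
  · right
    rcases hH : parseQuotient (C.input a) with _ | H
    · simp [hH] at ha
    · simp only [hH, Option.elim_some, Bool.not_eq_true', Bool.and_eq_false_iff] at ha
      refine ⟨H, rfl, fun hi => ?_⟩
      rcases ha with ha | ha
      · rw [goodCheck_iff.2 (Good.of_isomorphic hi).1] at ha
        exact Bool.noConfusion ha
      · rw [fits_of_isomorphic _ hi] at ha
        exact Bool.noConfusion ha

/-- With the true size all agents have been counted; and an `H` passing all tests would be the
quotient by `isomorphic_of_fits`. -/
theorem omegaAnswer_complete (hC : C ∈ Omega.yes) (hx : x a = bin C.graph.size)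
    (h : explored (C.ident a) ((List.range s).map (C.entry a)) (omegaWords (C.input a) (x a))) :
    omegaAnswer (C.ident a) (C.input a) (x a) ((List.range s).map (C.entry a)) = true := by
  have hN : ofBits (x a) = C.graph.size := by rw [hx]; exact ofBits_bits _
  unfold omegaAnswer
  rw [map_recorded h, Bool.or_eq_true]
  rcases (mem_omega_of_uniform hC.1 a).1 hC with ⟨k, hk, h0, hlt⟩ | ⟨H, hH, hi⟩
  · left
    rw [hk]
    simp only [Option.elim_some, Bool.and_eq_true, decide_eq_true_eq]
    exact ⟨h0, hlt.trans_le (le_length_distinct (by rw [hN]) (by rw [hN]; omega) h)⟩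
  · right
    rw [hH]
    simp only [Option.elim_some, Bool.not_eq_true']
    rw [Bool.eq_false_iff, Ne, Bool.and_eq_true]
    rintro ⟨hg, hf⟩
    refine hi (isomorphic_of_fits (v := C.start a) hg (K := C.graph.size)
      (L := C.graph.size + C.graph.size * H.1) (C.graph.degree_code_le) (by omega) ?_)
    unfold omegaWords at hf
    rwa [hH, hN] at hf

theorem omegaProtocol_decides : ∃ r b, omegaRule (C.knowledge x o a r) = some b ∧
    omegaProtocol.Decides C x o a b := by
  obtain ⟨n, hn⟩ := exists_explored (C.ident a) (omegaWords (C.input a) (x a))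
  refine explorer_decides (s := n) ?_
  rw [omegaRule_eq_some.2 ⟨hn _ (by simp), rfl⟩]
  rfl

end

theorem omegaProtocol_complete {C : Config} (hC : C ∈ Omega.yes) (o : List Bool → Bool)
    (a : Fin C.numAgents) :
    omegaProtocol.Decides C (fun _ => bin C.graph.size) o a true := by
  obtain ⟨r, b, h1, h2⟩ := omegaProtocol_decides (C := C) (x := fun _ => bin C.graph.size)
    (o := o) (a := a)
  rw [omegaRule_eq_some] at h1
  rw [omegaAnswer_complete (x := fun _ => bin C.graph.size) hC rfl h1.1] at h1
  rwa [← h1.2] at h2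

theorem omegaProtocol_verifies : Verifies omegaProtocol Omega := by
  refine fun C hC => ⟨fun x a => ?_, fun hy => ⟨_, omegaProtocol_complete hy noOracle⟩,
    fun hn x => ?_⟩
  · obtain ⟨r, b, -, h⟩ := omegaProtocol_decides (C := C) (x := x) (o := noOracle) (a := a)
    exact ⟨b, h⟩
  · obtain ⟨r, b, h1, h2⟩ := omegaProtocol_decides (C := C) (x := x) (o := noOracle)
      (a := C.first)
    rw [omegaRule_eq_some] at h1
    refine ⟨C.first, ?_⟩
    cases b
    · exact h2
    · exact absurd (omegaAnswer_sound hC h1.1 h1.2) hn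

/-! Codes of configurations -/

/-- Edges can be reversed, and there are no loops or multiple edges. -/
def simpleCheck (l : AdjList) : Bool :=
  (List.range l.length).all fun x => (List.range (degree l x)).all fun p =>
    (crossing l x (p + 1)).elim true fun e =>
      decide (crossing l e.1 e.2 = some (x, p + 1)) && (!(decide (e.1 = x)) &&
        (List.range (degree l x)).all fun p' =>
          (crossing l x (p' + 1)).elim true fun e' => !(decide (e'.1 = e.1)) || decide (p' = p))

/-- Recognizes the adjacency lists of graphs. -/
def graphCheck (l : AdjList) : Bool :=
  decide (0 < l.length) && (simpleCheck l && connectedCheck l)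

/-- Recognizes the lists of agents on a graph with `n` nodes. -/
def agentsCheck (n : ℕ) (A : List (ℕ × ℕ × List Bool)) : Bool :=
  decide (0 < A.length) && ((A.all fun z => decide (z.1 < n) && decide (0 < z.2.1)) &&
    (List.range A.length).all fun i => (List.range A.length).all fun j =>
      !(decide (A[i]?.map (fun z => z.2.1) = A[j]?.map (fun z => z.2.1))) || decide (i = j))

/-- Recognizes the codes of configurations. -/
def configCheck (z : AdjList × List (ℕ × ℕ × List Bool)) : Bool :=
  graphCheck z.1 && agentsCheck z.1.length z.2

section Primrec
variable {α : Type*} [Primcodable α]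

@[fun_prop]
theorem primrec_simpleCheck {l : α → AdjList} (hl : Primrec l) :
    Primrec (fun a => simpleCheck (l a)) := by
  unfold simpleCheck; fun_prop

@[fun_prop]
theorem primrec_graphCheck {l : α → AdjList} (hl : Primrec l) :
    Primrec (fun a => graphCheck (l a)) := by
  unfold graphCheck; fun_prop

@[fun_prop]
theorem primrec_agentsCheck {n : α → ℕ} {A : α → List (ℕ × ℕ × List Bool)} (hn : Primrec n)
    (hA : Primrec A) : Primrec (fun a => agentsCheck (n a) (A a)) := by
  unfold agentsCheck; fun_prop

@[fun_prop]
theorem primrec_configCheck {z : α → AdjList × List (ℕ × ℕ × List Bool)} (hz : Primrec z) :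
    Primrec (fun a => configCheck (z a)) := by
  unfold configCheck; fun_prop

end Primrec

/-- The adjacency list of a graph. -/
structure IsGraph (l : AdjList) : Prop where
  pos : 0 < l.length
  reversible : Reversible l
  irrefl : ∀ x p y q, crossing l x p = some (y, q) → y ≠ x
  simple : ∀ x p p' y q q', crossing l x p = some (y, q) → crossing l x p' = some (y, q') → p = p'
  connected : ∀ x < l.length, ∀ y < l.length, ∃ w, target l x w = y

theorem graphCheck_iff {l : AdjList} : graphCheck l = true ↔ IsGraph l := by
  simp only [graphCheck, simpleCheck, connectedCheck, Bool.and_eq_true, List.all_eq_true,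
    List.any_eq_true, List.mem_range, decide_eq_true_eq]
  constructor
  · rintro ⟨h0, h1, h2⟩
    have key : ∀ x p y q, crossing l x p = some (y, q) → crossing l y q = some (x, p) ∧ y ≠ x ∧
        ∀ p' q', crossing l x p' = some (y, q') → p' = p := by
      intro x p y q h
      have hp := bounds_of_crossing h
      have := h1 x (lt_of_crossing h) (p - 1) (by omega)
      rw [show p - 1 + 1 = p by omega, h] at this
      simp only [Option.elim_some, Bool.and_eq_true, decide_eq_true_eq, Bool.not_eq_true',
        decide_eq_false_iff_not, List.all_eq_true, List.mem_range] at this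
      refine ⟨this.1, this.2.1, fun p' q' h' => ?_⟩
      have hp' := bounds_of_crossing h'
      have := this.2.2 (p' - 1) (by omega)
      rw [show p' - 1 + 1 = p' by omega, h'] at this
      simp at this
      omega
    refine ⟨h0, fun x p y q h => (key x p y q h).1, fun x p y q h => (key x p y q h).2.1,
      fun x p p' y q q' h h' => ((key x p y q h).2.2 p' q' h').symm, fun x hx y hy => ?_⟩
    obtain ⟨w, -, hw⟩ := h2 x hx y hy
    exact ⟨w, hw⟩
  · intro h
    refine ⟨h.pos, fun x hx p hp => ?_, fun x hx y hy => ?_⟩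
    · obtain ⟨y, q, hc⟩ := exists_crossing (c := l) (x := x) (p := p + 1) (by omega) (by omega)
      rw [hc]
      simp only [Option.elim_some, Bool.and_eq_true, decide_eq_true_eq, Bool.not_eq_true',
        decide_eq_false_iff_not, List.all_eq_true, List.mem_range]
      refine ⟨h.reversible _ _ _ _ hc, h.irrefl _ _ _ _ hc, fun p' hp' => ?_⟩
      obtain ⟨y', q', hc'⟩ := exists_crossing (c := l) (x := x) (p := p' + 1) (by omega) (by omega)
      rw [hc']
      simp only [Option.elim_some, Bool.or_eq_true, Bool.not_eq_true', decide_eq_false_iff_not,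
        decide_eq_true_eq]
      by_cases hy : y' = y
      · subst hy
        have := h.simple _ _ _ _ _ _ hc hc'
        omega
      · exact Or.inl hy
    · obtain ⟨w, hw⟩ := h.connected x hx y hy
      obtain ⟨w', h1, h2, h3⟩ := exists_short_walk h.reversible degree_le_maxDegree hx w
      exact ⟨w', mem_words.2 ⟨h1.le, h2⟩, h3.trans hw⟩

theorem PortGraph.isGraph_code (G : PortGraph) : IsGraph G.code := by
  have hlt : ∀ {x p y q}, crossing G.code x p = some (y, q) →
      ∃ u v : Fin G.size, u.val = x ∧ v.val = y ∧ G.cross u p = some (v, q) := by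
    intro x p y q h
    have hx := lt_of_crossing h
    rw [G.length_code] at hx
    obtain ⟨v, hv, hc⟩ := G.exists_cross_of_crossing (v := ⟨x, hx⟩) h
    exact ⟨_, v, rfl, hv, hc⟩
  have hport : ∀ {u v : Fin G.size} {p q}, G.cross u p = some (v, q) → 1 ≤ p ∧
      ∃ hp : p - 1 < G.deg u, (G.port u ⟨p - 1, hp⟩).1 = v := by
    intro u v p q h
    have hp : 1 ≤ p ∧ p ≤ G.deg u := by
      by_contra hp
      rw [G.cross_eq_none hp] at h
      cases h
    rw [G.cross_of_pos hp.1 hp.2] at h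
    exact ⟨hp.1, by omega, congrArg Prod.fst (Option.some.inj h)⟩
  refine ⟨by simpa using G.size_pos, G.reversible_code, ?_, ?_, ?_⟩
  · intro x p y q h
    obtain ⟨u, v, rfl, rfl, hc⟩ := hlt h
    obtain ⟨-, hp, rfl⟩ := hport hc
    intro e
    exact G.graph.irrefl (Fin.ext e ▸ (G.port u ⟨p - 1, hp⟩).2)
  · intro x p p' y q q' h h'
    obtain ⟨u, v, rfl, rfl, hc⟩ := hlt h
    obtain ⟨u', v', hu, hv, hc'⟩ := hlt h'
    rw [Fin.ext hu, Fin.ext hv] at hc'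
    obtain ⟨h1, hp, h2⟩ := hport hc
    obtain ⟨h1', hp', h2'⟩ := hport hc'
    have := (G.port u).injective (Subtype.ext (h2.trans h2'.symm))
    simp only [Fin.mk.injEq] at this
    omega
  · intro x hx y hy
    rw [G.length_code] at hx hy
    exact G.exists_walk ⟨x, hx⟩ ⟨y, hy⟩

theorem crossing_eq_getD {l : AdjList} {x : ℕ} (p : Fin (degree l x)) :
    ∃ q, crossing l x (p + 1) = some (((crossing l x (p + 1)).getD (0, 0)).1, q) := by
  obtain ⟨y, q, hc⟩ := exists_crossing (c := l) (x := x) (p := p + 1) (by omega) (by omega)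
  exact ⟨q, by rw [hc]; rfl⟩

/-- The simple graph with a given adjacency list. -/
def IsGraph.graph {l : AdjList} (h : IsGraph l) : SimpleGraph (Fin l.length) where
  Adj u v := ∃ p q, crossing l u p = some (v.val, q)
  symm := ⟨fun _ _ ⟨p, q, hc⟩ => ⟨q, p, h.reversible _ _ _ _ hc⟩⟩
  loopless := ⟨fun _ ⟨_, _, hc⟩ => h.irrefl _ _ _ _ hc rfl⟩

/-- The neighbor reached by a port. -/
def IsGraph.neighbor {l : AdjList} (h : IsGraph l) (v : Fin l.length) (p : Fin (degree l v)) :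
    h.graph.neighborSet v :=
  ⟨⟨((crossing l v (p + 1)).getD (0, 0)).1, by
      obtain ⟨q, hc⟩ := crossing_eq_getD p
      exact h.reversible.lt hc⟩, by
    obtain ⟨q, hc⟩ := crossing_eq_getD p
    exact ⟨_, q, hc⟩⟩

theorem IsGraph.neighbor_eq {l : AdjList} (h : IsGraph l) {v : Fin l.length}
    {p : Fin (degree l v)} {y q : ℕ} (hc : crossing l v (p + 1) = some (y, q)) :
    (h.neighbor v p).1.val = y := by
  simp [IsGraph.neighbor, hc]

theorem IsGraph.bijective_neighbor {l : AdjList} (h : IsGraph l) (v : Fin l.length) :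
    Function.Bijective (h.neighbor v) := by
  constructor
  · intro p p' hp
    obtain ⟨q, hc⟩ := crossing_eq_getD p
    obtain ⟨q', hc'⟩ := crossing_eq_getD p'
    have he := congrArg (fun z => z.1.val) hp
    rw [← h.neighbor_eq hc, he, h.neighbor_eq hc'] at hc
    have := h.simple _ _ _ _ _ _ hc hc'
    exact Fin.ext (by omega)
  · rintro ⟨u, p, q, hc⟩
    have hp := bounds_of_crossing hc
    refine ⟨⟨p - 1, by omega⟩, Subtype.ext (Fin.ext ?_)⟩
    refine h.neighbor_eq (q := q) ?_
    exact (congrArg (crossing l v) (show p - 1 + 1 = p by omega)).trans hc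

/-- The port-labeled graph with a given adjacency list. -/
noncomputable def IsGraph.toPortGraph {l : AdjList} (h : IsGraph l) : PortGraph where
  size := l.length
  graph := h.graph
  connected := by
    have : Nonempty (Fin l.length) := ⟨⟨0, h.pos⟩⟩
    refine ⟨fun u v => ?_⟩
    obtain ⟨w, hw⟩ := h.connected u u.2 v v.2
    -- Following a word stays within a component: a failed move changes nothing, any other goes
    -- along an edge.
    have key : ∀ w (u : Fin l.length), ∃ hlt : target l u w < l.length,
        h.graph.Reachable u ⟨target l u w, hlt⟩ := by
      intro w
      induction w with
      | nil => exact fun u => ⟨u.2, SimpleGraph.Reachable.refl _⟩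
      | cons p w ih =>
        intro u
        rw [← List.singleton_append]
        simp only [target_append]
        rcases hc : crossing l u p with _ | ⟨y, q⟩
        · have : target l u [p] = u := by
            simp [target, move_of_none _ hc]
          simp only [this]
          exact ih u
        · simp only [target_singleton hc]
          obtain ⟨h1, h2⟩ := ih ⟨y, h.reversible.lt hc⟩
          exact ⟨h1, SimpleGraph.Reachable.trans
            (SimpleGraph.Adj.reachable (show h.graph.Adj u ⟨y, h.reversible.lt hc⟩ from
              ⟨p, q, hc⟩)) h2⟩
    obtain ⟨h1, h2⟩ := key w u
    have : (⟨target l u w, h1⟩ : Fin l.length) = v := Fin.ext hw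
    rwa [this] at h2
  deg v := degree l v
  port v := Equiv.ofBijective (h.neighbor v) (h.bijective_neighbor v)

theorem IsGraph.arc_eq {l : AdjList} (h : IsGraph l) {v : Fin l.length} {p : Fin (degree l v)}
    {y q : ℕ} (hc : crossing l v (p + 1) = some (y, q)) :
    ((h.toPortGraph.arc v p).1.val, (h.toPortGraph.arc v p).2) = (y, q) := by
  have h1 : (h.neighbor v p).1.val = y := h.neighbor_eq hc
  refine Prod.ext h1 ?_
  have hr := h.reversible _ _ _ _ hc
  have hq := bounds_of_crossing hr
  let u : Fin l.length := (h.neighbor v p).1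
  have hu : u.val = y := h1
  have hq' : q - 1 < degree l u := by rw [hu]; omega
  show (((Equiv.ofBijective (h.neighbor u) (h.bijective_neighbor u)).symm
    ⟨v, h.graph.symm.symm _ _ (h.neighbor v p).2⟩ : Fin (degree l u)) : ℕ) + 1 = q
  -- The entry port is defined by inverting the bijection between ports and neighbors; reversibility
  -- identifies the preimage of `v` as `q - 1`.
  have : (Equiv.ofBijective (h.neighbor u) (h.bijective_neighbor u)).symm
      ⟨v, h.graph.symm.symm _ _ (h.neighbor v p).2⟩ = ⟨q - 1, hq'⟩ := by
    rw [Equiv.symm_apply_eq]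
    refine Subtype.ext (Fin.ext ?_)
    refine (h.neighbor_eq (q := p + 1) ?_).symm
    refine Eq.trans ?_ hr
    exact congrArg₂ (crossing l) hu (by simp only; omega)
  rw [this]
  simp only
  omega

theorem IsGraph.code_toPortGraph {l : AdjList} (h : IsGraph l) : h.toPortGraph.code = l := by
  refine List.ext_getElem (by simp [IsGraph.toPortGraph]) fun i h1 h2 => ?_
  have hd : degree l i = l[i].length := by simp [degree, h2]
  refine List.ext_getElem ?_ fun j h3 h4 => ?_
  · simp only [PortGraph.code, List.getElem_ofFn, List.length_ofFn]
    exact hd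
  · have hj : j < degree l i := by omega
    obtain ⟨y, q, hc⟩ := exists_crossing (c := l) (x := i) (p := j + 1) (by omega) (by omega)
    have := h.arc_eq (v := ⟨i, h2⟩) (p := ⟨j, hj⟩) hc
    simp only [PortGraph.code, List.getElem_ofFn]
    refine Eq.trans this ?_
    simp [crossing, h2, h4] at hc
    exact hc.symm

theorem configCheck_code (C : Config) : configCheck C.code = true := by
  unfold configCheck agentsCheck
  rw [Bool.and_eq_true]
  refine ⟨graphCheck_iff.2 C.graph.isGraph_code, ?_⟩
  simp only [Bool.and_eq_true, List.all_eq_true, decide_eq_true_eq, Config.length_code,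
    List.mem_range, Bool.or_eq_true, Bool.not_eq_true', decide_eq_false_iff_not]
  refine ⟨C.numAgents_pos, fun z hz => ?_, fun i hi j hj => ?_⟩
  · obtain ⟨a, rfl⟩ := Config.mem_code.1 hz
    exact ⟨by simp [Config.code], C.ident_pos a⟩
  · by_cases hij : i = j
    · exact Or.inr hij
    · left
      simp only [Config.code, List.getElem?_ofFn, hi, hj, dite_true, Option.map_some,
        Option.some.injEq]
      exact fun e => hij (Fin.mk.inj_iff.1 (C.ident_injective e))

/-- Used in the reduction, where a candidate must be a genuine configuration before the correctness
of a verification protocol says anything about it. -/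
theorem exists_config {z : AdjList × List (ℕ × ℕ × List Bool)} (h : configCheck z = true) :
    ∃ C : Config, C.code = z := by
  obtain ⟨l, A⟩ := z
  unfold configCheck agentsCheck at h
  rw [Bool.and_eq_true] at h
  obtain ⟨hg, h⟩ := h
  have hg := graphCheck_iff.1 hg
  simp only [Bool.and_eq_true, List.all_eq_true, decide_eq_true_eq,
    List.mem_range, Bool.or_eq_true, Bool.not_eq_true', decide_eq_false_iff_not] at h
  obtain ⟨h0, h1, h2⟩ := h
  let C : Config :=
    { graph := hg.toPortGraph
      numAgents := A.length
      numAgents_pos := h0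
      start := fun i => (⟨A[i].1, (h1 _ (List.getElem_mem _)).1⟩ : Fin l.length)
      ident := fun i => A[i].2.1
      ident_pos := fun i => (h1 _ (List.getElem_mem _)).2
      ident_injective := fun i j hij => by
        refine Fin.ext ((h2 i i.2 j j.2).resolve_left fun hne => hne ?_)
        simp only [Fin.getElem_fin] at hij
        simp [hij]
      input := fun i => A[i].2.2 }
  refine ⟨C, Prod.ext hg.code_toPortGraph ?_⟩
  refine List.ext_getElem (by simp [Config.code, C]) fun i h3 h4 => ?_
  simp [Config.code, C]

/-! Configurations with at least two agents are determined by what one agent sees -/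

section
variable {C D : Config} {a : Fin C.numAgents} {a' : Fin D.numAgents} {K L : ℕ}

/-- What agent `a` of `C` sees on short walks is what agent `a'` of `D` sees. -/
structure SeesAlike (C D : Config) (a : Fin C.numAgents) (a' : Fin D.numAgents) (K L : ℕ) :
    Prop where
  obs_eq : Alike K L C.graph.code (C.start a) D.graph.code (D.start a')
  seen_iff : ∀ w ∈ words K L, ∀ z,
    z ∈ C.seen a (walk C.graph.cross (C.start a, 0) w).1 ↔
      z ∈ D.seen a' (walk D.graph.cross (D.start a', 0) w).1

/-- The words that are at most as long as the size of the graph. -/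
abbrev Short (D : Config) (K : ℕ) (w : List ℕ) : Prop :=
  w.length ≤ D.graph.size ∧ ∀ p ∈ w, p ≤ K

theorem mem_words_append {w w' : List ℕ} (hL : 2 * D.graph.size + 1 ≤ L)
    (hw : Short D K w) (hw' : Short D K w') : w ++ w' ∈ words K L := by
  rw [mem_words]
  refine ⟨by rw [List.length_append]; have := hw.1; have := hw'.1; omega, fun p hp => ?_⟩
  rcases List.mem_append.1 hp with h | h
  · exact hw.2 p h
  · exact hw'.2 p h

theorem SeesAlike.obs_append_eq (h : SeesAlike C D a a' K L) {w w' : List ℕ}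
    (hL : 2 * D.graph.size + 1 ≤ L) (hw : Short D K w) (hw' : Short D K w') :
    obs C.graph.code (target C.graph.code (C.start a) w) w' =
      obs D.graph.code (target D.graph.code (D.start a') w) w' := by
  refine obs_target (h.obs_eq _ ?_) (h.obs_eq _ (mem_words_append hL hw hw'))
  simpa using mem_words_append (w' := []) hL hw (by simp [Short])

theorem exists_short_word (hK : ∀ x, degree D.graph.code x ≤ K) (u v : Fin D.graph.size) :
    ∃ w, Short D K w ∧ w.length < D.graph.size ∧ target D.graph.code u w = v := by
  obtain ⟨w, hw⟩ := D.graph.exists_walk u v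
  obtain ⟨w', h1, h2, h3⟩ := exists_short_walk D.graph.reversible_code hK (x := u) (by simp) w
  rw [PortGraph.length_code] at h1
  exact ⟨w', ⟨h1.le, h2⟩, h1, h3.trans hw⟩

theorem Short.of_prefix {w w' : List ℕ} (h : Short D K w) (hw : w' <+: w) : Short D K w' :=
  ⟨hw.length_le.trans h.1, fun p hp => h.2 p (hw.subset hp)⟩

/-- The marker is the home of an agent other than `a'`. Unlike the observer, which sees itself
everywhere, such an agent is seen at one node only, and identities match it with an agent of `C`. -/
theorem SeesAlike.exists_marker (h : SeesAlike C D a a' K L) (hid : C.ident a = D.ident a')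
    (hK : ∀ x, degree D.graph.code x ≤ K) (hL : 2 * D.graph.size + 1 ≤ L)
    (hD : 1 < D.numAgents) : ∃ (m : Fin C.graph.size) (m' : Fin D.graph.size),
      ∀ w ∈ words K L, target C.graph.code (C.start a) w = m ↔
        target D.graph.code (D.start a') w = m' := by
  obtain ⟨b', hb'⟩ : ∃ b', b' ≠ a' := by
    have : Nontrivial (Fin D.numAgents) := Fin.nontrivial_iff_two_le.2 hD
    exact exists_ne a'
  have hD' : ∀ v, (D.ident b', D.input b') ∈ D.seen a' v ↔ v = D.start b' := by
    intro v
    rw [mem_seen]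
    constructor
    · rintro ⟨b, hb, e⟩
      have := D.ident_injective (congrArg Prod.fst e)
      subst this
      exact (hb.resolve_left hb').symm
    · rintro rfl
      exact ⟨b', Or.inr rfl, rfl⟩
  obtain ⟨w, hw, -, hwb⟩ := exists_short_word hK (D.start a') (D.start b')
  have hmem : w ∈ words K L := by simpa using mem_words_append (w' := []) hL hw (by simp [Short])
  have hin : (D.ident b', D.input b') ∈ C.seen a (walk C.graph.cross (C.start a, 0) w).1 := by
    rw [h.seen_iff w hmem, hD']
    refine Fin.ext ?_
    rw [← target_sight, hwb]
  obtain ⟨b, -, hb⟩ := mem_seen.1 hin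
  have hba : b ≠ a := by
    rintro rfl
    refine hb' (D.ident_injective ?_)
    rw [← hid]
    exact (congrArg Prod.fst hb).symm
  have hC' : ∀ v, (D.ident b', D.input b') ∈ C.seen a v ↔ v = C.start b := by
    intro v
    rw [← hb, mem_seen]
    constructor
    · rintro ⟨b1, hb1, e⟩
      have := C.ident_injective (congrArg Prod.fst e)
      subst this
      exact (hb1.resolve_left hba).symm
    · rintro rfl
      exact ⟨b, Or.inr rfl, rfl⟩
  refine ⟨C.start b, D.start b', fun w hw => ?_⟩
  have := h.seen_iff w hw (D.ident b', D.input b')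
  rw [hC', hD', Fin.ext_iff, Fin.ext_iff, ← target_sight, ← target_sight] at this
  exact this

/-- Continue both words by a word `r` leading from the first end to the marker. If the ends coincide
in one configuration, then both continuations reach the marker in it, hence in the other one too,
with equal entry ports along `r`. Walking `r` backwards shows that the ends coincide there
(`eq_of_target_eq`). The concatenations explain the bound twice the size. -/
theorem SeesAlike.target_eq_iff (h : SeesAlike C D a a' K L) (hid : C.ident a = D.ident a')
    (hK : ∀ x, degree D.graph.code x ≤ K) (hL : 2 * D.graph.size + 1 ≤ L)
    (hD : 1 < D.numAgents) {w₁ w₂ : List ℕ} (h₁ : Short D K w₁) (h₂ : Short D K w₂) :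
    target C.graph.code (C.start a) w₁ = target C.graph.code (C.start a) w₂ ↔
      target D.graph.code (D.start a') w₁ = target D.graph.code (D.start a') w₂ := by
  obtain ⟨m, m', hm⟩ := h.exists_marker hid hK hL hD
  have hlt := D.graph.reversible_code.target_lt (x := D.start a') (by simp) w₁
  rw [PortGraph.length_code] at hlt
  obtain ⟨r, hr, -, hrm⟩ := exists_short_word hK ⟨_, hlt⟩ m'
  have hd₁ : target D.graph.code (D.start a') (w₁ ++ r) = m' := by rw [target_append, hrm]
  have hc₁ := (hm _ (mem_words_append hL h₁ hr)).2 hd₁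
  have hm₂ := hm _ (mem_words_append hL h₂ hr)
  constructor
  · intro e
    have hc₂ : target C.graph.code (C.start a) (w₂ ++ r) = m := by
      rw [target_append, ← e, ← target_append, hc₁]
    have hd₂ := hm₂.1 hc₂
    refine eq_of_target_eq D.graph.reversible_code (w := r) ?_ fun w' hw' => ?_
    · rw [← target_append, ← target_append, hd₁, hd₂]
    · rw [← h.obs_append_eq hL h₁ (hr.of_prefix hw'), ← h.obs_append_eq hL h₂ (hr.of_prefix hw'), e]
  · intro e
    have hd₂ : target D.graph.code (D.start a') (w₂ ++ r) = m' := by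
      rw [target_append, ← e, ← target_append, hd₁]
    have hc₂ := hm₂.2 hd₂
    refine eq_of_target_eq C.graph.reversible_code (w := r) ?_ fun w' hw' => ?_
    · rw [← target_append, ← target_append, hc₁, hc₂]
    · rw [h.obs_append_eq hL h₁ (hr.of_prefix hw'), h.obs_append_eq hL h₂ (hr.of_prefix hw'), e]

/-- A configuration with at least two agents is determined by what one agent sees. -/
theorem SeesAlike.equivalent (h : SeesAlike C D a a' K L) (hid : C.ident a = D.ident a')
    (hin : C.input a = D.input a')
    (hK : ∀ x, degree D.graph.code x ≤ K) (hL : 2 * D.graph.size + 1 ≤ L)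
    (hD : 1 < D.numAgents) : D.Equivalent C := by
  have heq := fun {w₁ w₂} => h.target_eq_iff hid hK hL hD (w₁ := w₁) (w₂ := w₂)
  have hnil : Short D K [] := by simp [Short]
  choose W hW hlen hWt using fun u => exists_short_word hK (D.start a') u
  have hWmem : ∀ u, W u ∈ words K L := fun u => by simpa using mem_words_append hL (hW u) hnil
  let φ : Fin D.graph.size → Fin C.graph.size := fun u =>
    (walk C.graph.cross (C.start a, 0) (W u)).1
  have hφ : ∀ u, (φ u).val = target C.graph.code (C.start a) (W u) := fun u =>
    (target_sight _).symm
  have hφt : ∀ (u : Fin D.graph.size) w, Short D K w → target D.graph.code (D.start a') w = u →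
      target C.graph.code (C.start a) w = φ u := by
    intro u w hw hu
    rw [hφ, heq hw (hW u), hWt, hu]
  have hdeg : ∀ u, C.graph.deg (φ u) = D.graph.deg u := by
    intro u
    rw [← C.graph.degree_code, ← D.graph.degree_code, hφ]
    have := congrArg Prod.snd (h.obs_eq _ (hWmem u))
    rwa [obs_snd, obs_snd, hWt] at this
  have hcross : ∀ u p, C.graph.cross (φ u) p =
      (D.graph.cross u p).map fun e => (φ e.1, e.2) := by
    intro u p
    by_cases hp : 1 ≤ p ∧ p ≤ D.graph.deg u
    · rcases hc : D.graph.cross u p with _ | ⟨v, q⟩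
      · rw [D.graph.cross_of_pos hp.1 hp.2] at hc
        cases hc
      · have hcd := D.graph.crossing_code_eq_some.2 hc
        have hpK : p ≤ K := (D.graph.degree_code u ▸ hp.2).trans (hK u)
        have hs1 : Short D K [p] := ⟨D.graph.size_pos, by simpa using hpK⟩
        -- `W u` is strictly shorter than the size, which leaves room for one more letter.
        have hs : Short D K (W u ++ [p]) := by
          refine ⟨by simpa using hlen u, fun p' hp' => ?_⟩
          rcases List.mem_append.1 hp' with h' | h'
          · exact (hW u).2 _ h'
          · exact hs1.2 _ h'
        have ho := congrArg Prod.fst (h.obs_append_eq hL (hW u) hs1)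
        rw [← hφ, hWt] at ho
        have ht := hφt v _ hs (by rw [target_append, hWt, target_singleton hcd])
        rw [target_append, ← hφ] at ht
        rw [C.graph.cross_of_pos hp.1 (by rw [hdeg]; exact hp.2)]
        have hcc := C.graph.crossing_code_eq_some.2
          (C.graph.cross_of_pos (v := φ u) hp.1 (by rw [hdeg]; exact hp.2))
        rw [target_singleton hcc] at ht
        simp only [obs, walk_cons, walk_nil, move_of_some _ hcc, move_of_some _ hcd] at ho
        exact congrArg some (Prod.ext (Fin.ext ht) ho)
    · rw [C.graph.cross_eq_none (by rwa [hdeg]), D.graph.cross_eq_none hp]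
      rfl
  have hinj : Function.Injective φ := by
    intro u v e
    have e' := congrArg Fin.val e
    rw [hφ, hφ, heq (hW u) (hW v), hWt, hWt] at e'
    exact Fin.ext e'
  have hφa : φ (D.start a') = C.start a := Fin.ext (hφt (D.start a') [] hnil rfl).symm
  -- The image of `φ` is closed under walks, hence everything, as the graph of `C` is connected.
  have hwalk : ∀ w u, ∃ u', target C.graph.code (φ u) w = (φ u').val := by
    intro w
    induction w with
    | nil => exact fun u => ⟨u, rfl⟩
    | cons p w ih =>
      intro u
      rw [← List.singleton_append, target_append]
      rcases hc : C.graph.cross (φ u) p with _ | ⟨v, q⟩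
      · have : target C.graph.code (φ u) [p] = φ u := by
          have : crossing C.graph.code (φ u) p = none := by rw [PortGraph.crossing_code, hc]; rfl
          simp [target, move_of_none _ this]
        rw [this]
        exact ih u
      · rw [target_singleton (C.graph.crossing_code_eq_some.2 hc)]
        rw [hcross] at hc
        obtain ⟨e, -, he⟩ := Option.map_eq_some_iff.1 hc
        rw [← show φ e.1 = v from congrArg Prod.fst he]
        exact ih e.1
  have hsurj : Function.Surjective φ := by
    intro v
    obtain ⟨w, hw⟩ := C.graph.exists_walk (φ (D.start a')) v
    obtain ⟨u, hu⟩ := hwalk w (D.start a')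
    exact ⟨u, Fin.ext (hu.symm.trans hw)⟩
  have hwalkD : ∀ u, (walk D.graph.cross (D.start a', 0) (W u)).1 = u := fun u =>
    Fin.ext (by rw [← target_sight, hWt])
  have hagent : ∀ b', ∃ b, C.start b = φ (D.start b') ∧ C.ident b = D.ident b' ∧
      C.input b = D.input b' := by
    intro b'
    have hmem : (D.ident b', D.input b') ∈
        D.seen a' (walk D.graph.cross (D.start a', 0) (W (D.start b'))).1 := by
      rw [hwalkD]
      exact mem_seen.2 ⟨b', Or.inr rfl, rfl⟩
    rw [← h.seen_iff _ (hWmem _)] at hmem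
    obtain ⟨b, hb, e⟩ := mem_seen.1 hmem
    refine ⟨b, ?_, congrArg Prod.fst e, congrArg Prod.snd e⟩
    -- Seeing itself tells `a` nothing about the place, so here the position is found from the
    -- identity.
    rcases hb with rfl | hb
    · have : b' = a' := D.ident_injective ((congrArg Prod.fst e).symm.trans hid)
      rw [this, hφa]
    · exact hb
  choose σ hσ using hagent
  have hσb : Function.Bijective σ := by
    constructor
    · intro b b' e
      refine D.ident_injective ?_
      rw [← (hσ b).2.1, ← (hσ b').2.1, e]
    · intro b
      obtain ⟨u, hu⟩ := hsurj (C.start b)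
      have hmem : (C.ident b, C.input b) ∈
          C.seen a (walk C.graph.cross (C.start a, 0) (W u)).1 :=
        mem_seen.2 ⟨b, Or.inr hu.symm, rfl⟩
      rw [h.seen_iff _ (hWmem _)] at hmem
      obtain ⟨b', -, e⟩ := mem_seen.1 hmem
      exact ⟨b', C.ident_injective ((hσ b').2.1.trans (congrArg Prod.fst e))⟩
  refine ⟨⟨Equiv.ofBijective φ ⟨hinj, hsurj⟩, hcross⟩, Equiv.ofBijective σ hσb, hσ⟩

end

/-! A single agent cannot distinguish nodes with equal views -/

section
variable {C D : Config}

theorem unique_agent (hC : C.numAgents = 1) (a b : Fin C.numAgents) : b = a := by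
  apply Fin.ext
  omega

theorem here_of_single (P : Protocol) (hC : C.numAgents = 1)
    (σ : Fin C.numAgents → AgentState C.graph P.Mem) (a : Fin C.numAgents) :
    P.here C σ a = [(C.ident a, (σ a).entry, (σ a).mem)] := by
  have hf : List.finRange C.numAgents = [a] := by
    have hl : (List.finRange C.numAgents).length = 1 := by simpa using hC
    obtain ⟨b, hb⟩ := List.length_eq_one_iff.1 hl
    rw [hb, unique_agent hC a b]
  simp [Protocol.here, hf]

/-- A lone agent perceives nothing but entry ports and degrees. Equal views therefore produce equal
moves, which lead to nodes with equal views again. -/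
theorem run_of_same (P : Protocol) (hC : C.numAgents = 1) (hD : D.numAgents = 1)
    {a : Fin C.numAgents} {a' : Fin D.numAgents} (hid : C.ident a = D.ident a')
    (hin : C.input a = D.input a')
    (hs : Same C.graph.code (C.start a) D.graph.code (D.start a'))
    (x : List Bool) (o : List Bool → Bool) (t : ℕ) :
    let σ := P.run C (fun _ => x) o t a
    let τ := P.run D (fun _ => x) o t a'
    Same C.graph.code σ.pos D.graph.code τ.pos ∧ σ.entry = τ.entry ∧ σ.mem = τ.mem := by
  induction t with
  | zero => exact ⟨hs, rfl, by simp [Protocol.run, hid, hin]⟩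
  | succ t ih =>
    obtain ⟨h1, h2, h3⟩ := ih
    simp only [Protocol.run]
    rcases hv : P.verdict (P.run C (fun _ => x) o t a).mem with _ | b
    · have hv' := hv
      rw [h3] at hv'
      rw [Protocol.step_of_none hv, Protocol.step_of_none hv', here_of_single P hC,
        here_of_single P hD, ← h3, ← h2, ← hid]
      have hd := h1.degree
      rw [PortGraph.degree_code, PortGraph.degree_code] at hd
      rw [← hd]
      generalize P.next _ = r
      have hm : Same C.graph.code
          (move C.graph.cross ((P.run C (fun _ => x) o t a).pos, 0) r.2).1 D.graph.code
          (move D.graph.cross ((P.run D (fun _ => x) o t a').pos, 0) r.2).1 ∧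
          (move C.graph.cross ((P.run C (fun _ => x) o t a).pos, 0) r.2).2 =
          (move D.graph.cross ((P.run D (fun _ => x) o t a').pos, 0) r.2).2 := by
        have e1 := C.graph.walk_code ((P.run C (fun _ => x) o t a).pos, 0) [r.2]
        have e2 := D.graph.walk_code ((P.run D (fun _ => x) o t a').pos, 0) [r.2]
        simp only [walk_cons, walk_nil] at e1 e2
        have k1 := h1.target [r.2]
        have k2 := congrArg Prod.fst (h1 [r.2])
        simp only [target, obs, walk_cons, walk_nil] at k1 k2
        rw [e1, e2] at k1 k2
        exact ⟨k1, k2⟩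
      exact ⟨hm.1, hm.2, rfl⟩
    · rw [Protocol.step_of_some (by rw [hv]; rfl),
        Protocol.step_of_some (by rw [← h3, hv]; rfl)]
      exact ⟨h1, rfl, h3⟩

/-- A verifiable problem does not distinguish single agents with equal views. -/
theorem mem_yes_of_same {A : Problem} {P : Protocol} (hP : Verifies P A)
    (hC : C.numAgents = 1) (hD : D.numAgents = 1) (hCA : C ∈ A.yes) (hDA : D ∈ A.instances)
    {a : Fin C.numAgents} {a' : Fin D.numAgents} (hid : C.ident a = D.ident a')
    (hin : C.input a = D.input a')
    (hs : Same C.graph.code (C.start a) D.graph.code (D.start a')) : D ∈ A.yes := by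
  by_contra hno
  obtain ⟨x, hx⟩ := (hP C (A.yes_subset hCA)).2.1 hCA
  -- With one agent a certificate is a single string, which can be handed to the agent of `D`.
  have hxa : x = fun _ => x a := funext fun b => by rw [unique_agent hC a b]
  rw [hxa] at hx
  obtain ⟨b, hb⟩ := (hP D hDA).2.2 hno fun _ => x a
  rw [unique_agent hD a' b] at hb
  obtain ⟨t, ht⟩ := hx a
  have : P.Decides D (fun _ => x a) noOracle a' true := by
    refine ⟨t, ?_⟩
    rw [← (run_of_same P hC hD hid hin hs (x a) noOracle t).2.2]
    exact ht
  exact absurd (this.unique hb) (by simp)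

end

/-! Reduction to `Ω` -/

/-- A candidate for the configuration: its code, its quotient graph, and the starting node of the
agent that considers it. -/
abbrev Candidate : Type := (AdjList × List (ℕ × ℕ × List Bool)) × GraphCode × ℕ

/-- The agents in the list `s` are those that the agent with identity `i` should see at node `u`. -/
def seenCheck (s : List (ℕ × List Bool)) (A : List (ℕ × ℕ × List Bool)) (i u : ℕ) : Bool :=
  (A.all fun b => !(decide (b.2.1 = i) || decide (b.1 = u)) || s.any fun z => decide (z = b.2)) &&
  s.all fun z => A.any fun b => (decide (b.2.1 = i) || decide (b.1 = u)) && decide (b.2 = z)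

/-- The words on which a candidate is tested. -/
def testWords (q : Candidate) : List (List ℕ) :=
  -- The summand `2 * n + 1` serves configurations with several agents, the square of the size of
  -- `H` separates the nodes of `H`, and the letters cover the ports of both graphs.
  words (maxDegree q.1.1 + maxDegree (adjList q.2.1)) (2 * q.1.1.length + 1 + q.2.1.1 * q.2.1.1)

/-- The candidate agrees with the record of the agent with identity `i`. -/
def recordCheck (i : ℕ) (log : List Sight) (q : Candidate) : Bool :=
  (testWords q).all fun w => log[Encodable.encode (i, w)]?.elim false fun e =>
    decide ((e.1, e.2.1) = obs q.1.1 q.2.2 w) &&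
      seenCheck e.2.2 q.1.2 i (target q.1.1 q.2.2 w)

/-- The candidate agrees with the answers of the black box. -/
def answerCheck (r : List (Option Bool)) (q : Candidate) : Bool :=
  -- Answers are stored by rounds, so the code of a question is its index. The second entry must be
  -- "no", since `quotient` asks for a graph different from `H`.
  decide (r[Encodable.encode ((1 : ℕ), bin (1 : ℕ))]? = some (some (decide (1 < q.1.2.length)))) &&
  decide (r[Encodable.encode ((2 : ℕ), bin q.2.1)]? = some (some false))

/-- The candidate agrees with all that is known. -/
def candidateCheck (k : Knowledge) (q : Candidate) : Bool :=
  (configCheck q.1 && q.1.2.any fun e => decide (e = (q.2.2, k.1.1, k.1.2.1))) &&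
  (quotientCheck q.1.1 q.2.2 q.2.1 && (recordCheck k.1.1 k.2.1 q && answerCheck k.2.2 q))

section Primrec
variable {α : Type*} [Primcodable α]

@[fun_prop]
theorem primrec_bin {β : Type} [Primcodable β] {f : α → β} (hf : Primrec f) :
    Primrec (fun a => bin (f a)) := by
  unfold bin; fun_prop

@[fun_prop]
theorem primrec_seenCheck {s : α → List (ℕ × List Bool)} {A : α → List (ℕ × ℕ × List Bool)}
    {i u : α → ℕ} (hs : Primrec s) (hA : Primrec A) (hi : Primrec i) (hu : Primrec u) :
    Primrec (fun a => seenCheck (s a) (A a) (i a) (u a)) := by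
  unfold seenCheck; fun_prop

@[fun_prop]
theorem primrec_testWords {q : α → Candidate} (hq : Primrec q) :
    Primrec (fun a => testWords (q a)) := by
  unfold testWords; fun_prop

@[fun_prop]
theorem primrec_recordCheck {i : α → ℕ} {log : α → List Sight} {q : α → Candidate}
    (hi : Primrec i) (hl : Primrec log) (hq : Primrec q) :
    Primrec (fun a => recordCheck (i a) (log a) (q a)) := by
  unfold recordCheck; fun_prop

@[fun_prop]
theorem primrec_answerCheck {r : α → List (Option Bool)} {q : α → Candidate}
    (hr : Primrec r) (hq : Primrec q) : Primrec (fun a => answerCheck (r a) (q a)) := by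
  unfold answerCheck; fun_prop

@[fun_prop]
theorem primrec_candidateCheck {k : α → Knowledge} {q : α → Candidate}
    (hk : Primrec k) (hq : Primrec q) : Primrec (fun a => candidateCheck (k a) (q a)) := by
  unfold candidateCheck; fun_prop

end Primrec

/-- The rule for decisions in the reduction: find a candidate, and answer as for it. -/
def reductionRule (inst yes : AdjList × List (ℕ × ℕ × List Bool) → Bool) (k : Knowledge) :
    Option Bool :=
  -- The first component of the slot number takes each value infinitely often, so every candidate is
  -- reconsidered when more is known.
  (Encodable.decode k.2.1.length.unpair.1 : Option Candidate).bind fun q =>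
    bif candidateCheck k q && inst q.1 then some (yes q.1) else none

/-- The algorithms recognizing the problem are merely computable; all other ingredients are
primitive recursive. -/
theorem computable_reductionRule {inst yes : AdjList × List (ℕ × ℕ × List Bool) → Bool}
    (hi : Computable inst) (hy : Computable yes) : Computable (reductionRule inst yes) := by
  have h1 : Primrec fun k : Knowledge =>
    (Encodable.decode k.2.1.length.unpair.1 : Option Candidate) := by fun_prop
  have h2 : Primrec fun p : Knowledge × Candidate => candidateCheck p.1 p.2 := by fun_prop
  have h3 : Computable fun p : Knowledge × Candidate => p.2.1 :=
    Computable.fst.comp Computable.snd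
  refine Computable.option_bind h1.to_comp
    (g := fun k q => bif candidateCheck k q && inst q.1 then some (yes q.1) else none) ?_
  exact Computable.cond (Primrec.and.to_comp.comp h2.to_comp (hi.comp h3))
    (Computable.option_some.comp (hy.comp h3)) (Computable.const none)

theorem seenCheck_iff {s : List (ℕ × List Bool)} {D : Config} {a' : Fin D.numAgents}
    {v : Fin D.graph.size} :
    seenCheck s D.code.2 (D.ident a') v = true ↔ ∀ z, z ∈ s ↔ z ∈ D.seen a' v := by
  have hb : ∀ b, D.ident b = D.ident a' ↔ b = a' := fun b => D.ident_injective.eq_iff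
  simp only [seenCheck, Bool.and_eq_true, List.all_eq_true, Bool.or_eq_true, Bool.not_eq_true',
    Bool.or_eq_false_iff, decide_eq_false_iff_not, List.any_eq_true, decide_eq_true_eq,
    Config.mem_code, mem_seen, forall_exists_index, forall_apply_eq_imp_iff, exists_eq_right]
  constructor
  · rintro ⟨h1, h2⟩ z
    constructor
    · intro hz
      obtain ⟨_, ⟨b, rfl⟩, h3, h4⟩ := h2 z hz
      refine ⟨b, h3.imp (hb b).1 Fin.ext, h4⟩
    · rintro ⟨b, h3, rfl⟩
      refine (h1 b).resolve_left fun h4 => ?_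
      rcases h3 with h3 | h3
      · exact h4.1 ((hb b).2 h3)
      · exact h4.2 (congrArg Fin.val h3)
  · intro h
    refine ⟨fun b => ?_, fun z hz => ?_⟩
    · by_cases h3 : b = a' ∨ D.start b = v
      · exact Or.inr ((h _).2 ⟨b, h3, rfl⟩)
      · left
        rw [not_or] at h3
        exact ⟨fun e => h3.1 ((hb b).1 e), fun e => h3.2 (Fin.ext e)⟩
    · obtain ⟨b, h3, rfl⟩ := (h z).1 hz
      exact ⟨_, ⟨b, rfl⟩, h3.imp (hb b).2 (congrArg Fin.val), rfl⟩

/-! ### Answers of the black box for `Omega` -/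

section BlackBox
variable (C : Config)

theorem withInput_mem_omega (w : List Bool) : C.withInput (fun _ => w) ∈ Omega.yes ↔
    (∃ k, parseTeam w = some k ∧ 0 < k ∧ k < C.numAgents) ∨
      ∃ H, parseQuotient w = some H ∧ ¬ C.graph.quotient.Isomorphic H.toGraph :=
  mem_omega_of_uniform (C := C.withInput fun _ => w) (fun _ _ => rfl) C.first

theorem blackBox_teamsize : blackBox Omega C (bin ((1 : ℕ), bin (1 : ℕ))) =
    decide (1 < C.numAgents) := by
  unfold blackBox
  rw [decide_eq_decide, withInput_mem_omega]
  constructor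
  · rintro (⟨k, hk, -, hlt⟩ | ⟨H, hH, -⟩)
    · have := bin_injective (parseTeam_eq_some.1 hk)
      simp only [Prod.mk.injEq, true_and] at this
      rw [← bin_injective this] at hlt
      exact hlt
    · have := bin_injective (parseQuotient_eq_some.1 hH)
      simp at this
  · intro h
    exact Or.inl ⟨1, parseTeam_eq_some.2 rfl, one_pos, h⟩

theorem blackBox_quotient (H : GraphCode) : blackBox Omega C (bin ((2 : ℕ), bin H)) = false ↔
    C.graph.quotient.Isomorphic H.toGraph := by
  unfold blackBox
  rw [decide_eq_false_iff_not, withInput_mem_omega]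
  constructor
  · intro h
    by_contra hi
    exact h (Or.inr ⟨H, parseQuotient_eq_some.2 rfl, hi⟩)
  · rintro h (⟨k, hk, -⟩ | ⟨H', hH, hi⟩)
    · have := bin_injective (parseTeam_eq_some.1 hk)
      simp at this
    · have := bin_injective (parseQuotient_eq_some.1 hH)
      simp only [Prod.mk.injEq, true_and] at this
      rw [← bin_injective this] at hi
      exact hi h

end BlackBox

theorem getElem?_answers {o : List Bool → Bool} {t j : ℕ} {b : Bool} :
    (answers o t)[j]? = some (some b) ↔ j < t ∧ o j.bits = b := by
  unfold answers
  rw [List.getElem?_map]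
  by_cases h : j < t
  · simp [h]
  · rw [List.getElem?_eq_none (by simpa using h)]
    simp [h]

/-- Each slot takes at least one round, so late slots also have many answers at their disposal. -/
theorem le_clock (s : ℕ) : s ≤ clock s := by
  induction s with
  | zero => exact Nat.zero_le _
  | succ s ih => simp only [clock]; omega

section
variable {C : Config} {x : Fin C.numAgents → List Bool} {a : Fin C.numAgents} {s : ℕ}

theorem recordCheck_iff {D : Config} {a' : Fin D.numAgents} {H : GraphCode}
    (hid : C.ident a = D.ident a') :
    recordCheck (C.ident a) ((List.range s).map (C.entry a)) (D.code, H, D.start a') = true ↔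
      ∀ w ∈ testWords (D.code, H, (D.start a').val), Encodable.encode (C.ident a, w) < s ∧
        obs C.graph.code (C.start a) w = obs D.graph.code (D.start a') w ∧
        ∀ z, z ∈ C.seen a (walk C.graph.cross (C.start a, 0) w).1 ↔
          z ∈ D.seen a' (walk D.graph.cross (D.start a', 0) w).1 := by
  unfold recordCheck
  rw [List.all_eq_true]
  refine forall₂_congr fun w _ => ?_
  by_cases h : Encodable.encode (C.ident a, w) < s
  · rw [getElem?_log h, Option.elim_some, Bool.and_eq_true, decide_eq_true_eq, obs_eq_sight]
    refine Iff.trans ?_ (and_iff_right h).symm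
    refine and_congr_right fun _ => ?_
    rw [hid]
    have ht : target D.code.1 (D.start a') w =
      (walk D.graph.cross (D.start a', 0) w).1 := target_sight w
    simp only
    rw [ht]
    exact seenCheck_iff
  · rw [List.getElem?_eq_none (by simpa using h)]
    simp only [Option.elim_none, Bool.false_eq_true, false_iff]
    exact fun h' => h h'.1

/-- An accepted candidate is the true configuration, or has a single agent with the same view. -/
theorem candidateCheck_sound {q : Candidate}
    (h : candidateCheck (C.knowledge x (blackBox Omega C) a s) q = true) :
    ∃ (D : Config) (a' : Fin D.numAgents), D.code = q.1 ∧ C.ident a = D.ident a' ∧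
      C.input a = D.input a' ∧ (D.Equivalent C ∨ C.numAgents = 1 ∧ D.numAgents = 1 ∧
        Same C.graph.code (C.start a) D.graph.code (D.start a')) := by
  obtain ⟨z, H, v⟩ := q
  simp only [candidateCheck, Bool.and_eq_true, List.any_eq_true, decide_eq_true_eq] at h
  obtain ⟨⟨h1, e, he, rfl⟩, h2, h3, h4⟩ := h
  obtain ⟨D, rfl⟩ := exists_config h1
  obtain ⟨a', ha'⟩ := Config.mem_code.1 he
  simp only [Config.knowledge, Prod.mk.injEq] at ha'
  obtain ⟨rfl, hid, hin⟩ := ha'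
  refine ⟨D, a', rfl, hid.symm, hin.symm, ?_⟩
  have h3 := (recordCheck_iff hid.symm).1 h3
  have hDH := (quotientCheck_iff (D.start a')).1 h2
  simp only [answerCheck, Bool.and_eq_true, decide_eq_true_eq, Config.knowledge, getElem?_answers,
    Config.length_code] at h4
  have hteam := (blackBox_teamsize C).symm.trans h4.1.2
  rw [decide_eq_decide] at hteam
  have hCH := (blackBox_quotient C H).1 h4.2.2
  by_cases hD : 1 < D.numAgents
  · left
    have hs : SeesAlike C D a a' (maxDegree D.graph.code + maxDegree (adjList H))
        (2 * D.graph.code.length + 1 + H.1 * H.1) :=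
      ⟨fun w hw => (h3 w hw).2.1, fun w hw => (h3 w hw).2.2⟩
    refine hs.equivalent hid.symm hin.symm (fun y => ?_) ?_ hD
    · exact degree_le_maxDegree y |>.trans (Nat.le_add_right _ _)
    · rw [PortGraph.length_code]; omega
  · right
    have := C.numAgents_pos
    have := D.numAgents_pos
    refine ⟨by omega, by omega, ?_⟩
    obtain ⟨hg, hC⟩ := Good.of_isomorphic hCH
    obtain ⟨y, hy, hsy⟩ := hC (C.start a)
    obtain ⟨y', hy', hsy'⟩ := (Good.of_isomorphic hDH).2 (D.start a')
    -- Both starting nodes have counterparts in the same graph `H`. The tested words agree, and they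
    -- are long enough to separate nodes of `H`, so the counterparts coincide.
    have hyy : Same (adjList H) y (adjList H) y' := by
      refine Alike.same hg.reversible hg.reversible degree_le_maxDegree (by simpa using hy)
        (by simpa using hy') fun w hw => ?_
      rw [mem_words, length_adjList] at hw
      have hw' : w ∈ testWords (D.code, H, (D.start a').val) :=
        mem_words.2 ⟨hw.1.trans (Nat.le_add_left _ _),
          fun p hp => (hw.2 p hp).trans (Nat.le_add_left _ _)⟩
      rw [← hsy w, ← hsy' w, (h3 w hw').2.1]
    obtain rfl := hg.reduced y hy y' hy' hyy
    exact hsy.trans hsy'.symm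

/-- The true configuration is accepted eventually. -/
theorem exists_candidateCheck (C : Config) (x : Fin C.numAgents → List Bool)
    (a : Fin C.numAgents) : ∃ H : GraphCode, ∃ n, ∀ s ≥ n,
      candidateCheck (C.knowledge x (blackBox Omega C) a s) (C.code, H, (C.start a).val) =
        true := by
  obtain ⟨H, hH⟩ := exists_code_quotient C.graph
  obtain ⟨n, hn⟩ := exists_explored (C.ident a) (testWords (C.code, H, (C.start a).val))
  -- Late enough for all test words and for both questions to the black box.
  refine ⟨H, n + Encodable.encode ((1 : ℕ), bin (1 : ℕ)) +
    Encodable.encode ((2 : ℕ), bin H) + 1, fun s hs => ?_⟩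
  have hs' := le_clock s
  simp only [candidateCheck, Bool.and_eq_true, List.any_eq_true, decide_eq_true_eq]
  refine ⟨⟨configCheck_code C, _, Config.mem_code.2 ⟨a, rfl⟩, rfl⟩,
    (quotientCheck_iff (C.start a)).2 hH, ?_, ?_⟩
  · refine (recordCheck_iff rfl).2 fun w hw => ⟨?_, rfl, fun _ => Iff.rfl⟩
    have := explored_iff.1 (hn ((List.range s).map (C.entry a)) (by simp; omega)) w hw
    simpa using this
  · simp only [answerCheck, Bool.and_eq_true, decide_eq_true_eq, Config.knowledge,
      getElem?_answers, Config.length_code]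
    exact ⟨⟨by omega, blackBox_teamsize C⟩, by omega, (blackBox_quotient C H).2 hH⟩

end

theorem reducible_omega {A : Problem} (hA : A ∈ MAV) : Reducible A Omega := by
  obtain ⟨⟨⟨inst, hi, hinst⟩, ⟨yes, hy, hyes⟩, -, hinv⟩, P, hP⟩ := hA
  refine ⟨fun C hC => hC, explorer (reductionRule inst yes) (computable_reductionRule hi hy),
    fun C hC => ?_⟩
  have key : ∀ a, ∃ b, (b = true ↔ C ∈ A.yes) ∧
      (explorer (reductionRule inst yes) (computable_reductionRule hi hy)).Decides C
        (fun _ => []) (blackBox Omega C) a b := by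
    intro a
    obtain ⟨H, n, hn⟩ := exists_candidateCheck C (fun _ => []) a
    obtain ⟨r, b, h1, h2⟩ := explorer_decides (D := reductionRule inst yes)
      (hD := computable_reductionRule hi hy) (C := C) (x := fun _ => []) (o := blackBox Omega C)
      (a := a)
      -- In this slot the true configuration is the candidate, and the number is at least `n`, so it
      -- is accepted unless another candidate was accepted before.
      (s := Nat.pair (Encodable.encode ((C.code, H, (C.start a).val) : Candidate)) n) (by
        have hs := hn (Nat.pair (Encodable.encode ((C.code, H, (C.start a).val) : Candidate)) n)
          (Nat.right_le_pair _ _)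
        unfold reductionRule
        rw [show (C.knowledge (fun _ => []) (blackBox Omega C) a (Nat.pair (Encodable.encode
          ((C.code, H, (C.start a).val) : Candidate)) n)).2.1.length = Nat.pair (Encodable.encode
          ((C.code, H, (C.start a).val) : Candidate)) n by simp [Config.knowledge],
          Nat.unpair_pair, Encodable.encodek, Option.bind_some, hs, (hinst C).1 hC]
        rfl)
    refine ⟨b, ?_, h2⟩
    unfold reductionRule at h1
    obtain ⟨q, -, hq⟩ := Option.bind_eq_some_iff.1 h1
    rcases hc : candidateCheck (C.knowledge (fun _ => []) (blackBox Omega C) a r) q &&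
      inst q.1 with _ | _
    · simp [hc] at hq
    · rw [hc, cond_true, Option.some.injEq] at hq
      rw [Bool.and_eq_true] at hc
      obtain ⟨D, a', hD, hid, hin, hor⟩ := candidateCheck_sound hc.1
      rw [← hq, ← hD, ← hyes]
      have hDi : D ∈ A.instances := (hinst D).2 (by rw [hD]; exact hc.2)
      rcases hor with he | ⟨hC1, hD1, hs⟩
      · exact hinv D C he
      -- Equality of views is symmetric, so positive answers carry over in both directions.
      · exact ⟨fun h => mem_yes_of_same hP hD1 hC1 h hC hid.symm hin.symm hs.symm,
          fun h => mem_yes_of_same hP hC1 hD1 h hDi hid hin hs⟩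
  refine ⟨fun a => ?_, fun h a => ?_, fun h => ?_⟩
  · obtain ⟨b, -, hb⟩ := key a
    exact ⟨b, hb⟩
  · obtain ⟨b, hb, hd⟩ := key a
    rwa [hb.2 h] at hd
  · obtain ⟨b, hb, hd⟩ := key C.first
    refine ⟨C.first, ?_⟩
    cases b
    · exact hd
    · exact absurd (hb.1 rfl) h

end MobileAgents

theorem theorem2 :
    MobileAgents.Complete MobileAgents.MAV MobileAgents.Omega ∧
    ∃ P : MobileAgents.Protocol, MobileAgents.Verifies P MobileAgents.Omega ∧
      ∀ C ∈ MobileAgents.Omega.yes, ∀ a,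
        P.Decides C (fun _ => MobileAgents.bin C.graph.size) MobileAgents.noOracle a true :=
  ⟨⟨⟨MobileAgents.isDecisionProblem_omega, _, MobileAgents.omegaProtocol_verifies⟩,
    fun _ hA => MobileAgents.reducible_omega hA⟩,
    _, MobileAgents.omegaProtocol_verifies,
    fun _ hC a => MobileAgents.omegaProtocol_complete hC _ a⟩
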